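/- Let $K$ be an algebraically closed field of characteristic $0$, let $S=K[x_0,\dots,x_n]$, and let $g=(a_{ij})\in \mathrm{GL}_{n+1}(K)$ act on $S$ by the $K$-algebra automorphism with $g\cdot x_i=\sum_j a_{ji}x_j$. Let $I\subseteq S$ be a saturated homogeneous ideal, defining $Z\subseteq\mathbb P^n$, let $P$ be the Hilbert polynomial of $S/I$, and let $m$ be the Gotzmann number of $P$, i.e. the least integer $m\ge 0$ such that every saturated homogeneous ideal with Hilbert polynomial $P$ is $m$-regular. The Hilbert scheme $\mathrm{Hilb}$ of subschemes of $\mathbb P^n$ with Hilbert polynomial $P$ is viewed inside the Grassmannian of subspaces of $S_m$, a saturated ideal $J$ with Hilbert polynomial $P$ corresponding to the point $J_m$. Let $f_1,\dots,f_r$ be a basis of $I_m$. Let $w=(w_0,\dots,w_n)\in\mathbb Z^{n+1}$ satisfy $w_0>w_1>\dots>w_n$ and distinguish monomials in every degree $d\le rm$: if $x^A\ne x^B$ are monomials of degree $d$, then $w\cdot A\neq w\cdot B$. For $t\in K^\times$ let $\lambda_w(t)=\mathrm{diag}(t^{-w_0},\dots,t^{-w_n})$. Let $G=(G_{ij})$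 be a matrix of indeterminates, and expand $Gf_1\wedge\dots\wedge Gf_r$ in the wedge products $x^{B_1}\wedge\dots\wedge x^{B_r}$ of monomials of degree $m$, the coefficients being polynomials in the $G_{ij}$. Let $U=U(f)\subseteq\mathrm{GL}_{n+1}(K)$ be the set of $g$ at which none of the not identically zero coefficients vanishes. Then $U$ is Zariski open and dense in $\mathrm{GL}_{n+1}(K)$, and for every $g\in U$ the following hold. 1. The path $t\mapsto \lambda_w(t)\,g I_m$, $t\ne0$, extends uniquely to a morphism $\gamma:\mathbb A^1\to\mathrm{Hilb}$, and its limit $\gamma(0)\in \mathrm{Hilb}$ as $t\to 0$ is fixed by the Borel group $B$ of invertible upper triangular matrices. 2. Suppose that $Z\neq\emptyset$ and $Z\ne\mathbb P^n$ (i.e. $I\neq S$ and $I\ne 0$), and put $V=\gamma(0)\subseteq S_m$. Then $\gamma$ has a unique tangent vector at $V$, meaning its first nonvanishing derivative at $t=0$: there is exactly one nonzero $\varphi\in\mathrm{Hom}_K(V,S_m/V)$ such that, for some $k\ge1$, every $v\in V$ extends to a section of the family $\gamma$ over $\mathbb A^1$ of the form $v+t^k u+O(t^{k+1})$ with $u\in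 S_m$ representing $\varphi(v)$. This $\varphi$ lies in the tangent space $T_V\mathrm{Hilb}\subseteq\mathrm{Hom}_K(V,S_m/V)$ (the ideal of $S[\varepsilon]$, $\varepsilon^2=0$, generated by all $v+\varepsilon u$ with $v\in V$ and $u$ representing $\varphi(v)$ has quotient flat over $K[\varepsilon]$), and it is an eigenvector for $B$: for every $h\in B$ there is $c\in K$ with $h\circ\varphi\circ h^{-1}=c\,\varphi$. -/

import Mathlib

namespace InfGalligo

open MvPolynomial
open scoped Polynomial

noncomputable section

/-! ### Forms, linear substitutions and base change -/

/-- The module `S_m` of forms of degree `m` in `x_0, …, x_n` with coefficients in `R`. -/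
abbrev Forms (R : Type*) [CommRing R] (n m : ℕ) :
    Submodule R (MvPolynomial (Fin (n + 1)) R) :=
  homogeneousSubmodule (Fin (n + 1)) R m

/-- The action of a matrix on polynomials: `g · x_i = ∑ j, g j i * x_j`. -/
def linSubst {R : Type*} [CommRing R] {n : ℕ} (g : Matrix (Fin (n + 1)) (Fin (n + 1)) R) :
    MvPolynomial (Fin (n + 1)) R →ₐ[R] MvPolynomial (Fin (n + 1)) R :=
  aeval fun i => ∑ j, C (g j i) * X j

theorem linSubst_mem {R : Type*} [CommRing R] {n m : ℕ}
    (g : Matrix (Fin (n + 1)) (Fin (n + 1)) R) (p : MvPolynomial (Fin (n + 1)) R)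
    (hp : p ∈ Forms R n m) : linSubst g p ∈ Forms R n m := by
  rw [mem_homogeneousSubmodule] at hp ⊢
  have h := hp.aeval (fun i => ∑ j, C (g j i) * X j) (n := 1) (fun i =>
    IsHomogeneous.sum _ _ _ fun j _ => by
      simpa using (isHomogeneous_C (Fin (n + 1)) (g j i)).mul (isHomogeneous_X R j))
  simpa [linSubst] using h

theorem linSubst_mul {R : Type*} [CommRing R] {n : ℕ}
    (g h : Matrix (Fin (n + 1)) (Fin (n + 1)) R) (p : MvPolynomial (Fin (n + 1)) R) :
    linSubst g (linSubst h p) = linSubst (g * h) p := by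
  have : (linSubst g).comp (linSubst h) = linSubst (g * h) := by
    apply MvPolynomial.algHom_ext
    intro i
    simp only [linSubst, AlgHom.comp_apply, aeval_X, map_sum, map_mul, Matrix.mul_apply,
      Finset.sum_mul, Finset.mul_sum, algHom_C, algebraMap_eq]
    rw [Finset.sum_comm]
    refine Finset.sum_congr rfl fun j _ => Finset.sum_congr rfl fun k _ => by ring
  exact DFunLike.congr_fun this p

theorem linSubst_one {R : Type*} [CommRing R] {n : ℕ} (p : MvPolynomial (Fin (n + 1)) R) :
    linSubst (1 : Matrix (Fin (n + 1)) (Fin (n + 1)) R) p = p := by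
  have : linSubst (1 : Matrix (Fin (n + 1)) (Fin (n + 1)) R) = AlgHom.id R _ := by
    apply MvPolynomial.algHom_ext
    intro i
    simp [linSubst, Matrix.one_apply]
  rw [this]; rfl

/-- The action of a matrix on `S_m`. -/
def matAct {R : Type*} [CommRing R] {n : ℕ} (m : ℕ)
    (g : Matrix (Fin (n + 1)) (Fin (n + 1)) R) : Forms R n m →ₗ[R] Forms R n m :=
  (linSubst g).toLinearMap.restrict fun p hp => linSubst_mem g p hp

/-- The action of an element of `GL_{n+1}` on `S_m`. -/
def glAct {R : Type*} [CommRing R] {n : ℕ} (m : ℕ) (g : GL (Fin (n + 1)) R) :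
    Forms R n m ≃ₗ[R] Forms R n m :=
  LinearEquiv.ofLinearMap (matAct m (g : Matrix (Fin (n + 1)) (Fin (n + 1)) R))
    (matAct m ((g⁻¹ : GL (Fin (n + 1)) R) : Matrix (Fin (n + 1)) (Fin (n + 1)) R))
    (by
      ext1 p
      apply Subtype.ext
      change linSubst _ (linSubst _ (p : MvPolynomial (Fin (n + 1)) R)) = p
      rw [linSubst_mul, ← Units.val_mul, mul_inv_cancel, Units.val_one, linSubst_one])
    (by
      ext1 p
      apply Subtype.ext
      change linSubst _ (linSubst _ (p : MvPolynomial (Fin (n + 1)) R)) = p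
      rw [linSubst_mul, ← Units.val_mul, inv_mul_cancel, Units.val_one, linSubst_one])

/-- Change of coefficients on forms along a ring homomorphism. -/
def coeffMap {R R' : Type*} [CommRing R] [CommRing R'] {n m : ℕ} (φ : R →+* R')
    (p : Forms R n m) : Forms R' n m :=
  ⟨MvPolynomial.map φ p.1,
    (mem_homogeneousSubmodule m _).2
      (IsHomogeneous.map ((mem_homogeneousSubmodule m _).1 p.2) φ)⟩

/-! ### Points of the Hilbert scheme, regularity and the Gotzmann number -/

section Hilbert

variable {K : Type*} [Field K] {n : ℕ}

/-- The graded piece `I_d`, as a subspace of `S_d`. -/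
def gradedPiece (I : Ideal (MvPolynomial (Fin (n + 1)) K)) (d : ℕ) :
    Submodule K (Forms K n d) :=
  (I.restrictScalars K).comap (Forms K n d).subtype

/-- `I` is a homogeneous ideal that is saturated with respect to `(x_0, …, x_n)`. These ideals
correspond to the closed subschemes of projective `n`-space. -/
def IsSaturatedIdeal (I : Ideal (MvPolynomial (Fin (n + 1)) K)) : Prop :=
  (∀ p ∈ I, ∀ d : ℕ, homogeneousComponent d p ∈ I) ∧
    ∀ p : MvPolynomial (Fin (n + 1)) K, (∀ i, ∃ k : ℕ, X i ^ k * p ∈ I) → p ∈ I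

/-- `P` is the Hilbert polynomial of `S / I`. -/
def HasHilbertPoly (I : Ideal (MvPolynomial (Fin (n + 1)) K)) (P : ℚ[X]) : Prop :=
  ∃ N : ℕ, ∀ d ≥ N,
    (Module.finrank K (Forms K n d ⧸ gradedPiece I d) : ℚ) = P.eval (d : ℚ)

/-- The `K`-points of the Hilbert scheme of projective `n`-space with Hilbert polynomial `P`,
as a set of subspaces of `S_m`: the graded pieces `I_m` of the saturated ideals `I` with Hilbert
polynomial `P`. -/
def hilb (K : Type*) [Field K] (n : ℕ) (P : ℚ[X]) (m : ℕ) : Set (Submodule K (Forms K n m)) :=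
  {V | ∃ I : Ideal (MvPolynomial (Fin (n + 1)) K),
    IsSaturatedIdeal I ∧ HasHilbertPoly I P ∧ V = gradedPiece I m}

/-- A minimal graded free resolution of a homogeneous ideal `I`:
`0 ← I ← ⨁_j S(-e_{0j}) ← ⋯ ← ⨁_j S(-e_{nj}) ← 0`, where `e_{ij} = deg i j`. -/
structure MinGradedFreeRes (I : Ideal (MvPolynomial (Fin (n + 1)) K)) where
  /-- the ranks of the free modules -/
  rank : ℕ → ℕ
  /-- the degrees of the basis elements -/
  deg : (i : ℕ) → Fin (rank i) → ℕ
  /-- the images in `I` of the basis elements of the first free module -/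
  gen : Fin (rank 0) → MvPolynomial (Fin (n + 1)) K
  /-- the matrices of the differentials -/
  diff : (i : ℕ) → Matrix (Fin (rank i)) (Fin (rank (i + 1))) (MvPolynomial (Fin (n + 1)) K)
  gen_homogeneous : ∀ j, (gen j).IsHomogeneous (deg 0 j)
  /-- the differentials have degree zero, and no entry is a nonzero constant -/
  diff_homogeneous : ∀ i k j, diff i k j = 0 ∨
    (deg i k < deg (i + 1) j ∧ (diff i k j).IsHomogeneous (deg (i + 1) j - deg i k))
  span_gen : Ideal.span (Set.range gen) = I
  exact_zero : ∀ v : Fin (rank 0) → MvPolynomial (Fin (n + 1)) K,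
    ∑ j, v j * gen j = 0 ↔ ∃ u, v = (diff 0).mulVec u
  exact_succ : ∀ (i : ℕ) (v : Fin (rank (i + 1)) → MvPolynomial (Fin (n + 1)) K),
    (diff i).mulVec v = 0 ↔ ∃ u, v = (diff (i + 1)).mulVec u
  length_le : ∀ i > n, rank i = 0

/-- The ideal `I` is `m`-regular: in its minimal graded free resolution, `e_{ij} - i ≤ m`. -/
def IsRegular (m : ℕ) (I : Ideal (MvPolynomial (Fin (n + 1)) K)) : Prop :=
  ∃ F : MinGradedFreeRes I, ∀ i j, F.deg i j ≤ m + i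

/-- `m` is the Gotzmann number of `P`: the least bound for the regularity of all saturated ideals
with Hilbert polynomial `P`. -/
def IsGotzmannNumber (K : Type*) [Field K] (n : ℕ) (P : ℚ[X]) (m : ℕ) : Prop :=
  IsLeast {m : ℕ | ∀ I : Ideal (MvPolynomial (Fin (n + 1)) K),
    IsSaturatedIdeal I → HasHilbertPoly I P → IsRegular m I} m

/-! ### Curves and tangent vectors on the Hilbert scheme -/

/-- The fibre over `t = a` of a family of subspaces of `S_m` over the affine line. -/
def fibre {m : ℕ} (M : Submodule K[X] (Forms K[X] n m)) (a : K) : Submodule K (Forms K n m) :=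
  Submodule.span K (coeffMap (Polynomial.evalRingHom a) '' (M : Set (Forms K[X] n m)))

/-- `M` is a morphism from the affine line to the Hilbert scheme: a `K[t]`-point of the
Grassmannian of `S_m` (a submodule of `S_m ⊗ K[t]` with flat, hence locally free, quotient) all
of whose fibres are points of the Hilbert scheme. -/
def IsHilbCurve {m : ℕ} (P : ℚ[X]) (M : Submodule K[X] (Forms K[X] n m)) : Prop :=
  Module.Flat K[X] (Forms K[X] n m ⧸ M) ∧ ∀ a : K, fibre M a ∈ hilb K n P m

/-- The diagonal matrix `λ_w(t)` with entries `t ^ (-w_0), …, t ^ (-w_n)`. -/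
def oneParam (w : Fin (n + 1) → ℤ) (t : K) : Matrix (Fin (n + 1)) (Fin (n + 1)) K :=
  Matrix.diagonal fun i => t ^ (-w i)

/-- `M` is the extension to the affine line of the path `t ↦ λ_w(t) g V`, `t ≠ 0`, on the Hilbert
scheme; its fibre at `0` is the limit of the path. -/
def IsPath {m : ℕ} (P : ℚ[X]) (w : Fin (n + 1) → ℤ) (g : GL (Fin (n + 1)) K)
    (V : Submodule K (Forms K n m)) (M : Submodule K[X] (Forms K[X] n m)) : Prop :=
  IsHilbCurve P M ∧
    ∀ a : K, a ≠ 0 → fibre M a = (V.map (glAct m g).toLinearMap).map (matAct m (oneParam w a))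

/-- The tangent space `Hom(V, S_m / V)` of the Grassmannian of `S_m` at `V`. -/
abbrev GrassTangent {m : ℕ} (V : Submodule K (Forms K n m)) : Type _ :=
  V →ₗ[K] (Forms K n m ⧸ V)

/-- The ideal of `S[ε]` generated by the elements `v + ε u` with `v ∈ V` and `u ∈ S_m` a
representative of `φ v`. -/
def deformationIdeal {m : ℕ} (V : Submodule K (Forms K n m)) (φ : GrassTangent V) :
    Ideal (MvPolynomial (Fin (n + 1)) (DualNumber K)) :=
  Ideal.span {q | ∃ (v : V) (u : Forms K n m), V.mkQ u = φ v ∧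
    q = MvPolynomial.map (algebraMap K (DualNumber K)) (v : Forms K n m).1 +
      C DualNumber.eps * MvPolynomial.map (algebraMap K (DualNumber K)) u.1}

/-- `φ` is tangent to the Hilbert scheme at its point `V`: the corresponding first order
deformation is flat over `K[ε]`. -/
def IsHilbTangent {m : ℕ} (V : Submodule K (Forms K n m)) (φ : GrassTangent V) : Prop :=
  Module.Flat (DualNumber K)
    (MvPolynomial (Fin (n + 1)) (DualNumber K) ⧸ deformationIdeal V φ)

/-- `φ` is the tangent vector at `t = 0` to the curve `M`: its first nonvanishing derivative at
`t = 0`. That is, `φ ≠ 0` and, for some `k ≥ 1`, every `v` in the fibre `V` of `M` at `0` extends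
to a section `v + t^k u + O(t^(k+1))` of `M` where `u` represents `φ v` modulo `V`. -/
def IsTangentVectorAtZero {m : ℕ} (M : Submodule K[X] (Forms K[X] n m))
    (φ : GrassTangent (fibre M 0)) : Prop :=
  φ ≠ 0 ∧ ∃ k : ℕ, 1 ≤ k ∧ ∀ v : fibre M 0, ∃ (u : Forms K n m) (q : Forms K[X] n m),
    (fibre M 0).mkQ u = φ v ∧
    coeffMap Polynomial.C (v : Forms K n m) +
      (Polynomial.X ^ k : K[X]) • coeffMap Polynomial.C u +
      (Polynomial.X ^ (k + 1) : K[X]) • q ∈ M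

/-! ### The Borel group -/

/-- `g` is upper triangular. -/
def IsUpperTri (g : GL (Fin (n + 1)) K) : Prop :=
  ∀ i j : Fin (n + 1), j < i → (g : Matrix (Fin (n + 1)) (Fin (n + 1)) K) i j = 0

/-- `V` is fixed by the Borel group of upper triangular matrices. -/
def BorelFixed {m : ℕ} (V : Submodule K (Forms K n m)) : Prop :=
  ∀ h : GL (Fin (n + 1)) K, IsUpperTri h → V.map (glAct m h).toLinearMap = V

/-- The action `φ ↦ h ∘ φ ∘ h⁻¹` of an element `h` of the stabilizer of `V` on tangent vectors
at `V`. -/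
def tangentAct {m : ℕ} {V : Submodule K (Forms K n m)} (h : GL (Fin (n + 1)) K)
    (hV : V.map (glAct m h).toLinearMap = V) (φ : GrassTangent V) : GrassTangent V :=
  (Submodule.Quotient.equiv V V (glAct m h) hV).toLinearMap ∘ₗ φ ∘ₗ
    ((glAct m h).ofSubmodules V V hV).symm.toLinearMap

/-- `φ` is an eigenvector for the Borel group. -/
def IsBorelEigenvector {m : ℕ} {V : Submodule K (Forms K n m)} (hV : BorelFixed V)
    (φ : GrassTangent V) : Prop :=
  φ ≠ 0 ∧ ∀ (h : GL (Fin (n + 1)) K) (hh : IsUpperTri h),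
    ∃ c : K, tangentAct h (hV h hh) φ = c • φ

/-! ### Weights and generic coordinates -/

/-- The weight vector `w` distinguishes the monomials of degree `d`. -/
def Distinguishes (w : Fin (n + 1) → ℤ) (d : ℕ) : Prop :=
  ∀ A B : Fin (n + 1) →₀ ℕ, A.degree = d → B.degree = d → A ≠ B →
    ∑ i, w i * (A i : ℤ) ≠ ∑ i, w i * (B i : ℤ)

/-- For `f = f_1 ∧ ⋯ ∧ f_r` and the generic matrix `G = (G_ij)`, the coefficient of the state
`x^{B_1} ∧ ⋯ ∧ x^{B_r}` in `G f = G f_1 ∧ ⋯ ∧ G f_r`, a polynomial in the `G_ij`. It is the minor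
of the coefficients of `x^{B_1}, …, x^{B_r}` in `G f_1, …, G f_r`. -/
def stateCoeff {r : ℕ} (f : Fin r → MvPolynomial (Fin (n + 1)) K)
    (B : Fin r → (Fin (n + 1) →₀ ℕ)) : MvPolynomial (Fin (n + 1) × Fin (n + 1)) K :=
  Matrix.det (Matrix.of fun i j => coeff (B j)
    (linSubst (Matrix.mvPolynomialX (Fin (n + 1)) (Fin (n + 1)) K) (MvPolynomial.map C (f i))))

/-- The value at `g` of a polynomial in the matrix entries. -/
def evalMatrix (g : GL (Fin (n + 1)) K) (p : MvPolynomial (Fin (n + 1) × Fin (n + 1)) K) : K :=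
  MvPolynomial.eval (fun ij => (g : Matrix (Fin (n + 1)) (Fin (n + 1)) K) ij.1 ij.2) p

/-- The set `U(f)` for `f = f_1 ∧ ⋯ ∧ f_r`, with `f_i` of degree `m`: the `g` in `GL_{n+1}` at
which none of the not identically zero coefficients of `G f` vanishes. -/
def genericSet {r : ℕ} (m : ℕ) (f : Fin r → MvPolynomial (Fin (n + 1)) K) :
    Set (GL (Fin (n + 1)) K) :=
  {g | ∀ B : Fin r → (Fin (n + 1) →₀ ℕ), (∀ j, (B j).degree = m) →
    stateCoeff f B ≠ 0 → evalMatrix g (stateCoeff f B) ≠ 0}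

/-- Zariski open subsets of `GL_{n+1}(K)`. -/
def IsZariskiOpen (U : Set (GL (Fin (n + 1)) K)) : Prop :=
  ∃ T : Set (MvPolynomial (Fin (n + 1) × Fin (n + 1)) K),
    U = {g | ∃ p ∈ T, evalMatrix g p ≠ 0}

/-- Zariski dense subsets of `GL_{n+1}(K)`. -/
def IsZariskiDense (U : Set (GL (Fin (n + 1)) K)) : Prop :=
  ∀ O : Set (GL (Fin (n + 1)) K), IsZariskiOpen O → O.Nonempty → (O ∩ U).Nonempty

end Hilbert

end

end InfGalligo

namespace InfGalligo

open MvPolynomial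
open scoped Polynomial

noncomputable section

/-!
Choose a basis `F_i` of `(g I)_m` that is reduced for the order given by the weights: `F_i` has the
leading monomial `x^{b_i}`, which occurs in no other `F_j`, and all its other terms have smaller
weight. After division by a power of `t`, the forms `λ_w(t) F_i` become `x^{b_i}` plus terms
divisible by `t`, so over the affine line they span the graph of a map out of the span of the
`x^{b_i}`. This graph is the only flat extension of the path, and its fibre at `0` is spanned by the
`x^{b_i}`. That fibre is the degree `m` piece of the limit ideal, which has the Hilbert function of
`I` in large degrees. Because `m` bounds the regularity both of `g I` and of the saturation of the
limit ideal, their Hilbert functions agree in all degrees `≥ m`, and the limit is a point of the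
Hilbert scheme.

For `g ∈ U` the space `(g I)_m` has all the states (nonvanishing Plücker coordinates) of its
translates. If an upper triangular `h` moved some monomial of the limit out of it, solving for the
coefficients by Cramer's rule would produce a state of a translate, and hence a monomial `x^A` of
some `F_i`; but `h` raises weights, whereas `x^A` has smaller weight than `x^{b_i}`.

The tangent vector is read off from the smallest gap `k` between the weight of `x^{b_i}` and that of
another term of `F_i`: the terms realizing this gap are the coefficients of `t^k`. Since `w`
distinguishes the monomials of degree `r m`, all pairs `(x^{b_i}, x^A)` realizing the gap have the
same quotient `x^A / x^{b_i}`, so diagonal matrices act on the tangent vector by a character, and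
the argument for the limit extends this to the Borel group. The gap exists, because otherwise
`(g I)_m` would be spanned by monomials and, by genericity, invariant under `GL_{n+1}`.
-/

/-! ### Homogeneous components and homogeneous ideals -/

section Homogeneous

variable {σ R R' : Type*} [CommRing R] [CommRing R']

attribute [local instance] MvPolynomial.gradedAlgebra in
theorem homogeneousComponent_mul_of_isHomogeneous {p q : MvPolynomial σ R} {a : ℕ}
    (hp : p.IsHomogeneous a) (N : ℕ) :
    homogeneousComponent N (p * q) = if a ≤ N then p * homogeneousComponent (N - a) q else 0 := by
  have e : ∀ (x : MvPolynomial σ R) (k : ℕ),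
      (DirectSum.decompose (homogeneousSubmodule σ R) x k : MvPolynomial σ R) =
        homogeneousComponent k x := fun x k => decomposition.decompose'_apply x k
  rw [← e, ← e]
  exact DirectSum.coe_decompose_mul_of_left_mem (𝒜 := homogeneousSubmodule σ R) (b := q) N
    ((mem_homogeneousSubmodule a p).2 hp)

theorem homogeneousComponent_map (φ : R →+* R') (d : ℕ) (p : MvPolynomial σ R) :
    homogeneousComponent d (map φ p) = map φ (homogeneousComponent d p) := by
  ext A
  simp only [coeff_homogeneousComponent, coeff_map]
  split_ifs <;> simp

/-- Homogeneous ideals, in the elementwise form that also appears in `IsSaturatedIdeal`. -/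
def IsHomogeneousIdeal (I : Ideal (MvPolynomial σ R)) : Prop :=
  ∀ p ∈ I, ∀ d : ℕ, homogeneousComponent d p ∈ I

theorem mem_of_homogeneousComponent_mem {I : Ideal (MvPolynomial σ R)} {p : MvPolynomial σ R}
    (h : ∀ d, homogeneousComponent d p ∈ I) : p ∈ I := by
  rw [← sum_homogeneousComponent p]
  exact Ideal.sum_mem _ fun d _ => h d

theorem coeff_eq_zero_of_mem_span {s : Set (MvPolynomial σ R)} {m : ℕ}
    (hs : ∀ p ∈ s, p.IsHomogeneous m) {p : MvPolynomial σ R} (hp : p ∈ Ideal.span s)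
    {A : σ →₀ ℕ} (hA : A.degree < m) : coeff A p = 0 := by
  classical
  induction hp using Submodule.span_induction generalizing A with
  | mem x hx => exact (hs x hx).coeff_eq_zero hA.ne
  | zero => exact coeff_zero A
  | add x y _ _ hx hy => rw [coeff_add, hx hA, hy hA, add_zero]
  | smul a x _ hx =>
    rw [smul_eq_mul, coeff_mul]
    refine Finset.sum_eq_zero fun B hB => ?_
    have hdeg : B.2.degree ≤ A.degree := by
      rw [← Finset.HasAntidiagonal.mem_antidiagonal.1 hB, map_add]
      exact Nat.le_add_left _ _
    rw [hx (hdeg.trans_lt hA), mul_zero]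

theorem isHomogeneousIdeal_map {I : Ideal (MvPolynomial σ R)} (hI : IsHomogeneousIdeal I)
    (φ : R →+* R') (hφ : Function.Surjective φ) :
    IsHomogeneousIdeal (I.map (MvPolynomial.map φ)) := by
  intro p hp d
  obtain ⟨q, hq, rfl⟩ := (Ideal.mem_map_iff_of_surjective _ (map_surjective φ hφ)).1 hp
  rw [homogeneousComponent_map]
  exact Ideal.mem_map_of_mem _ (hI q hq d)

end Homogeneous

/-! ### Forms -/

section Forms

variable {R : Type*} [CommRing R] {n : ℕ}

/-- The exponents of the monomials of degree `d`. -/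
abbrev Exps (n d : ℕ) : Finset (Fin (n + 1) →₀ ℕ) := Finset.univ.finsuppAntidiag d

theorem mem_exps {d : ℕ} {A : Fin (n + 1) →₀ ℕ} : A ∈ Exps n d ↔ A.degree = d := by
  simp [Exps, Finset.mem_finsuppAntidiag, Finsupp.degree_eq_sum]

theorem card_exps (n d : ℕ) : (Exps n d).card = (d + n).choose n := by
  rw [Exps, Finset.card_finsuppAntidiag_nat_eq_choose]
  simp only [Finset.card_univ, Fintype.card_fin]
  rw [show n + 1 + d - 1 = d + n by omega, ← Nat.choose_symm_of_eq_add (add_comm d n)]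

theorem Forms.coeff_eq_zero {d : ℕ} (p : Forms R n d) {A : Fin (n + 1) →₀ ℕ}
    (hA : A.degree ≠ d) : coeff A p.1 = 0 :=
  ((mem_homogeneousSubmodule d p.1).1 p.2).coeff_eq_zero hA

/-- A form is determined by its coefficients. -/
def formsEquiv (R : Type*) [CommRing R] (n d : ℕ) : Forms R n d ≃ₗ[R] (Exps n d → R) where
  toFun p A := coeff A.1 p.1
  map_add' p q := by ext A; simp
  map_smul' c p := by ext A; simp
  invFun v := ⟨∑ A : Exps n d, monomial A.1 (v A), Submodule.sum_mem _ fun A _ =>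
    (mem_homogeneousSubmodule d _).2 (isHomogeneous_monomial _ (mem_exps.1 A.2))⟩
  left_inv p := by
    apply Subtype.ext
    ext B
    simp only [coeff_sum, coeff_monomial]
    by_cases hB : B ∈ Exps n d
    · rw [Finset.sum_eq_single ⟨B, hB⟩] <;> simp +contextual [Subtype.ext_iff]
    · rw [Finset.sum_eq_zero, Forms.coeff_eq_zero p fun h => hB (mem_exps.2 h)]
      intro A _
      rw [if_neg]
      rintro rfl
      exact hB A.2
  right_inv v := by
    ext B
    simp only [coeff_sum, coeff_monomial]
    rw [Finset.sum_eq_single B]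
    · simp
    · intro A _ hA
      rw [if_neg fun h => hA (Subtype.ext h)]
    · simp

instance (d : ℕ) : Module.Finite R (Forms R n d) :=
  Module.Finite.equiv (formsEquiv R n d).symm

theorem finrank_forms [StrongRankCondition R] (n d : ℕ) :
    Module.finrank R (Forms R n d) = (d + n).choose n := by
  rw [(formsEquiv R n d).finrank_eq, Module.finrank_fintype_fun_eq_card, Fintype.card_coe,
    card_exps]

/-- The monomial with exponent `A`, as a form. -/
def monoForm (R : Type*) [CommRing R] {n d : ℕ} (A : Fin (n + 1) →₀ ℕ) (hA : A.degree = d) :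
    Forms R n d :=
  ⟨monomial A 1, (mem_homogeneousSubmodule d _).2 (isHomogeneous_monomial _ hA)⟩

/-- The forms of degree `d` in an ideal. -/
def idealForms (I : Ideal (MvPolynomial (Fin (n + 1)) R)) (d : ℕ) : Submodule R (Forms R n d) :=
  (I.restrictScalars R).comap (Forms R n d).subtype

theorem mem_idealForms {I : Ideal (MvPolynomial (Fin (n + 1)) R)} {d : ℕ} {p : Forms R n d} :
    p ∈ idealForms I d ↔ p.1 ∈ I := Iff.rfl

theorem mem_gradedPiece {K : Type*} [Field K] {I : Ideal (MvPolynomial (Fin (n + 1)) K)} {d : ℕ}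
    {p : Forms K n d} : p ∈ gradedPiece I d ↔ p.1 ∈ I := Iff.rfl

theorem linSubst_homogeneousComponent (g : Matrix (Fin (n + 1)) (Fin (n + 1)) R) (d : ℕ)
    (p : MvPolynomial (Fin (n + 1)) R) :
    linSubst g (homogeneousComponent d p) = homogeneousComponent d (linSubst g p) := by
  conv_rhs => rw [← sum_homogeneousComponent p]
  simp only [map_sum]
  rw [Finset.sum_congr rfl fun i _ => homogeneousComponent_of_mem
    (linSubst_mem g _ (homogeneousComponent_mem i p))]
  rw [Finset.sum_ite_eq]
  split_ifs with h
  · rfl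
  · rw [homogeneousComponent_eq_zero, map_zero]
    simpa [Nat.lt_succ_iff] using h

theorem glAct_apply {m : ℕ} (g : GL (Fin (n + 1)) R) (p : Forms R n m) :
    (glAct m g p).1 = linSubst (g : Matrix (Fin (n + 1)) (Fin (n + 1)) R) p.1 := rfl

/-- The change of coefficients `coeffMap`, as a semilinear map. -/
def coeffMapₛₗ {R' : Type*} [CommRing R'] {m : ℕ} (φ : R →+* R') :
    Forms R n m →ₛₗ[φ] Forms R' n m where
  toFun := coeffMap φ
  map_add' p q := Subtype.ext (map_add (MvPolynomial.map φ) p.1 q.1)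
  map_smul' c p := Subtype.ext (by simp [coeffMap, smul_eq_C_mul])

@[simp]
theorem coeff_coeffMap {R' : Type*} [CommRing R'] {m : ℕ} (φ : R →+* R')
    (p : Forms R n m) (A : Fin (n + 1) →₀ ℕ) :
    coeff A (coeffMap φ p).1 = φ (coeff A p.1) :=
  coeff_map _ _ _

theorem Forms.ext_coeff {m : ℕ} {p q : Forms R n m} (h : ∀ A, coeff A p.1 = coeff A q.1) :
    p = q := Subtype.ext (MvPolynomial.ext _ _ h)

/-- A coefficient, as a linear map on forms. -/
def coeffForm {m : ℕ} (A : Fin (n + 1) →₀ ℕ) : Forms R n m →ₗ[R] R :=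
  lcoeff R A ∘ₗ (Forms R n m).subtype

theorem Forms.coeff_sum {ι : Type*} {m : ℕ} (s : Finset ι) (p : ι → Forms R n m)
    (A : Fin (n + 1) →₀ ℕ) : coeff A (∑ i ∈ s, p i).1 = ∑ i ∈ s, coeff A (p i).1 :=
  map_sum (coeffForm A) p s

theorem Forms.coeff_smul {m : ℕ} (c : R) (p : Forms R n m) (A : Fin (n + 1) →₀ ℕ) :
    coeff A (c • p).1 = c * coeff A p.1 :=
  MvPolynomial.coeff_smul A c p.1

theorem Forms.coeff_add {m : ℕ} (p q : Forms R n m) (A : Fin (n + 1) →₀ ℕ) :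
    coeff A (p + q).1 = coeff A p.1 + coeff A q.1 :=
  MvPolynomial.coeff_add A p.1 q.1

theorem Forms.coeff_sub {m : ℕ} (p q : Forms R n m) (A : Fin (n + 1) →₀ ℕ) :
    coeff A (p - q).1 = coeff A p.1 - coeff A q.1 :=
  map_sub (coeffForm A) p q

theorem Forms.coeff_zero {m : ℕ} (A : Fin (n + 1) →₀ ℕ) : coeff A (0 : Forms R n m).1 = 0 :=
  MvPolynomial.coeff_zero A

end Forms

/-! ### Fibres of families -/

section Fibre

variable {K : Type*} [Field K] {n : ℕ}

theorem evalRingHom_surjective (a : K) : Function.Surjective (Polynomial.evalRingHom a) :=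
  fun c => ⟨Polynomial.C c, by simp⟩

theorem mem_fibre {m : ℕ} {M : Submodule K[X] (Forms K[X] n m)} {a : K} {v : Forms K n m} :
    v ∈ fibre M a ↔ ∃ q ∈ M, coeffMap (Polynomial.evalRingHom a) q = v := by
  have : RingHomSurjective (Polynomial.evalRingHom a) := ⟨evalRingHom_surjective a⟩
  have hfibre : fibre M a = M.map (coeffMapₛₗ (Polynomial.evalRingHom a)) :=
    Submodule.span_eq (M.map (coeffMapₛₗ (Polynomial.evalRingHom a)))
  rw [hfibre]
  exact Submodule.mem_map

theorem fibre_idealForms {J : Ideal (MvPolynomial (Fin (n + 1)) K[X])}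
    (hJ : IsHomogeneousIdeal J) (d : ℕ) (a : K) :
    fibre (idealForms J d) a =
      gradedPiece (J.map (MvPolynomial.map (Polynomial.evalRingHom a))) d := by
  ext v
  rw [mem_fibre, mem_gradedPiece,
    Ideal.mem_map_iff_of_surjective _ (map_surjective _ (evalRingHom_surjective a))]
  constructor
  · rintro ⟨q, hq, rfl⟩
    exact ⟨q.1, hq, rfl⟩
  · rintro ⟨q, hq, hqv⟩
    refine ⟨⟨homogeneousComponent d q, homogeneousComponent_mem d q⟩, hJ q hq d, Subtype.ext ?_⟩
    change MvPolynomial.map _ (homogeneousComponent d q) = v.1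
    rw [← homogeneousComponent_map, hqv]
    exact homogeneousComponent_eq_self v.2

end Fibre

/-! ### Regularity and Hilbert functions -/

section GradedFree

variable {R : Type*} [CommRing R] {n : ℕ}

/-- The forms of degree `d` in the graded module `S(-e)`. -/
def shiftForms (R : Type*) [CommRing R] (n e d : ℕ) : Submodule R (MvPolynomial (Fin (n + 1)) R) :=
  if e ≤ d then Forms R n (d - e) else ⊥

/-- The component of degree `d` of an element of `S(-e)`. -/
def shiftComponent (R : Type*) [CommRing R] (n e d : ℕ) :
    MvPolynomial (Fin (n + 1)) R →ₗ[R] MvPolynomial (Fin (n + 1)) R :=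
  if e ≤ d then homogeneousComponent (d - e) else 0

theorem shiftForms_of_le {e d : ℕ} (h : e ≤ d) : shiftForms R n e d = Forms R n (d - e) :=
  if_pos h

theorem shiftForms_of_lt {e d : ℕ} (h : d < e) : shiftForms R n e d = ⊥ :=
  if_neg h.not_ge

instance (e d : ℕ) : Module.Finite R (shiftForms R n e d) := by
  obtain h | h := le_or_gt e d
  · rw [shiftForms_of_le h]
    infer_instance
  · rw [shiftForms_of_lt h]
    infer_instance

theorem shiftComponent_mem (e d : ℕ) (p : MvPolynomial (Fin (n + 1)) R) :
    shiftComponent R n e d p ∈ shiftForms R n e d := by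
  unfold shiftComponent shiftForms
  split_ifs
  · exact homogeneousComponent_mem _ _
  · exact Submodule.zero_mem _

theorem shiftComponent_of_mem {e d : ℕ} {p : MvPolynomial (Fin (n + 1)) R}
    (hp : p ∈ shiftForms R n e d) : shiftComponent R n e d p = p := by
  unfold shiftComponent
  unfold shiftForms at hp
  split_ifs at hp ⊢
  · exact homogeneousComponent_eq_self hp
  · exact ((Submodule.mem_bot R).1 hp).symm

theorem shiftComponent_mul {e e' d : ℕ} {p q : MvPolynomial (Fin (n + 1)) R} (h : e ≤ e')
    (hp : p.IsHomogeneous (e' - e)) :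
    shiftComponent R n e d (p * q) = p * shiftComponent R n e' d q := by
  unfold shiftComponent
  by_cases hed : e ≤ d
  · rw [if_pos hed, homogeneousComponent_mul_of_isHomogeneous hp]
    by_cases hed' : e' ≤ d
    · rw [if_pos (by omega), if_pos hed', show d - e - (e' - e) = d - e' by omega]
    · rw [if_neg (by omega), if_neg hed', LinearMap.zero_apply, mul_zero]
  · rw [if_neg hed, if_neg (by omega), LinearMap.zero_apply, LinearMap.zero_apply, mul_zero]

variable {ι κ : Type*}

/-- The forms of degree `d` in the graded free module `⨁ S(-e_j)`. -/
def freeForms (R : Type*) [CommRing R] (n : ℕ) (e : ι → ℕ) (d : ℕ) :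
    Submodule R (ι → MvPolynomial (Fin (n + 1)) R) :=
  Submodule.pi Set.univ fun j => shiftForms R n (e j) d

/-- The forms of degree `d` in a graded free module, componentwise. -/
def freeFormsEquiv (e : ι → ℕ) (d : ℕ) :
    freeForms R n e d ≃ₗ[R] ((j : ι) → shiftForms R n (e j) d) where
  toFun v j := ⟨v.1 j, v.2 j trivial⟩
  map_add' _ _ := rfl
  map_smul' _ _ := rfl
  invFun v := ⟨fun j => (v j).1, fun j _ => (v j).2⟩
  left_inv _ := rfl
  right_inv _ := rfl

instance [Finite ι] (e : ι → ℕ) (d : ℕ) : Module.Finite R (freeForms R n e d) :=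
  Module.Finite.equiv (freeFormsEquiv e d).symm

/-- The component of degree `d` of an element of a graded free module. -/
def freeComponent (e : ι → ℕ) (d : ℕ) (v : ι → MvPolynomial (Fin (n + 1)) R) :
    ι → MvPolynomial (Fin (n + 1)) R :=
  fun j => shiftComponent R n (e j) d (v j)

theorem freeComponent_mem (e : ι → ℕ) (d : ℕ) (v : ι → MvPolynomial (Fin (n + 1)) R) :
    freeComponent e d v ∈ freeForms R n e d :=
  fun j _ => shiftComponent_mem (e j) d (v j)

theorem freeComponent_of_mem {e : ι → ℕ} {d : ℕ} {v : ι → MvPolynomial (Fin (n + 1)) R}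
    (hv : v ∈ freeForms R n e d) : freeComponent e d v = v :=
  funext fun j => shiftComponent_of_mem (hv j trivial)

/-- `D` is the matrix of a map `⨁ S(-e'_j) → ⨁ S(-e_i)` of degree zero. -/
def IsDegreeZero (e : ι → ℕ) (e' : κ → ℕ) (D : Matrix ι κ (MvPolynomial (Fin (n + 1)) R)) : Prop :=
  ∀ i j, D i j = 0 ∨ (e i ≤ e' j ∧ (D i j).IsHomogeneous (e' j - e i))

/-- Multiplication by a matrix of polynomials, linear over the coefficient ring only. -/
def mulVecMap [Fintype κ] (D : Matrix ι κ (MvPolynomial (Fin (n + 1)) R)) :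
    (κ → MvPolynomial (Fin (n + 1)) R) →ₗ[R] (ι → MvPolynomial (Fin (n + 1)) R) :=
  D.mulVecLin.restrictScalars R

theorem mulVecMap_apply [Fintype κ] (D : Matrix ι κ (MvPolynomial (Fin (n + 1)) R))
    (v : κ → MvPolynomial (Fin (n + 1)) R) : mulVecMap D v = D.mulVec v := rfl

namespace IsDegreeZero

variable [Fintype κ] {e : ι → ℕ} {e' : κ → ℕ} {D : Matrix ι κ (MvPolynomial (Fin (n + 1)) R)}

theorem freeComponent_mulVec (hD : IsDegreeZero e e' D) (d : ℕ)
    (v : κ → MvPolynomial (Fin (n + 1)) R) :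
    freeComponent e d (D.mulVec v) = D.mulVec (freeComponent e' d v) := by
  funext i
  simp only [freeComponent, Matrix.mulVec, dotProduct, map_sum]
  refine Finset.sum_congr rfl fun j _ => ?_
  obtain h | ⟨hle, hhom⟩ := hD i j
  · simp only [h, zero_mul, map_zero]
  · exact shiftComponent_mul hle hhom

theorem map_freeForms_le (hD : IsDegreeZero e e' D) (d : ℕ) :
    (freeForms R n e' d).map (mulVecMap D) ≤ freeForms R n e d := by
  rintro _ ⟨v, hv, rfl⟩
  rw [mulVecMap_apply, ← freeComponent_of_mem hv, ← hD.freeComponent_mulVec]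
  exact freeComponent_mem _ _ _

end IsDegreeZero

end GradedFree

section Regularity

variable {K : Type*} [Field K] {n : ℕ}

/-- The vanishing for `d < e ≤ d + n` is what makes Hilbert functions polynomial in the whole range
`d ≥ m` for an `m`-regular ideal. -/
theorem eval_preHilbertPoly {n e d : ℕ} (h : e ≤ d + n) :
    (Polynomial.preHilbertPoly ℚ n e).eval (d : ℚ) =
      if e ≤ d then ((d - e + n).choose n : ℚ) else 0 := by
  split_ifs with hd
  · exact_mod_cast Polynomial.preHilbertPoly_eq_choose_sub_add ℚ n hd
  · obtain ⟨z, rfl⟩ := Nat.exists_eq_add_of_lt (not_le.1 hd)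
    have heval : (d : ℚ) - ((d + z + 1 : ℕ) : ℚ) + 1 = -(z : ℚ) := by
      push_cast
      ring
    simp only [Polynomial.preHilbertPoly, Polynomial.eval_smul, Polynomial.eval_comp,
      Polynomial.eval_add, Polynomial.eval_sub, Polynomial.eval_X, Polynomial.eval_C,
      Polynomial.eval_one, heval]
    rw [ascPochhammer_eval_neg_coe_nat_of_lt (by omega), smul_zero]

theorem finrank_shiftForms {e d : ℕ} (h : e ≤ d + n) :
    (Module.finrank K (shiftForms K n e d) : ℚ) =
      (Polynomial.preHilbertPoly ℚ n e).eval (d : ℚ) := by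
  rw [eval_preHilbertPoly h]
  split_ifs with hd
  · rw [shiftForms_of_le hd, finrank_forms]
  · rw [shiftForms_of_lt (not_le.1 hd), finrank_bot, Nat.cast_zero]

theorem finrank_freeForms {ι : Type*} [Fintype ι] {e : ι → ℕ} {d : ℕ} (h : ∀ j, e j ≤ d + n) :
    (Module.finrank K (freeForms K n e d) : ℚ) =
      (∑ j, Polynomial.preHilbertPoly ℚ n (e j)).eval (d : ℚ) := by
  rw [(freeFormsEquiv e d).finrank_eq, Module.finrank_pi_fintype, Polynomial.eval_finsetSum,
    Nat.cast_sum]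
  exact Finset.sum_congr rfl fun j _ => finrank_shiftForms (h j)

theorem finrank_inf_ker_add_finrank_map {V W : Type*} [AddCommGroup V] [Module K V]
    [AddCommGroup W] [Module K W] (G : Submodule K V) [Module.Finite K G] (f : V →ₗ[K] W) :
    Module.finrank K (G ⊓ LinearMap.ker f : Submodule K V) + Module.finrank K (G.map f) =
      Module.finrank K G := by
  rw [← (f.domRestrict G).finrank_range_add_finrank_ker, add_comm]
  congr 1
  · rw [LinearMap.range_domRestrict]
  · rw [LinearMap.ker_domRestrict, ← Submodule.finrank_map_subtype_eq G,
      Submodule.map_comap_subtype]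

/-- A function on the natural numbers that agrees with a polynomial from `m` on. -/
def PolyFrom (m : ℕ) (f : ℕ → ℕ) : Prop :=
  ∃ Q : ℚ[X], ∀ d ≥ m, (f d : ℚ) = Q.eval (d : ℚ)

theorem PolyFrom.of_add {m : ℕ} {f g h : ℕ → ℕ} (hg : PolyFrom m g) (hh : PolyFrom m h)
    (hadd : ∀ d ≥ m, g d + f d = h d) : PolyFrom m f := by
  obtain ⟨Q, hQ⟩ := hg
  obtain ⟨Q', hQ'⟩ := hh
  refine ⟨Q' - Q, fun d hd => ?_⟩
  rw [Polynomial.eval_sub, ← hQ d hd, ← hQ' d hd, ← hadd d hd]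
  push_cast
  ring

theorem polyFrom_finrank_freeForms {ι : Type*} [Finite ι] {m : ℕ} {e : ι → ℕ}
    (h : ∀ j, e j ≤ m + n) : PolyFrom m fun d => Module.finrank K (freeForms K n e d) :=
  have := Fintype.ofFinite ι
  ⟨_, fun d hd => finrank_freeForms fun j => (h j).trans (by omega)⟩

namespace MinGradedFreeRes

variable {I : Ideal (MvPolynomial (Fin (n + 1)) K)} (F : MinGradedFreeRes I)

/-- The map from the first free module onto the ideal, as a matrix with one row. -/
def genRow : Matrix (Fin 1) (Fin (F.rank 0)) (MvPolynomial (Fin (n + 1)) K) :=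
  Matrix.of fun _ j => F.gen j

theorem genRow_mulVec (v : Fin (F.rank 0) → MvPolynomial (Fin (n + 1)) K) (i : Fin 1) :
    F.genRow.mulVec v i = ∑ j, v j * F.gen j := by
  simp [genRow, Matrix.mulVec, dotProduct, mul_comm]

/-- The syzygies of degree `d` in the `i`-th free module. -/
def syz (d : ℕ) : (i : ℕ) → Submodule K (Fin (F.rank i) → MvPolynomial (Fin (n + 1)) K)
  | 0 => freeForms K n (F.deg 0) d ⊓ LinearMap.ker (mulVecMap F.genRow)
  | i + 1 => freeForms K n (F.deg (i + 1)) d ⊓ LinearMap.ker (mulVecMap (F.diff i))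

theorem isDegreeZero_diff (i : ℕ) : IsDegreeZero (F.deg i) (F.deg (i + 1)) (F.diff i) :=
  fun k j => (F.diff_homogeneous i k j).imp_right fun h => ⟨h.1.le, h.2⟩

theorem mem_syz_iff {d i : ℕ} {v : Fin (F.rank i) → MvPolynomial (Fin (n + 1)) K} :
    v ∈ F.syz d i ↔ v ∈ freeForms K n (F.deg i) d ∧ ∃ u, v = (F.diff i).mulVec u := by
  cases i with
  | zero =>
    rw [← F.exact_zero, syz, Submodule.mem_inf, LinearMap.mem_ker, mulVecMap_apply, funext_iff]
    simp [genRow_mulVec]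
  | succ i => rw [← F.exact_succ, syz, Submodule.mem_inf, LinearMap.mem_ker, mulVecMap_apply]

theorem map_freeForms_eq_syz (d i : ℕ) :
    (freeForms K n (F.deg (i + 1)) d).map (mulVecMap (F.diff i)) = F.syz d i := by
  ext v
  rw [mem_syz_iff]
  constructor
  · rintro ⟨u, hu, rfl⟩
    exact ⟨(F.isDegreeZero_diff i).map_freeForms_le d ⟨u, hu, rfl⟩, u, rfl⟩
  · rintro ⟨hv, u, rfl⟩
    refine ⟨freeComponent (F.deg (i + 1)) d u, freeComponent_mem _ _ _, ?_⟩
    rw [mulVecMap_apply, ← (F.isDegreeZero_diff i).freeComponent_mulVec, freeComponent_of_mem hv]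

theorem finrank_syz_add (d i : ℕ) :
    Module.finrank K (F.syz d (i + 1)) + Module.finrank K (F.syz d i) =
      Module.finrank K (freeForms K n (F.deg (i + 1)) d) := by
  rw [← finrank_inf_ker_add_finrank_map (freeForms K n (F.deg (i + 1)) d)
    (mulVecMap (F.diff i)), map_freeForms_eq_syz]
  rfl

theorem finrank_syz_eq_zero (d : ℕ) {i : ℕ} (hi : n ≤ i) : Module.finrank K (F.syz d i) = 0 := by
  have h := F.finrank_syz_add d i
  have h0 : Module.finrank K (freeForms K n (F.deg (i + 1)) d) = 0 := by
    have := F.length_le (i + 1) (by omega)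
    rw [(freeFormsEquiv _ d).finrank_eq, Module.finrank_pi_fintype]
    exact Finset.sum_eq_zero fun j _ => absurd j.2 (by omega)
  omega

theorem polyFrom_finrank_syz {m : ℕ} (hF : ∀ i j, F.deg i j ≤ m + i) (i : ℕ) :
    PolyFrom m fun d => Module.finrank K (F.syz d i) := by
  obtain hi | hi := le_total n i
  · exact ⟨0, fun d _ => by simp [F.finrank_syz_eq_zero d hi]⟩
  · induction hi using Nat.decreasingInduction with
    | self => exact ⟨0, fun d _ => by simp [F.finrank_syz_eq_zero d le_rfl]⟩
    | of_succ i hi ih =>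
      exact ih.of_add (polyFrom_finrank_freeForms fun j => (hF (i + 1) j).trans (by omega))
        fun d _ => F.finrank_syz_add d i

theorem gen_mem (j : Fin (F.rank 0)) : F.gen j ∈ I :=
  F.span_gen.le (Ideal.subset_span ⟨j, rfl⟩)

theorem exists_eq_sum {p : MvPolynomial (Fin (n + 1)) K} (hp : p ∈ I) :
    ∃ v : Fin (F.rank 0) → MvPolynomial (Fin (n + 1)) K, ∑ j, v j * F.gen j = p := by
  rw [← F.span_gen] at hp
  exact (Ideal.mem_span_range_iff_exists_fun).1 hp

theorem isDegreeZero_genRow : IsDegreeZero (fun _ => 0) (F.deg 0) F.genRow :=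
  fun _ j => Or.inr ⟨Nat.zero_le _, F.gen_homogeneous j⟩

theorem map_freeForms_genRow (d : ℕ) :
    (freeForms K n (F.deg 0) d).map (mulVecMap F.genRow) =
      (gradedPiece I d).map
        (LinearMap.pi fun _ : Fin 1 => (Forms K n d).subtype) := by
  ext p
  constructor
  · rintro ⟨v, hv, rfl⟩
    have hdeg : mulVecMap F.genRow v 0 ∈ shiftForms K n 0 d :=
      F.isDegreeZero_genRow.map_freeForms_le d ⟨v, hv, rfl⟩ 0 trivial
    rw [mulVecMap_apply, genRow_mulVec, shiftForms_of_le (Nat.zero_le d)] at hdeg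
    have hmem : ∑ j, v j * F.gen j ∈ I :=
      Ideal.sum_mem _ fun j _ => Ideal.mul_mem_left _ _ (F.gen_mem j)
    exact ⟨⟨∑ j, v j * F.gen j, hdeg⟩, hmem, funext fun i => (F.genRow_mulVec v i).symm⟩
  · rintro ⟨q, hq, rfl⟩
    obtain ⟨v, hv⟩ := F.exists_eq_sum hq
    refine ⟨freeComponent (F.deg 0) d v, freeComponent_mem _ _ _, ?_⟩
    rw [mulVecMap_apply, ← F.isDegreeZero_genRow.freeComponent_mulVec]
    funext i
    rw [freeComponent, genRow_mulVec, hv]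
    refine shiftComponent_of_mem ?_
    rw [shiftForms_of_le (Nat.zero_le d)]
    exact q.2

theorem finrank_map_genRow (d : ℕ) :
    Module.finrank K ((freeForms K n (F.deg 0) d).map (mulVecMap F.genRow)) =
      Module.finrank K (gradedPiece I d) := by
  rw [map_freeForms_genRow]
  refine (LinearEquiv.finrank_eq (Submodule.equivMapOfInjective _ ?_ _)).symm
  exact fun p q h => Subtype.ext (congrFun h 0)

theorem polyFrom_finrank_gradedPiece {m : ℕ} (hF : ∀ i j, F.deg i j ≤ m + i) :
    PolyFrom m fun d => Module.finrank K (gradedPiece I d) := by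
  refine (F.polyFrom_finrank_syz hF 0).of_add (polyFrom_finrank_freeForms
    (K := K) (n := n) (e := F.deg 0) fun j => (hF 0 j).trans (by omega)) fun d _ => ?_
  rw [← finrank_inf_ker_add_finrank_map (freeForms K n (F.deg 0) d) (mulVecMap F.genRow),
    F.finrank_map_genRow]
  rfl

end MinGradedFreeRes

theorem finrank_quotient_gradedPiece (I : Ideal (MvPolynomial (Fin (n + 1)) K)) (d : ℕ) :
    Module.finrank K (Forms K n d ⧸ gradedPiece I d) + Module.finrank K (gradedPiece I d) =
      (d + n).choose n := by
  rw [Submodule.finrank_quotient_add_finrank, finrank_forms]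

theorem polynomial_eq_of_eventually_eval_nat {P Q : ℚ[X]} {N : ℕ}
    (h : ∀ d ≥ N, P.eval (d : ℚ) = Q.eval (d : ℚ)) : P = Q := by
  refine Polynomial.eq_of_infinite_eval_eq P Q ?_
  refine Set.Infinite.mono (s := (fun d : ℕ => (d : ℚ)) '' Set.Ici N) ?_
    ((Set.Ici_infinite N).image Nat.cast_injective.injOn)
  rintro _ ⟨d, hd, rfl⟩
  exact h d hd

theorem IsRegular.finrank_eq {I : Ideal (MvPolynomial (Fin (n + 1)) K)} {m : ℕ} {P : ℚ[X]}
    (hm : IsRegular m I) (hP : HasHilbertPoly I P) {d : ℕ} (hd : m ≤ d) :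
    (Module.finrank K (gradedPiece I d) : ℚ) = ((d + n).choose n : ℕ) - P.eval (d : ℚ) := by
  obtain ⟨F, hF⟩ := hm
  obtain ⟨Q, hQ⟩ := F.polyFrom_finrank_gradedPiece hF
  obtain ⟨N, hN⟩ := hP
  have hchoose : ∀ d : ℕ,
      (((d + n).choose n : ℕ) : ℚ) = (Polynomial.preHilbertPoly ℚ n 0).eval (d : ℚ) := by
    intro d
    rw [eval_preHilbertPoly (Nat.zero_le _), if_pos (Nat.zero_le _), Nat.sub_zero]
  have hPQ : P = Polynomial.preHilbertPoly ℚ n 0 - Q := by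
    refine polynomial_eq_of_eventually_eval_nat (N := max N m) fun d hd => ?_
    rw [Polynomial.eval_sub, ← hN d (le_of_max_le_left hd), ← hQ d (le_of_max_le_right hd),
      ← hchoose, ← finrank_quotient_gradedPiece I d]
    push_cast
    ring
  rw [hQ d hd, hPQ, Polynomial.eval_sub, ← hchoose]
  ring

theorem mul_mem_span_gradedPiece {I : Ideal (MvPolynomial (Fin (n + 1)) K)} {e m d : ℕ}
    (hem : e ≤ m) (hmd : m ≤ d) {p q : MvPolynomial (Fin (n + 1)) K} (hp : p.IsHomogeneous e)
    (hpI : p ∈ I) (hq : q.IsHomogeneous (d - e)) :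
    p * q ∈ Ideal.span ((fun p : Forms K n m => p.1) '' (gradedPiece I m : Set _)) := by
  rw [q.as_sum, Finset.mul_sum]
  refine Ideal.sum_mem _ fun A hA => ?_
  have hdeg : A.degree = d - e := by
    by_contra h
    exact mem_support_iff.1 hA (hq.coeff_eq_zero h)
  obtain ⟨B, hBA, hB⟩ := Finsupp.exists_le_degree_eq A (m - e) (by omega)
  obtain ⟨B', rfl⟩ := exists_add_of_le hBA
  have hsplit : p * monomial (B + B') (coeff (B + B') q) =
      monomial B' (coeff (B + B') q) * (p * monomial B 1) := by
    rw [mul_left_comm, monomial_mul, mul_one, add_comm B]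
  have hform : p * monomial B 1 ∈ Forms K n m := by
    rw [mem_homogeneousSubmodule, ← Nat.add_sub_of_le hem]
    exact hp.mul (isHomogeneous_monomial 1 hB)
  rw [hsplit]
  exact Ideal.mul_mem_left _ _
    (Ideal.subset_span ⟨⟨p * monomial B 1, hform⟩, Ideal.mul_mem_right _ _ hpI, rfl⟩)

theorem IsRegular.gradedPiece_span {I : Ideal (MvPolynomial (Fin (n + 1)) K)} {m : ℕ}
    (hm : IsRegular m I) {d : ℕ} (hd : m ≤ d) :
    gradedPiece (Ideal.span ((fun p : Forms K n m => p.1) '' (gradedPiece I m : Set _))) d =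
      gradedPiece I d := by
  obtain ⟨F, hF⟩ := hm
  apply le_antisymm
  · intro p hp
    refine Ideal.span_le.2 ?_ hp
    rintro _ ⟨q, hq, rfl⟩
    exact hq
  · intro p hp
    rw [mem_gradedPiece] at hp ⊢
    obtain ⟨v, hv⟩ := F.exists_eq_sum hp
    rw [← homogeneousComponent_eq_self p.2, ← hv, map_sum]
    refine Ideal.sum_mem _ fun j _ => ?_
    rw [mul_comm, homogeneousComponent_mul_of_isHomogeneous (F.gen_homogeneous j)]
    split_ifs
    · exact mul_mem_span_gradedPiece (hF 0 j) hd (F.gen_homogeneous j) (F.gen_mem j)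
        (homogeneousComponent_isHomogeneous _ _)
    · exact Ideal.zero_mem _

end Regularity

/-! ### States of a space of forms -/

section Coordinates

variable {K E κ : Type*} [Field K] [AddCommGroup E] [Module K E] [Fintype κ]
  {W : Submodule K E}

theorem forall_eq_zero_iff_det_ne_zero [DecidableEq κ] (e : Module.Basis κ K W)
    (c : κ → E →ₗ[K] K) :
    (∀ x ∈ W, (∀ j, c j x = 0) → x = 0) ↔ (Matrix.of fun i j => c j (e i : E)).det ≠ 0 := by
  rw [Ne, ← Matrix.exists_vecMul_eq_zero_iff, not_exists]
  have hvecMul : ∀ (v : κ → K) (j : κ), c j (∑ i, v i • e i : W) =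
      Matrix.vecMul v (Matrix.of fun i j => c j (e i : E)) j := by
    intro v j
    simp [Matrix.vecMul, dotProduct]
  constructor
  · rintro h v ⟨hv, hv0⟩
    have hsum : ∑ i, v i • e i = 0 :=
      Subtype.ext (h _ (∑ i, v i • e i : W).2 fun j => (hvecMul v j).trans (congrFun hv0 j))
    exact hv (funext (Fintype.linearIndependent_iff.1 e.linearIndependent v hsum))
  · intro h x hx hx0
    by_contra hne
    refine h (e.repr ⟨x, hx⟩) ⟨fun h0 => hne ?_, funext fun j => ?_⟩
    · have hrepr : e.repr ⟨x, hx⟩ = 0 := DFunLike.coe_injective h0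
      exact congrArg Subtype.val (e.repr.map_eq_zero_iff.1 hrepr)
    · rw [← hvecMul, e.sum_repr]
      exact hx0 j

theorem exists_subfamily_forall_eq_zero {ι : Type*} [Module.Finite K W]
    (hcard : Module.finrank K W = Fintype.card κ) (c : ι → E →ₗ[K] K)
    (hc : ∀ x ∈ W, (∀ i, c i x = 0) → x = 0) :
    ∃ B : κ → ι, ∀ x ∈ W, (∀ j, c (B j) x = 0) → x = 0 := by
  let v : ι → Module.Dual K W := fun i => c i ∘ₗ W.subtype
  obtain ⟨μ, a, -, hspan, hli⟩ := exists_linearIndependent' K v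
  have : Finite μ := hli.finite
  have := Fintype.ofFinite μ
  have hker : ∀ x : W, (∀ k, v (a k) x = 0) → x = 0 := by
    intro x hx
    have hle : Submodule.span K (Set.range v) ≤ LinearMap.ker (Module.Dual.eval K W x) := by
      rw [← hspan, Submodule.span_le]
      rintro _ ⟨k, rfl⟩
      exact hx k
    exact Subtype.ext (hc x x.2 fun i => hle (Submodule.subset_span ⟨i, rfl⟩))
  have hμ : Fintype.card κ = Fintype.card μ := by
    apply le_antisymm
    · rw [← hcard, ← Module.finrank_fintype_fun_eq_card K (η := μ)]
      refine LinearMap.finrank_le_finrank_of_injective (f := LinearMap.pi fun k => v (a k)) ?_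
      exact (injective_iff_map_eq_zero _).2 fun x hx => hker x (congrFun hx)
    · rw [← hcard, ← Subspace.dual_finrank_eq (K := K) (V := W)]
      exact hli.fintype_card_le_finrank
  let ε := Fintype.equivOfCardEq hμ
  exact ⟨a ∘ ε, fun x hx h => congrArg Subtype.val (hker ⟨x, hx⟩ (ε.forall_congr_right.1 h))⟩

theorem exists_dual_of_forall_eq_zero [DecidableEq κ] [Module.Finite K W]
    (hcard : Module.finrank K W = Fintype.card κ) (c : κ → E →ₗ[K] K)
    (hc : ∀ x ∈ W, (∀ i, c i x = 0) → x = 0) :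
    ∃ F : κ → E, (∀ i, F i ∈ W) ∧ ∀ i j, c j (F i) = if i = j then 1 else 0 := by
  let T : W →ₗ[K] (κ → K) := LinearMap.pi fun j => c j ∘ₗ W.subtype
  have hT : Function.Injective T := (injective_iff_map_eq_zero _).2 fun x hx =>
    Subtype.ext (hc x.1 x.2 (congrFun hx))
  have hsurj : Function.Surjective T :=
    (LinearMap.injective_iff_surjective_of_finrank_eq_finrank
      (hcard.trans (Module.finrank_fintype_fun_eq_card K).symm)).1 hT
  choose F hF using fun i : κ => hsurj (Pi.single i 1)
  refine ⟨fun i => (F i).1, fun i => (F i).2, fun i j => ?_⟩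
  have := congrFun (hF i) j
  rw [Pi.single_apply] at this
  simpa [T, eq_comm] using this

end Coordinates

section States

variable {K : Type*} [Field K] {n m r : ℕ}

/-- The coefficients of the monomials `x^{B_1}, …, x^{B_r}` determine the elements of `W`. If `W`
has dimension `r`, this says that the coefficient of `x^{B_1} ∧ ⋯ ∧ x^{B_r}` in `⋀^r W` does not
vanish. -/
def IsState (W : Submodule K (Forms K n m)) (B : Fin r → (Fin (n + 1) →₀ ℕ)) : Prop :=
  ∀ x ∈ W, (∀ j, coeff (B j) x.1 = 0) → x = 0

theorem isState_iff_det_ne_zero {W : Submodule K (Forms K n m)} (e : Module.Basis (Fin r) K W)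
    (B : Fin r → (Fin (n + 1) →₀ ℕ)) :
    IsState W B ↔ (Matrix.of fun i j => coeff (B j) (e i).1.1).det ≠ 0 :=
  forall_eq_zero_iff_det_ne_zero e fun j => coeffForm (B j)

theorem exists_isState {W : Submodule K (Forms K n m)} (hr : Module.finrank K W = r) :
    ∃ B : Fin r → (Fin (n + 1) →₀ ℕ), (∀ j, (B j).degree = m) ∧ IsState W B := by
  obtain ⟨B, hB⟩ := exists_subfamily_forall_eq_zero (hr.trans (Fintype.card_fin r).symm)
    (fun A : Exps n m => coeffForm A.1) fun x _ hx => Forms.ext_coeff fun A => by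
      by_cases hA : A ∈ Exps n m
      · exact hx ⟨A, hA⟩
      · rw [Forms.coeff_eq_zero x fun h => hA (mem_exps.2 h), Forms.coeff_zero]
  exact ⟨fun j => (B j).1, fun j => mem_exps.1 (B j).2, hB⟩

/-- `F` is the basis of `W` dual to the coefficients of the monomials `x^{b_1}, …, x^{b_r}`. -/
structure IsDualBasis (W : Submodule K (Forms K n m)) (b : Fin r → (Fin (n + 1) →₀ ℕ))
    (F : Fin r → Forms K n m) : Prop where
  isState : IsState W b
  mem : ∀ i, F i ∈ W
  coeff_eq : ∀ i j, coeff (b j) (F i).1 = if i = j then 1 else 0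

theorem IsState.exists_isDualBasis {W : Submodule K (Forms K n m)}
    (hr : Module.finrank K W = r) {b : Fin r → (Fin (n + 1) →₀ ℕ)} (hb : IsState W b) :
    ∃ F : Fin r → Forms K n m, IsDualBasis W b F := by
  obtain ⟨F, hF, hc⟩ := exists_dual_of_forall_eq_zero (hr.trans (Fintype.card_fin r).symm)
    (fun j => coeffForm (b j)) hb
  exact ⟨F, hb, hF, hc⟩

namespace IsDualBasis

variable {W : Submodule K (Forms K n m)} {b : Fin r → (Fin (n + 1) →₀ ℕ)}
  {F : Fin r → Forms K n m}

theorem eq_sum (h : IsDualBasis W b F) {x : Forms K n m} (hx : x ∈ W) :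
    x = ∑ i, coeff (b i) x.1 • F i := by
  rw [← sub_eq_zero]
  refine h.isState _ (W.sub_mem hx (W.sum_mem fun i _ => W.smul_mem _ (h.mem i))) fun j => ?_
  rw [Forms.coeff_sub, Forms.coeff_sum]
  simp [h.coeff_eq]

theorem isState_update_iff (h : IsDualBasis W b F) (i : Fin r) (A : Fin (n + 1) →₀ ℕ) :
    IsState W (Function.update b i A) ↔ coeff A (F i).1 ≠ 0 := by
  constructor
  · intro hstate hA
    have hFi : F i = 0 := by
      refine hstate _ (h.mem i) fun j => ?_
      obtain rfl | hj := eq_or_ne j i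
      · rwa [Function.update_self]
      · rw [Function.update_of_ne hj, h.coeff_eq, if_neg hj.symm]
    have hone := h.coeff_eq i i
    rw [hFi, if_pos rfl, Forms.coeff_zero] at hone
    exact zero_ne_one hone
  · intro hA x hx hx0
    have hxi : x = coeff (b i) x.1 • F i := by
      conv_lhs => rw [h.eq_sum hx]
      refine Finset.sum_eq_single i (fun j _ hj => ?_) (by simp)
      have hxj := hx0 j
      rw [Function.update_of_ne hj] at hxj
      rw [hxj, zero_smul]
    have hmul := hx0 i
    rw [Function.update_self, hxi, Forms.coeff_smul] at hmul
    rw [hxi, (mul_eq_zero.1 hmul).resolve_right hA, zero_smul]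

end IsDualBasis

/-- The weight of a monomial. -/
def wt (w : Fin (n + 1) → ℤ) (A : Fin (n + 1) →₀ ℕ) : ℤ := ∑ i, w i * (A i : ℤ)

/-- `F` is the reduced basis of `W` with leading monomials `x^{b_1}, …, x^{b_r}`. -/
structure IsReduced (w : Fin (n + 1) → ℤ) (W : Submodule K (Forms K n m))
    (b : Fin r → (Fin (n + 1) →₀ ℕ)) (F : Fin r → Forms K n m) : Prop
    extends IsDualBasis W b F where
  degree_eq : ∀ i, (b i).degree = m
  wt_le : ∀ i A, coeff A (F i).1 ≠ 0 → wt w A ≤ wt w (b i)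

/-- The state of maximal weight is reduced: exchanging `b_i` for another monomial of `F_i` gives a
state again. -/
theorem exists_isReduced (w : Fin (n + 1) → ℤ) {W : Submodule K (Forms K n m)}
    (hr : Module.finrank K W = r) :
    ∃ (b : Fin r → (Fin (n + 1) →₀ ℕ)) (F : Fin r → Forms K n m), IsReduced w W b F := by
  let s : Set (Fin r → Exps n m) := {B | IsState W fun j => (B j).1}
  obtain ⟨B₀, hB₀, hstate₀⟩ := exists_isState hr
  obtain ⟨b, hb, hmax⟩ := s.exists_max_image (fun B => ∑ j, wt w (B j).1) (Set.toFinite s)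
    ⟨fun j => ⟨B₀ j, mem_exps.2 (hB₀ j)⟩, hstate₀⟩
  obtain ⟨F, hF⟩ := IsState.exists_isDualBasis hr hb
  refine ⟨fun j => (b j).1, F, hF, fun j => mem_exps.1 (b j).2, fun i A hA => ?_⟩
  have hAm : A ∈ Exps n m := mem_exps.2 (by
    by_contra h
    exact hA (Forms.coeff_eq_zero (F i) h))
  have hupdate : Function.update (fun j => (b j).1) i A =
      fun j => (Function.update b i ⟨A, hAm⟩ j).1 :=
    funext fun j => by by_cases hj : j = i <;> simp [hj]
  have hle := hmax _ (hupdate ▸ (hF.isState_update_iff i A).2 hA)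
  rw [← Finset.add_sum_erase _ _ (Finset.mem_univ i),
    ← Finset.add_sum_erase _ (fun j => wt w (b j).1) (Finset.mem_univ i),
    Function.update_self, Finset.sum_congr rfl fun j hj => by
      rw [Function.update_of_ne (Finset.ne_of_mem_erase hj)]] at hle
  exact le_of_add_le_add_right hle

end States

/-! ### Generic coordinates -/

section Generic

variable {K : Type*} [Field K] {n m r : ℕ}

theorem map_linSubst {R R' : Type*} [CommRing R] [CommRing R'] (φ : R →+* R')
    (G : Matrix (Fin (n + 1)) (Fin (n + 1)) R) (p : MvPolynomial (Fin (n + 1)) R) :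
    MvPolynomial.map φ (linSubst G p) = linSubst (G.map φ) (MvPolynomial.map φ p) := by
  induction p using MvPolynomial.induction_on with
  | C a => simp [linSubst, MvPolynomial.algebraMap_eq]
  | add p q hp hq => simp only [map_add, hp, hq]
  | mul_X p i hp =>
    simp only [map_mul, hp]
    simp [linSubst]

theorem eval_coeff_linSubst_mvPolynomialX (g : GL (Fin (n + 1)) K)
    (p : MvPolynomial (Fin (n + 1)) K) (A : Fin (n + 1) →₀ ℕ) :
    evalMatrix g (coeff A (linSubst (Matrix.mvPolynomialX (Fin (n + 1)) (Fin (n + 1)) K)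
      (MvPolynomial.map C p))) =
      coeff A (linSubst (g : Matrix (Fin (n + 1)) (Fin (n + 1)) K) p) := by
  let ev : MvPolynomial (Fin (n + 1) × Fin (n + 1)) K →+* K :=
    MvPolynomial.eval fun ij => (g : Matrix (Fin (n + 1)) (Fin (n + 1)) K) ij.1 ij.2
  have map_generic : (Matrix.mvPolynomialX (Fin (n + 1)) (Fin (n + 1)) K).map ev = g := by
    ext i j
    simp [ev]
  have ev_comp_C : ev.comp C = RingHom.id K := by
    ext x
    simp [ev]
  change ev _ = _
  rw [← coeff_map, map_linSubst, MvPolynomial.map_map, map_generic, ev_comp_C,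
    MvPolynomial.map_id]

theorem evalMatrix_stateCoeff (g : GL (Fin (n + 1)) K) (f : Fin r → MvPolynomial (Fin (n + 1)) K)
    (B : Fin r → (Fin (n + 1) →₀ ℕ)) :
    evalMatrix g (stateCoeff f B) = (Matrix.of fun i j =>
      coeff (B j) (linSubst (g : Matrix (Fin (n + 1)) (Fin (n + 1)) K) (f i))).det := by
  rw [evalMatrix, stateCoeff, RingHom.map_det]
  congr 1
  ext i j
  exact eval_coeff_linSubst_mvPolynomialX g (f i) (B j)

theorem isState_map_glAct_iff {W : Submodule K (Forms K n m)} (f : Module.Basis (Fin r) K W)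
    (g : GL (Fin (n + 1)) K) (B : Fin r → (Fin (n + 1) →₀ ℕ)) :
    IsState (W.map (glAct m g).toLinearMap) B ↔
      evalMatrix g (stateCoeff (fun i => (f i).1.1) B) ≠ 0 := by
  rw [isState_iff_det_ne_zero (f.map ((glAct m g).submoduleMap W)), evalMatrix_stateCoeff]
  rfl

theorem isState_of_mem_genericSet {W : Submodule K (Forms K n m)} (f : Module.Basis (Fin r) K W)
    {g : GL (Fin (n + 1)) K} (hg : g ∈ genericSet m fun i => (f i).1.1)
    (g' : GL (Fin (n + 1)) K) {B : Fin r → (Fin (n + 1) →₀ ℕ)} (hB : ∀ j, (B j).degree = m)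
    (h : IsState (W.map (glAct m g').toLinearMap) B) :
    IsState (W.map (glAct m g).toLinearMap) B := by
  rw [isState_map_glAct_iff f] at h ⊢
  refine hg B hB fun h0 => h ?_
  rw [h0, evalMatrix, map_zero]

theorem exists_evalMatrix_ne_zero [Infinite K]
    {p : MvPolynomial (Fin (n + 1) × Fin (n + 1)) K} (hp : p ≠ 0) :
    ∃ g : GL (Fin (n + 1)) K, evalMatrix g p ≠ 0 := by
  let D := (Matrix.mvPolynomialX (Fin (n + 1)) (Fin (n + 1)) K).det
  have hD : D ≠ 0 := Matrix.det_mvPolynomialX_ne_zero _ _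
  obtain ⟨x, hx⟩ : ∃ x, MvPolynomial.eval x (p * D) ≠ 0 := by
    by_contra! h
    exact mul_ne_zero hp hD (MvPolynomial.funext fun x => by rw [h, map_zero])
  rw [map_mul] at hx
  have hdet : (Matrix.of fun i j => x (i, j)).det ≠ 0 := by
    have hDx := right_ne_zero_of_mul hx
    rw [RingHom.map_det] at hDx
    convert! hDx
    ext i j
    simp
  exact ⟨Matrix.GeneralLinearGroup.mkOfDetNeZero _ hdet, left_ne_zero_of_mul hx⟩

/-- The product of the state coefficients that do not vanish identically, whose nonvanishing locus
is the generic set. -/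
def stateProd (m : ℕ) (f : Fin r → MvPolynomial (Fin (n + 1)) K) :
    MvPolynomial (Fin (n + 1) × Fin (n + 1)) K :=
  open Classical in
  ∏ B : Fin r → Exps n m,
    if stateCoeff f (fun j => (B j).1) = 0 then 1 else stateCoeff f fun j => (B j).1

theorem stateProd_ne_zero (m : ℕ) (f : Fin r → MvPolynomial (Fin (n + 1)) K) :
    stateProd m f ≠ 0 := by
  refine Finset.prod_ne_zero_iff.2 fun B _ => ?_
  split_ifs with h
  · exact one_ne_zero
  · exact h

theorem mem_genericSet_iff (m : ℕ) (f : Fin r → MvPolynomial (Fin (n + 1)) K)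
    (g : GL (Fin (n + 1)) K) : g ∈ genericSet m f ↔ evalMatrix g (stateProd m f) ≠ 0 := by
  rw [evalMatrix, stateProd, map_prod, Finset.prod_ne_zero_iff]
  constructor
  · intro hg B _
    split_ifs with h
    · simp
    · exact hg _ (fun j => mem_exps.1 (B j).2) h
  · intro h B hB hne
    simpa only [evalMatrix, if_neg hne] using
      h (fun j => ⟨B j, mem_exps.2 (hB j)⟩) (Finset.mem_univ _)

theorem isZariskiOpen_genericSet (m : ℕ) (f : Fin r → MvPolynomial (Fin (n + 1)) K) :
    IsZariskiOpen (genericSet m f) :=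
  ⟨{stateProd m f}, by ext g; simp [mem_genericSet_iff]⟩

theorem isZariskiDense_genericSet [Infinite K] (m : ℕ)
    (f : Fin r → MvPolynomial (Fin (n + 1)) K) : IsZariskiDense (genericSet m f) := by
  rintro O ⟨T, rfl⟩ ⟨g, p, hpT, hp⟩
  have hp0 : p ≠ 0 := by
    rintro rfl
    simp [evalMatrix] at hp
  obtain ⟨g', hg'⟩ := exists_evalMatrix_ne_zero (mul_ne_zero hp0 (stateProd_ne_zero m f))
  rw [evalMatrix, map_mul] at hg'
  exact ⟨g', ⟨p, hpT, left_ne_zero_of_mul hg'⟩,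
    (mem_genericSet_iff m f g').2 (right_ne_zero_of_mul hg')⟩

end Generic

/-! ### Translates of ideals -/

section Translate

variable {K : Type*} [Field K] {n : ℕ}

/-- The ideal `h I`, written as the preimage of `I` under `h⁻¹`. -/
def translate (h : GL (Fin (n + 1)) K) (I : Ideal (MvPolynomial (Fin (n + 1)) K)) :
    Ideal (MvPolynomial (Fin (n + 1)) K) :=
  I.comap (linSubst ((h⁻¹ : GL (Fin (n + 1)) K) : Matrix (Fin (n + 1)) (Fin (n + 1)) K))

theorem mem_translate {h : GL (Fin (n + 1)) K} {I : Ideal (MvPolynomial (Fin (n + 1)) K)}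
    {p : MvPolynomial (Fin (n + 1)) K} : p ∈ translate h I ↔
      linSubst ((h⁻¹ : GL (Fin (n + 1)) K) : Matrix (Fin (n + 1)) (Fin (n + 1)) K) p ∈ I :=
  Iff.rfl

theorem linSubst_inv_linSubst (h : GL (Fin (n + 1)) K) (p : MvPolynomial (Fin (n + 1)) K) :
    linSubst ((h⁻¹ : GL (Fin (n + 1)) K) : Matrix (Fin (n + 1)) (Fin (n + 1)) K)
      (linSubst (h : Matrix (Fin (n + 1)) (Fin (n + 1)) K) p) = p := by
  rw [linSubst_mul, ← Units.val_mul, inv_mul_cancel, Units.val_one, linSubst_one]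

theorem linSubst_mem_translate {h : GL (Fin (n + 1)) K}
    {I : Ideal (MvPolynomial (Fin (n + 1)) K)} {p : MvPolynomial (Fin (n + 1)) K} :
    linSubst (h : Matrix (Fin (n + 1)) (Fin (n + 1)) K) p ∈ translate h I ↔ p ∈ I := by
  rw [mem_translate, linSubst_inv_linSubst]

theorem gradedPiece_translate (h : GL (Fin (n + 1)) K)
    (I : Ideal (MvPolynomial (Fin (n + 1)) K)) (m : ℕ) :
    gradedPiece (translate h I) m = (gradedPiece I m).map (glAct m h).toLinearMap := by
  ext p
  rw [mem_gradedPiece]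
  constructor
  · intro hp
    exact ⟨(glAct m h).symm p, hp, (glAct m h).apply_symm_apply p⟩
  · rintro ⟨q, hq, rfl⟩
    exact linSubst_mem_translate.2 hq

theorem finrank_gradedPiece_translate (h : GL (Fin (n + 1)) K)
    (I : Ideal (MvPolynomial (Fin (n + 1)) K)) (m : ℕ) :
    Module.finrank K (gradedPiece (translate h I) m) = Module.finrank K (gradedPiece I m) := by
  rw [gradedPiece_translate]
  exact ((glAct m h).submoduleMap (gradedPiece I m)).finrank_eq.symm

theorem hasHilbertPoly_of_finrank_eq {I J : Ideal (MvPolynomial (Fin (n + 1)) K)} {P : ℚ[X]}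
    (hI : HasHilbertPoly I P) {N : ℕ} (h : ∀ d ≥ N, Module.finrank K (gradedPiece J d) =
      Module.finrank K (gradedPiece I d)) : HasHilbertPoly J P := by
  obtain ⟨N', hN'⟩ := hI
  refine ⟨max N N', fun d hd => ?_⟩
  rw [← hN' d (le_of_max_le_right hd)]
  congr 1
  linarith [finrank_quotient_gradedPiece I d, finrank_quotient_gradedPiece J d,
    h d (le_of_max_le_left hd)]

theorem isHomogeneousIdeal_translate (h : GL (Fin (n + 1)) K)
    {I : Ideal (MvPolynomial (Fin (n + 1)) K)} (hI : IsHomogeneousIdeal I) :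
    IsHomogeneousIdeal (translate h I) := by
  intro p hp d
  rw [mem_translate, linSubst_homogeneousComponent]
  exact hI _ hp d

theorem isSaturatedIdeal_translate (h : GL (Fin (n + 1)) K)
    {I : Ideal (MvPolynomial (Fin (n + 1)) K)} (hI : IsSaturatedIdeal I) :
    IsSaturatedIdeal (translate h I) := by
  refine ⟨isHomogeneousIdeal_translate h hI.1, fun p hp => hI.2 _ fun i => ?_⟩
  have hX : ∀ j, X j ∈ ((translate h I).colon {p}).radical := fun j => by
    obtain ⟨k, hk⟩ := hp j
    exact ⟨k, Submodule.mem_colon_singleton.2 hk⟩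
  have h_linSubst_X : linSubst (h : Matrix (Fin (n + 1)) (Fin (n + 1)) K) (X i) ∈
      ((translate h I).colon {p}).radical := by
    rw [linSubst, aeval_X]
    exact Ideal.sum_mem _ fun j _ => Ideal.mul_mem_left _ _ (hX j)
  obtain ⟨k, hk⟩ := h_linSubst_X
  refine ⟨k, ?_⟩
  rwa [Submodule.mem_colon_singleton, smul_eq_mul, mem_translate, map_mul, map_pow,
    linSubst_inv_linSubst] at hk

theorem translate_mul (g h : GL (Fin (n + 1)) K) (I : Ideal (MvPolynomial (Fin (n + 1)) K)) :
    translate (g * h) I = translate g (translate h I) := by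
  ext p
  rw [mem_translate, mem_translate, mem_translate, linSubst_mul, mul_inv_rev, Units.val_mul]

theorem eq_bot_of_translate_eq_bot {h : GL (Fin (n + 1)) K}
    {I : Ideal (MvPolynomial (Fin (n + 1)) K)} (hI : translate h I = ⊥) : I = ⊥ := by
  refine (Submodule.eq_bot_iff _).2 fun p hp => ?_
  rw [← linSubst_mem_translate (h := h), hI, Ideal.mem_bot] at hp
  rw [← linSubst_inv_linSubst h p, hp, map_zero]

theorem translate_eq_top_iff {h : GL (Fin (n + 1)) K}
    {I : Ideal (MvPolynomial (Fin (n + 1)) K)} : translate h I = ⊤ ↔ I = ⊤ :=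
  Ideal.comap_eq_top_iff

end Translate

/-! ### The family of translates by a one-parameter subgroup -/

section Diagonal

variable {R : Type*} [CommRing R] {n : ℕ}

theorem linSubst_diagonal_X (c : Fin (n + 1) → R) (i : Fin (n + 1)) :
    linSubst (Matrix.diagonal c) (X i) = C (c i) * X i := by
  rw [linSubst, aeval_X, Finset.sum_eq_single i]
  · rw [Matrix.diagonal_apply_eq]
  · intro j _ hj
    rw [Matrix.diagonal_apply_ne _ hj, C_0, zero_mul]
  · simp

theorem linSubst_diagonal_monomial (c : Fin (n + 1) → R) (B : Fin (n + 1) →₀ ℕ) (a : R) :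
    linSubst (Matrix.diagonal c) (monomial B a) = monomial B ((∏ i, c i ^ B i) * a) := by
  simp only [monomial_eq, Finsupp.prod_fintype _ _ fun _ => pow_zero _, map_mul, map_prod, map_pow,
    linSubst_diagonal_X, mul_pow, Finset.prod_mul_distrib, ← algebraMap_eq, AlgHom.commutes]
  ring

theorem coeff_linSubst_diagonal (c : Fin (n + 1) → R) (p : MvPolynomial (Fin (n + 1)) R)
    (A : Fin (n + 1) →₀ ℕ) :
    coeff A (linSubst (Matrix.diagonal c) p) = (∏ i, c i ^ A i) * coeff A p := by
  induction p using MvPolynomial.induction_on' with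
  | monomial B a =>
    rw [linSubst_diagonal_monomial, coeff_monomial, coeff_monomial]
    split_ifs with h
    · rw [h]
    · rw [mul_zero]
  | add p q hp hq => rw [map_add, MvPolynomial.coeff_add, MvPolynomial.coeff_add, hp, hq, mul_add]

end Diagonal

section OneParam

variable {K : Type*} [Field K] {n : ℕ}

theorem coeff_linSubst_oneParam (w : Fin (n + 1) → ℤ) {a : K} (ha : a ≠ 0)
    (p : MvPolynomial (Fin (n + 1)) K) (A : Fin (n + 1) →₀ ℕ) :
    coeff A (linSubst (oneParam w a) p) = a ^ (-wt w A) * coeff A p := by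
  have zpow_neg_sum (s : Finset (Fin (n + 1))) :
      ∏ i ∈ s, (a ^ (-w i)) ^ A i = a ^ (-∑ i ∈ s, w i * (A i : ℤ)) := by
    induction s using Finset.induction_on with
    | empty => simp
    | insert i s hi ih =>
      rw [Finset.prod_insert hi, Finset.sum_insert hi, ih, neg_add, zpow_add₀ ha, ← zpow_natCast,
        ← zpow_mul, neg_mul]
  rw [oneParam, coeff_linSubst_diagonal, zpow_neg_sum, wt]

theorem oneParam_mul_oneParam_inv (w : Fin (n + 1) → ℤ) {a : K} (ha : a ≠ 0) :
    oneParam w a * oneParam w a⁻¹ = 1 := by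
  rw [oneParam, oneParam, Matrix.diagonal_mul_diagonal, ← Matrix.diagonal_one]
  congr 1
  funext i
  rw [← mul_zpow, mul_inv_cancel₀ ha, one_zpow]

/-- The matrix `λ_w(a)` as an element of the general linear group. -/
def oneParamGL (w : Fin (n + 1) → ℤ) (a : K) (ha : a ≠ 0) : GL (Fin (n + 1)) K where
  val := oneParam w a
  inv := oneParam w a⁻¹
  val_inv := oneParam_mul_oneParam_inv w ha
  inv_val := by
    have := oneParam_mul_oneParam_inv w (inv_ne_zero ha)
    rwa [inv_inv] at this

/-- The ideal of the family over the affine line whose fibre at `a ≠ 0` is `λ_w(a) J`. -/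
def familyIdeal (w : Fin (n + 1) → ℤ) (J : Ideal (MvPolynomial (Fin (n + 1)) K)) :
    Ideal (MvPolynomial (Fin (n + 1)) K[X]) :=
  ⨅ (a : K) (ha : a ≠ 0),
    (translate (oneParamGL w a ha) J).comap (MvPolynomial.map (Polynomial.evalRingHom a))

theorem mem_familyIdeal {w : Fin (n + 1) → ℤ} {J : Ideal (MvPolynomial (Fin (n + 1)) K)}
    {q : MvPolynomial (Fin (n + 1)) K[X]} : q ∈ familyIdeal w J ↔ ∀ (a : K) (ha : a ≠ 0),
      MvPolynomial.map (Polynomial.evalRingHom a) q ∈ translate (oneParamGL w a ha) J := by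
  simp [familyIdeal]

theorem isHomogeneousIdeal_familyIdeal (w : Fin (n + 1) → ℤ)
    {J : Ideal (MvPolynomial (Fin (n + 1)) K)} (hJ : IsHomogeneousIdeal J) :
    IsHomogeneousIdeal (familyIdeal w J) := by
  intro p hp d
  rw [mem_familyIdeal] at hp ⊢
  intro a ha
  rw [← homogeneousComponent_map]
  exact isHomogeneousIdeal_translate _ hJ _ (hp a ha) d

theorem mem_familyIdeal_of_X_pow_mul {w : Fin (n + 1) → ℤ}
    {J : Ideal (MvPolynomial (Fin (n + 1)) K)} {q : MvPolynomial (Fin (n + 1)) K[X]} {k : ℕ}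
    (h : C (Polynomial.X ^ k) * q ∈ familyIdeal w J) : q ∈ familyIdeal w J := by
  rw [mem_familyIdeal] at h ⊢
  intro a ha
  rw [← Ideal.unit_mul_mem_iff_mem _ ((isUnit_iff_ne_zero.2 (pow_ne_zero k ha)).map C)]
  simpa using h a ha

end OneParam

/-! ### Flat families of forms given as graphs -/

section PolynomialModule

variable {K : Type*} [Field K]

theorem flat_quotient_iff {E : Type*} [AddCommGroup E] [Module K[X] E] (M : Submodule K[X] E) :
    Module.Flat K[X] (E ⧸ M) ↔ ∀ (p : K[X]) (q : E), p ≠ 0 → p • q ∈ M → q ∈ M := by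
  rw [IsDedekindDomain.flat_iff_torsion_eq_bot, ← Submodule.isTorsionFree_iff_torsion_eq_bot]
  constructor
  · intro h p q hp hq
    rw [← Submodule.Quotient.mk_eq_zero] at hq ⊢
    rw [Submodule.Quotient.mk_smul] at hq
    exact (smul_eq_zero_iff_right hp).1 hq
  · refine fun h => Module.IsTorsionFree.of_smul_eq_zero fun p x hx => ?_
    obtain ⟨q, rfl⟩ := Submodule.Quotient.mk_surjective M x
    rw [← Submodule.Quotient.mk_smul, Submodule.Quotient.mk_eq_zero] at hx
    rw [Submodule.Quotient.mk_eq_zero, or_iff_not_imp_left]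
    exact fun hp => h p q hp hx

theorem polynomial_eq_of_eval_eq_of_ne_zero [Infinite K] {p q : K[X]}
    (h : ∀ a : K, a ≠ 0 → p.eval a = q.eval a) : p = q :=
  Polynomial.eq_of_infinite_eval_eq p q ((Set.finite_singleton 0).infinite_compl.mono h)

end PolynomialModule

section Graph

variable {R : Type*} [CommRing R] {n d r : ℕ}

/-- The forms `q` whose coefficients are determined by those at the monomials `x^{b_i}`: the
coefficient of `x^A` is the combination of the latter with coefficients `γ i A`. When `γ` is graph
data this is the graph of a linear map out of the span of the `x^{b_i}`. -/
def graphForms (b : Fin r → (Fin (n + 1) →₀ ℕ)) (γ : Fin r → (Fin (n + 1) →₀ ℕ) → R) :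
    Submodule R (Forms R n d) where
  carrier := {q | ∀ A, coeff A q.1 = ∑ i, coeff (b i) q.1 * γ i A}
  add_mem' {p q} hp hq A := by
    simp only [Forms.coeff_add, hp A, hq A, add_mul, Finset.sum_add_distrib]
  zero_mem' A := by simp
  smul_mem' c q hq A := by
    simp only [Forms.coeff_smul, mul_assoc, ← Finset.mul_sum]
    rw [hq A]

theorem mem_graphForms {b : Fin r → (Fin (n + 1) →₀ ℕ)} {γ : Fin r → (Fin (n + 1) →₀ ℕ) → R}
    {q : Forms R n d} :
    q ∈ graphForms b γ ↔ ∀ A, coeff A q.1 = ∑ i, coeff (b i) q.1 * γ i A := Iff.rfl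

/-- The family `γ` consists of the coefficients of forms of degree `d`, the `i`-th of which has
coefficient `1` at `x^{b_i}` and `0` at the other `x^{b_j}`. -/
structure IsGraphData (d : ℕ) (b : Fin r → (Fin (n + 1) →₀ ℕ))
    (γ : Fin r → (Fin (n + 1) →₀ ℕ) → R) : Prop where
  degree_eq : ∀ i A, γ i A ≠ 0 → A.degree = d
  apply_eq : ∀ i j, γ i (b j) = if i = j then 1 else 0

/-- The form with coefficients `γ i`: the point of the graph above the monomial `x^{b_i}`. -/
def graphSection (d : ℕ) (γ : Fin r → (Fin (n + 1) →₀ ℕ) → R) (i : Fin r) : Forms R n d :=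
  (formsEquiv R n d).symm fun A => γ i A.1

variable {b : Fin r → (Fin (n + 1) →₀ ℕ)} {γ : Fin r → (Fin (n + 1) →₀ ℕ) → R}

theorem coeff_formsEquiv_symm (v : (Fin (n + 1) →₀ ℕ) → R) (hv : ∀ A, v A ≠ 0 → A.degree = d)
    (A : Fin (n + 1) →₀ ℕ) :
    coeff A ((formsEquiv R n d).symm fun B => v B.1).1 = v A := by
  by_cases hA : A.degree = d
  · exact congrFun ((formsEquiv R n d).apply_symm_apply fun B => v B.1) ⟨A, mem_exps.2 hA⟩
  · rw [Forms.coeff_eq_zero _ hA, not_imp_comm.1 (hv A) hA]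

theorem IsGraphData.coeff_graphSection (h : IsGraphData d b γ) (i : Fin r)
    (A : Fin (n + 1) →₀ ℕ) : coeff A (graphSection d γ i).1 = γ i A :=
  coeff_formsEquiv_symm (γ i) (h.degree_eq i) A

theorem IsGraphData.graphSection_mem (h : IsGraphData d b γ) (i : Fin r) :
    graphSection d γ i ∈ graphForms b γ := by
  intro A
  simp [h.coeff_graphSection, h.apply_eq]

theorem IsGraphData.eq_sum (h : IsGraphData d b γ) {q : Forms R n d} (hq : q ∈ graphForms b γ) :
    q = ∑ i, coeff (b i) q.1 • graphSection d γ i := by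
  refine Forms.ext_coeff fun A => ?_
  rw [Forms.coeff_sum, hq A]
  exact Finset.sum_congr rfl fun i _ => by rw [Forms.coeff_smul, h.coeff_graphSection]

/-- The projection of a graph to the coefficients at the `x^{b_i}`. -/
def IsGraphData.equiv (h : IsGraphData d b γ) :
    (graphForms b γ : Submodule R (Forms R n d)) ≃ₗ[R] (Fin r → R) where
  toFun q i := coeff (b i) q.1.1
  map_add' _ _ := by ext; simp
  map_smul' _ _ := by ext; simp
  invFun v := ⟨∑ i, v i • graphSection d γ i,
    Submodule.sum_mem _ fun i _ => Submodule.smul_mem _ _ (h.graphSection_mem i)⟩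
  left_inv q := Subtype.ext (h.eq_sum q.2).symm
  right_inv v := by
    ext j
    change coeff (b j) (∑ i, v i • graphSection d γ i : Forms R n d).1 = v j
    rw [Forms.coeff_sum]
    simp only [Forms.coeff_smul, h.coeff_graphSection, h.apply_eq]
    simp

theorem IsGraphData.det_smul_graphSection (h : IsGraphData d b γ) {s : Fin r → Forms R n d}
    (hs : ∀ i, s i ∈ graphForms b γ) (k : Fin r) :
    (Matrix.of fun i j => coeff (b j) (s i).1).det • graphSection d γ k =
      ∑ i, (Matrix.of fun i j => coeff (b j) (s i).1).adjugate k i • s i := by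
  set T : Matrix (Fin r) (Fin r) R := Matrix.of fun i j => coeff (b j) (s i).1
  refine Forms.ext_coeff fun A => ?_
  have h_coeff (i : Fin r) : coeff A (s i).1 = (T.mulVec fun j => γ j A) i := hs i A
  have h_adj := congrFun (Matrix.mulVec_mulVec (fun j => γ j A) T.adjugate T) k
  rw [Matrix.adjugate_mul, Matrix.smul_mulVec, Matrix.one_mulVec] at h_adj
  simp only [Forms.coeff_sum, Forms.coeff_smul, h.coeff_graphSection, h_coeff]
  exact h_adj.symm

theorem IsGraphData.finrank_eq [StrongRankCondition R] (h : IsGraphData d b γ) :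
    Module.finrank R (graphForms b γ : Submodule R (Forms R n d)) = r := by
  rw [h.equiv.finrank_eq, Module.finrank_fintype_fun_eq_card, Fintype.card_fin]

theorem IsGraphData.map {R' : Type*} [CommRing R'] (h : IsGraphData d b γ) (φ : R →+* R') :
    IsGraphData d b fun i A => φ (γ i A) where
  degree_eq i A hA := h.degree_eq i A fun h0 => hA (by rw [h0, map_zero])
  apply_eq i j := by
    rw [h.apply_eq]
    split_ifs <;> simp

theorem coeffMap_mem_graphForms {R' : Type*} [CommRing R'] (φ : R →+* R') {q : Forms R n d}
    (hq : q ∈ graphForms b γ) : coeffMap φ q ∈ graphForms b fun i A => φ (γ i A) := by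
  intro A
  simp only [coeff_coeffMap]
  rw [hq A, map_sum]
  simp

variable {K : Type*} [Field K] {γ : Fin r → (Fin (n + 1) →₀ ℕ) → K[X]}

theorem IsGraphData.fibre_eq (h : IsGraphData d b γ) (a : K) :
    fibre (graphForms b γ : Submodule K[X] (Forms K[X] n d)) a =
      graphForms b fun i A => (γ i A).eval a := by
  ext v
  rw [mem_fibre]
  constructor
  · rintro ⟨q, hq, rfl⟩
    exact coeffMap_mem_graphForms _ hq
  · intro hv
    refine ⟨∑ i, Polynomial.C (coeff (b i) v.1) • graphSection d γ i,
      Submodule.sum_mem _ fun i _ => Submodule.smul_mem _ _ (h.graphSection_mem i),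
      Forms.ext_coeff fun A => ?_⟩
    rw [coeff_coeffMap, Forms.coeff_sum, hv A, map_sum]
    refine Finset.sum_congr rfl fun i _ => ?_
    rw [Forms.coeff_smul, h.coeff_graphSection, map_mul]
    simp

theorem flat_quotient_graphForms :
    Module.Flat K[X] (Forms K[X] n d ⧸ (graphForms b γ : Submodule K[X] (Forms K[X] n d))) := by
  refine (flat_quotient_iff _).2 fun p q hp hq A => ?_
  have h := hq A
  simp only [Forms.coeff_smul, mul_assoc, ← Finset.mul_sum] at h
  exact mul_left_cancel₀ hp h

theorem mem_graphForms_iff_forall_ne_zero [Infinite K] {q : Forms K[X] n d} :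
    q ∈ graphForms b γ ↔ ∀ a : K, a ≠ 0 →
      coeffMap (Polynomial.evalRingHom a) q ∈ graphForms b fun i A => (γ i A).eval a := by
  refine ⟨fun hq a _ => coeffMap_mem_graphForms (Polynomial.evalRingHom a) hq, fun h A =>
    polynomial_eq_of_eval_eq_of_ne_zero fun a ha => ?_⟩
  simpa only [coeff_coeffMap, Polynomial.coe_evalRingHom, Polynomial.eval_finsetSum,
    Polynomial.eval_mul] using h a ha A

theorem IsGraphData.eq_of_fibre_eq [Infinite K] (h : IsGraphData d b γ)
    {M : Submodule K[X] (Forms K[X] n d)} (hM : Module.Flat K[X] (Forms K[X] n d ⧸ M))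
    (hf : ∀ a : K, a ≠ 0 → fibre M a = graphForms b fun i A => (γ i A).eval a) :
    M = graphForms b γ := by
  have hle : M ≤ graphForms b γ := fun q hq =>
    mem_graphForms_iff_forall_ne_zero.2 fun a ha => hf a ha ▸ mem_fibre.2 ⟨q, hq, rfl⟩
  have h_eval_one := h.map (Polynomial.evalRingHom 1)
  have h_lift (i : Fin r) : ∃ s ∈ M, coeffMap (Polynomial.evalRingHom 1) s =
      graphSection d (fun i A => Polynomial.evalRingHom 1 (γ i A)) i := by
    rw [← mem_fibre, hf 1 one_ne_zero]
    exact h_eval_one.graphSection_mem i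
  choose s hs hs_eval using h_lift
  let T : Matrix (Fin r) (Fin r) K[X] := Matrix.of fun i j => coeff (b j) (s i).1
  have hT : T.det ≠ 0 := by
    have hT_eval : T.map (Polynomial.evalRingHom 1) = 1 := by
      ext i j
      change Polynomial.evalRingHom 1 (coeff (b j) (s i).1) = _
      rw [← coeff_coeffMap, hs_eval, h_eval_one.coeff_graphSection, h_eval_one.apply_eq,
        Matrix.one_apply]
    intro h0
    have := RingHom.map_det (Polynomial.evalRingHom (1 : K)) T
    rw [h0, RingHom.mapMatrix_apply, hT_eval, map_zero, Matrix.det_one] at this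
    exact zero_ne_one this
  have h_section (k : Fin r) : graphSection d γ k ∈ M := by
    refine (flat_quotient_iff M).1 hM T.det _ hT ?_
    rw [h.det_smul_graphSection fun i => hle (hs i)]
    exact M.sum_mem fun i _ => M.smul_mem _ (hs i)
  refine le_antisymm hle fun q hq => ?_
  rw [h.eq_sum hq]
  exact M.sum_mem fun i _ => M.smul_mem _ (h_section i)

end Graph

/-! ### The limit of a family of translates -/

section Limit

variable {K : Type*} [Field K] {n d r : ℕ} {w : Fin (n + 1) → ℤ}
  {J : Ideal (MvPolynomial (Fin (n + 1)) K)} {b : Fin r → (Fin (n + 1) →₀ ℕ)}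
  {F : Fin r → Forms K n d}

/-- The coefficients of the family of reduced bases of `λ_w(t) W`, where `F` is a reduced basis
of `W`. The exponents are nonnegative when `F i` has no terms of weight above that of `x^{b_i}`;
only for other coefficients, which are then `0`, does `toNat` truncate. -/
def familyCoeff (w : Fin (n + 1) → ℤ) (b : Fin r → (Fin (n + 1) →₀ ℕ)) (F : Fin r → Forms K n d)
    (i : Fin r) (A : Fin (n + 1) →₀ ℕ) : K[X] :=
  Polynomial.C (coeff A (F i).1) * Polynomial.X ^ (wt w (b i) - wt w A).toNat

/-- The family of spaces of forms with the reduced bases of `familyCoeff`. Its fibre at `0` is the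
limit of `λ_w(t) W` as `t → 0`. -/
abbrev familyForms (w : Fin (n + 1) → ℤ) (b : Fin r → (Fin (n + 1) →₀ ℕ))
    (F : Fin r → Forms K n d) : Submodule K[X] (Forms K[X] n d) :=
  graphForms b (familyCoeff w b F)

theorem IsReduced.isGraphData {W : Submodule K (Forms K n d)} (h : IsReduced w W b F) :
    IsGraphData d b (familyCoeff w b F) where
  degree_eq i A hA := by
    by_contra hd
    refine hA ?_
    rw [familyCoeff, Forms.coeff_eq_zero _ hd, map_zero, zero_mul]
  apply_eq i j := by
    rw [familyCoeff, h.coeff_eq]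
    split_ifs with hij
    · simp [hij]
    · simp

theorem IsReduced.eval_familyCoeff {W : Submodule K (Forms K n d)} (h : IsReduced w W b F)
    {a : K} (ha : a ≠ 0) (i : Fin r) (A : Fin (n + 1) →₀ ℕ) :
    (familyCoeff w b F i A).eval a = a ^ (wt w (b i)) * a ^ (-wt w A) * coeff A (F i).1 := by
  rw [familyCoeff, Polynomial.eval_mul, Polynomial.eval_C, Polynomial.eval_pow,
    Polynomial.eval_X, mul_comm]
  by_cases h0 : coeff A (F i).1 = 0
  · rw [h0, mul_zero, mul_zero]
  · have := h.wt_le i A h0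
    rw [← zpow_natCast, Int.toNat_of_nonneg (by omega), ← zpow_add₀ ha, sub_eq_add_neg]

theorem IsDualBasis.eq_graphForms {W : Submodule K (Forms K n d)} (h : IsDualBasis W b F) :
    W = graphForms b fun i A => coeff A (F i).1 := by
  ext v
  constructor
  · intro hv A
    conv_lhs => rw [h.eq_sum hv, Forms.coeff_sum]
    simp only [Forms.coeff_smul]
  · intro hv
    have hv_sum : v = ∑ i, coeff (b i) v.1 • F i := Forms.ext_coeff fun A => by
      simp only [hv A, Forms.coeff_sum, Forms.coeff_smul]
    rw [hv_sum]
    exact Submodule.sum_mem _ fun i _ => Submodule.smul_mem _ _ (h.mem i)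

theorem IsReduced.gradedPiece_translate_eq (h : IsReduced w (gradedPiece J d) b F) {a : K}
    (ha : a ≠ 0) : gradedPiece (translate (oneParamGL w a ha) J) d =
      graphForms b fun i A => (familyCoeff w b F i A).eval a := by
  ext v
  let v' : Forms K n d := matAct d ((oneParamGL w a ha)⁻¹ : GL (Fin (n + 1)) K).1 v
  have hv' : v ∈ gradedPiece (translate (oneParamGL w a ha) J) d ↔ v' ∈ gradedPiece J d := Iff.rfl
  have coeff_v' (A : Fin (n + 1) →₀ ℕ) : coeff A v'.1 = a ^ wt w A * coeff A v.1 := by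
    change coeff A (linSubst (oneParam w a⁻¹) v.1) = _
    rw [coeff_linSubst_oneParam w (inv_ne_zero ha), inv_zpow', neg_neg]
  rw [hv', h.toIsDualBasis.eq_graphForms, mem_graphForms, mem_graphForms]
  refine forall_congr' fun A => ?_
  have hA : a ^ wt w A ≠ 0 := zpow_ne_zero _ ha
  simp only [coeff_v', h.eval_familyCoeff ha]
  have h_sum : ∑ i, a ^ wt w (b i) * coeff (b i) v.1 * coeff A (F i).1 = a ^ wt w A *
      ∑ i, coeff (b i) v.1 * (a ^ wt w (b i) * a ^ (-wt w A) * coeff A (F i).1) := by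
    rw [Finset.mul_sum, zpow_neg]
    exact Finset.sum_congr rfl fun i _ => by field_simp
  rw [h_sum, mul_right_inj' hA]

theorem IsReduced.idealForms_familyIdeal_eq [Infinite K]
    (h : IsReduced w (gradedPiece J d) b F) :
    idealForms (familyIdeal w J) d = familyForms w b F := by
  ext q
  rw [mem_idealForms, mem_familyIdeal, mem_graphForms_iff_forall_ne_zero]
  refine forall₂_congr fun a ha => ?_
  rw [← h.gradedPiece_translate_eq ha]
  rfl

end Limit

/-! ### Saturation -/

section Saturation

variable {K : Type*} [Field K] {n : ℕ}

/-- The saturation of an ideal with respect to `(x_0, …, x_n)`: it has the same graded pieces in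
large degrees, and defines the same subscheme of projective space. -/
def saturation (L : Ideal (MvPolynomial (Fin (n + 1)) K)) :
    Ideal (MvPolynomial (Fin (n + 1)) K) where
  carrier := {p | ∀ i, ∃ k : ℕ, X i ^ k * p ∈ L}
  add_mem' {p q} hp hq i := by
    obtain ⟨k, hk⟩ := hp i
    obtain ⟨l, hl⟩ := hq i
    refine ⟨k + l, ?_⟩
    rw [show (X i : MvPolynomial (Fin (n + 1)) K) ^ (k + l) * (p + q) =
      X i ^ l * (X i ^ k * p) + X i ^ k * (X i ^ l * q) by ring]
    exact L.add_mem (L.mul_mem_left _ hk) (L.mul_mem_left _ hl)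
  zero_mem' i := ⟨0, by simp⟩
  smul_mem' c p hp i := by
    obtain ⟨k, hk⟩ := hp i
    refine ⟨k, ?_⟩
    rw [smul_eq_mul, mul_left_comm]
    exact L.mul_mem_left _ hk

theorem mem_saturation {L : Ideal (MvPolynomial (Fin (n + 1)) K)}
    {p : MvPolynomial (Fin (n + 1)) K} :
    p ∈ saturation L ↔ ∀ i, ∃ k : ℕ, X i ^ k * p ∈ L := Iff.rfl

theorem le_saturation (L : Ideal (MvPolynomial (Fin (n + 1)) K)) : L ≤ saturation L :=
  fun p hp i => ⟨0, by simpa using hp⟩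

theorem isSaturatedIdeal_saturation {L : Ideal (MvPolynomial (Fin (n + 1)) K)}
    (hL : IsHomogeneousIdeal L) : IsSaturatedIdeal (saturation L) := by
  constructor
  · intro p hp d i
    obtain ⟨k, hk⟩ := hp i
    refine ⟨k, ?_⟩
    have := hL _ hk (k + d)
    rwa [homogeneousComponent_mul_of_isHomogeneous (isHomogeneous_X_pow i k),
      if_pos (Nat.le_add_right k d), Nat.add_sub_cancel_left] at this
  · intro p hp i
    obtain ⟨k, hk⟩ := hp i
    obtain ⟨l, hl⟩ := hk i
    exact ⟨l + k, by rwa [pow_add, mul_assoc]⟩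

theorem exists_pow_mul_mem_of_mem_saturation (L : Ideal (MvPolynomial (Fin (n + 1)) K)) :
    ∃ k : ℕ, ∀ i, ∀ p ∈ saturation L, X i ^ k * p ∈ L := by
  obtain ⟨s, hs⟩ := IsNoetherian.noetherian (saturation L)
  have h_gen (i : Fin (n + 1)) (p : s) : ∃ k : ℕ, X i ^ k * p.1 ∈ L :=
    mem_saturation.1 (hs.le (Submodule.subset_span p.2)) i
  choose k hk using h_gen
  refine ⟨∑ i, ∑ p, k i p, fun i => ?_⟩
  suffices h_le : saturation L ≤ L.colon {X i ^ ∑ i, ∑ p, k i p} from fun p hp => by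
    simpa only [smul_eq_mul, mul_comm] using Submodule.mem_colon_singleton.1 (h_le hp)
  rw [← hs, Submodule.span_le]
  intro p hp
  rw [SetLike.mem_coe, Submodule.mem_colon_singleton, smul_eq_mul, mul_comm]
  refine L.mem_of_dvd (mul_dvd_mul_right (pow_dvd_pow _ ?_) _) (hk i ⟨p, hp⟩)
  exact (Finset.single_le_sum_of_canonicallyOrdered (Finset.mem_univ _)).trans
    (Finset.single_le_sum_of_canonicallyOrdered (f := fun i => ∑ p, k i p) (Finset.mem_univ i))

theorem exists_monomial_mul_mem_of_mem_saturation (L : Ideal (MvPolynomial (Fin (n + 1)) K)) :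
    ∃ N : ℕ, ∀ (B : Fin (n + 1) →₀ ℕ) (c : K) (p : MvPolynomial (Fin (n + 1)) K),
      N < B.degree → p ∈ saturation L → monomial B c * p ∈ L := by
  obtain ⟨k, hk⟩ := exists_pow_mul_mem_of_mem_saturation L
  refine ⟨(n + 1) * k, fun B c p hB hp => ?_⟩
  obtain ⟨i, hi⟩ : ∃ i, k ≤ B i := by
    by_contra! h
    refine hB.not_ge ?_
    rw [Finsupp.degree_eq_sum]
    exact (Finset.sum_le_card_nsmul Finset.univ _ k fun i _ => (h i).le).trans (by simp)
  refine L.mem_of_dvd (mul_dvd_mul_right ?_ _) (hk i p hp)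
  rw [X_pow_eq_monomial]
  exact monomial_dvd_monomial.2 ⟨Or.inr (by simpa using hi), one_dvd c⟩

theorem exists_gradedPiece_saturation_eq {L : Ideal (MvPolynomial (Fin (n + 1)) K)}
    (hL : IsHomogeneousIdeal L) :
    ∃ N : ℕ, ∀ d ≥ N, gradedPiece (saturation L) d = gradedPiece L d := by
  obtain ⟨l, s, hs⟩ := Submodule.fg_iff_exists_fin_generating_family.1
    (IsNoetherian.noetherian (saturation L))
  obtain ⟨N, hN⟩ := exists_monomial_mul_mem_of_mem_saturation L
  refine ⟨N + ∑ j, (s j).totalDegree + 1, fun d hd => le_antisymm (fun p hp => ?_)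
    fun p hp => le_saturation L hp⟩
  rw [mem_gradedPiece] at hp ⊢
  obtain ⟨c, hc⟩ := Ideal.mem_span_range_iff_exists_fun.1 (hs.ge hp)
  rw [← homogeneousComponent_eq_self p.2, ← hc, map_sum]
  refine L.sum_mem fun j _ => ?_
  rw [(c j).as_sum, Finset.sum_mul, map_sum]
  refine L.sum_mem fun B _ => ?_
  rw [homogeneousComponent_mul_of_isHomogeneous (isHomogeneous_monomial _ rfl)]
  split_ifs with hB
  · rcases lt_or_ge (s j).totalDegree (d - B.degree) with h_deg | h_deg
    · rw [homogeneousComponent_eq_zero _ _ h_deg, mul_zero]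
      exact L.zero_mem
    · have h_le : (s j).totalDegree ≤ ∑ j, (s j).totalDegree :=
        Finset.single_le_sum_of_canonicallyOrdered (f := fun j => (s j).totalDegree)
          (Finset.mem_univ j)
      exact hN B _ _ (by omega) ((isSaturatedIdeal_saturation hL).1 _
        (hs.le (Ideal.subset_span ⟨j, rfl⟩)) _)
  · exact L.zero_mem

end Saturation

/-! ### The limit of the path -/

section Limit

variable {K : Type*} [Field K] {n : ℕ}

/-- The ideal of the limit of `λ_w(t) J` as `t` tends to `0`: the fibre at `0` of the ideal of the
family. It need not be saturated. -/
def limitIdeal (w : Fin (n + 1) → ℤ) (J : Ideal (MvPolynomial (Fin (n + 1)) K)) :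
    Ideal (MvPolynomial (Fin (n + 1)) K) :=
  (familyIdeal w J).map (MvPolynomial.map (Polynomial.evalRingHom 0))

theorem isHomogeneousIdeal_limitIdeal (w : Fin (n + 1) → ℤ)
    {J : Ideal (MvPolynomial (Fin (n + 1)) K)} (hJ : IsHomogeneousIdeal J) :
    IsHomogeneousIdeal (limitIdeal w J) :=
  isHomogeneousIdeal_map (isHomogeneousIdeal_familyIdeal w hJ) _ (evalRingHom_surjective 0)

theorem fibre_zero_idealForms_familyIdeal (w : Fin (n + 1) → ℤ)
    {J : Ideal (MvPolynomial (Fin (n + 1)) K)} (hJ : IsHomogeneousIdeal J) (d : ℕ) :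
    fibre (idealForms (familyIdeal w J) d) 0 = gradedPiece (limitIdeal w J) d :=
  fibre_idealForms (isHomogeneousIdeal_familyIdeal w hJ) d 0

theorem finrank_gradedPiece_limitIdeal [Infinite K] (w : Fin (n + 1) → ℤ)
    {J : Ideal (MvPolynomial (Fin (n + 1)) K)} (hJ : IsHomogeneousIdeal J) (d : ℕ) :
    Module.finrank K (gradedPiece (limitIdeal w J) d) =
      Module.finrank K (gradedPiece J d) := by
  obtain ⟨b, F, h⟩ := exists_isReduced w (W := gradedPiece J d) rfl
  rw [← fibre_zero_idealForms_familyIdeal w hJ, h.idealForms_familyIdeal_eq,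
    h.isGraphData.fibre_eq]
  exact (h.isGraphData.map (Polynomial.evalRingHom 0)).finrank_eq

/-- The number `m` bounds the regularity of all saturated ideals with Hilbert polynomial `P`. The
Gotzmann number of `P` is the least such bound. -/
def IsRegularityBound (K : Type*) [Field K] (n : ℕ) (P : ℚ[X]) (m : ℕ) : Prop :=
  ∀ I : Ideal (MvPolynomial (Fin (n + 1)) K),
    IsSaturatedIdeal I → HasHilbertPoly I P → IsRegular m I

variable {P : ℚ[X]} {m : ℕ} {w : Fin (n + 1) → ℤ} {J : Ideal (MvPolynomial (Fin (n + 1)) K)}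

theorem hasHilbertPoly_saturation_limitIdeal [Infinite K] (w : Fin (n + 1) → ℤ)
    (hJ : IsSaturatedIdeal J) (hP : HasHilbertPoly J P) :
    HasHilbertPoly (saturation (limitIdeal w J)) P := by
  obtain ⟨N, hN⟩ := exists_gradedPiece_saturation_eq (isHomogeneousIdeal_limitIdeal w hJ.1)
  refine hasHilbertPoly_of_finrank_eq hP (N := N) fun d hd => ?_
  rw [hN d hd, finrank_gradedPiece_limitIdeal w hJ.1]

theorem gradedPiece_saturation_limitIdeal [Infinite K] (w : Fin (n + 1) → ℤ)
    (hm : IsRegularityBound K n P m) (hJ : IsSaturatedIdeal J) (hP : HasHilbertPoly J P) {d : ℕ}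
    (hd : m ≤ d) :
    gradedPiece (saturation (limitIdeal w J)) d = gradedPiece (limitIdeal w J) d := by
  have hsat := isSaturatedIdeal_saturation (isHomogeneousIdeal_limitIdeal w hJ.1)
  have hPsat := hasHilbertPoly_saturation_limitIdeal w hJ hP
  have hfinrank : Module.finrank K (gradedPiece (saturation (limitIdeal w J)) d) =
      Module.finrank K (gradedPiece J d) := by
    rw [← Nat.cast_inj (R := ℚ), (hm _ hsat hPsat).finrank_eq hPsat hd,
      (hm J hJ hP).finrank_eq hP hd]
  refine (Submodule.eq_of_le_of_finrank_eq (fun p hp => le_saturation _ hp) ?_).symm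
  rw [hfinrank, finrank_gradedPiece_limitIdeal w hJ.1]

theorem gradedPiece_limitIdeal_mem_hilb [Infinite K] (w : Fin (n + 1) → ℤ)
    (hm : IsRegularityBound K n P m) (hJ : IsSaturatedIdeal J) (hP : HasHilbertPoly J P) :
    gradedPiece (limitIdeal w J) m ∈ hilb K n P m :=
  ⟨saturation (limitIdeal w J),
    isSaturatedIdeal_saturation (isHomogeneousIdeal_limitIdeal w hJ.1),
    hasHilbertPoly_saturation_limitIdeal w hJ hP,
    (gradedPiece_saturation_limitIdeal w hm hJ hP le_rfl).symm⟩

theorem gradedPiece_span_limitIdeal [Infinite K] (w : Fin (n + 1) → ℤ)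
    (hm : IsRegularityBound K n P m) (hJ : IsSaturatedIdeal J) (hP : HasHilbertPoly J P) {d : ℕ}
    (hd : m ≤ d) :
    gradedPiece (Ideal.span ((fun p : Forms K n m => p.1) ''
      (gradedPiece (limitIdeal w J) m : Set _))) d = gradedPiece (limitIdeal w J) d := by
  have h := (hm _ (isSaturatedIdeal_saturation (isHomogeneousIdeal_limitIdeal w hJ.1))
    (hasHilbertPoly_saturation_limitIdeal w hJ hP)).gradedPiece_span hd
  rwa [gradedPiece_saturation_limitIdeal w hm hJ hP hd,
    gradedPiece_saturation_limitIdeal w hm hJ hP le_rfl] at h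

theorem hasHilbertPoly_translate (h : GL (Fin (n + 1)) K) (hP : HasHilbertPoly J P) :
    HasHilbertPoly (translate h J) P :=
  hasHilbertPoly_of_finrank_eq hP (N := 0) fun d _ => finrank_gradedPiece_translate h J d

theorem fibre_idealForms_familyIdeal [Infinite K] (w : Fin (n + 1) → ℤ)
    (J : Ideal (MvPolynomial (Fin (n + 1)) K)) (d : ℕ) {a : K} (ha : a ≠ 0) :
    fibre (idealForms (familyIdeal w J) d) a = gradedPiece (translate (oneParamGL w a ha) J) d := by
  obtain ⟨b, F, h⟩ := exists_isReduced w (W := gradedPiece J d) rfl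
  rw [h.idealForms_familyIdeal_eq, h.isGraphData.fibre_eq, h.gradedPiece_translate_eq ha]

theorem isHilbCurve_idealForms_familyIdeal [Infinite K] (w : Fin (n + 1) → ℤ)
    (hm : IsRegularityBound K n P m) (hJ : IsSaturatedIdeal J) (hP : HasHilbertPoly J P) :
    IsHilbCurve P (idealForms (familyIdeal w J) m) := by
  refine ⟨?_, fun a => ?_⟩
  · obtain ⟨b, F, h⟩ := exists_isReduced w (W := gradedPiece J m) rfl
    rw [h.idealForms_familyIdeal_eq]
    exact flat_quotient_graphForms
  · obtain rfl | ha := eq_or_ne a 0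
    · rw [fibre_zero_idealForms_familyIdeal w hJ.1]
      exact gradedPiece_limitIdeal_mem_hilb w hm hJ hP
    · rw [fibre_idealForms_familyIdeal w J m ha]
      exact ⟨_, isSaturatedIdeal_translate _ hJ, hasHilbertPoly_translate _ hP, rfl⟩

theorem eq_idealForms_familyIdeal_of_fibre_eq [Infinite K] {d : ℕ}
    {M : Submodule K[X] (Forms K[X] n d)} (hM : Module.Flat K[X] (Forms K[X] n d ⧸ M))
    (hfibre : ∀ (a : K) (ha : a ≠ 0),
      fibre M a = gradedPiece (translate (oneParamGL w a ha) J) d) :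
    M = idealForms (familyIdeal w J) d := by
  obtain ⟨b, F, h⟩ := exists_isReduced w (W := gradedPiece J d) rfl
  rw [h.idealForms_familyIdeal_eq]
  refine h.isGraphData.eq_of_fibre_eq hM fun a ha => ?_
  rw [hfibre a ha, h.gradedPiece_translate_eq ha]

theorem map_matAct_oneParam_map_glAct (w : Fin (n + 1) → ℤ) (g : GL (Fin (n + 1)) K)
    (I : Ideal (MvPolynomial (Fin (n + 1)) K)) (d : ℕ) {a : K} (ha : a ≠ 0) :
    ((gradedPiece I d).map (glAct d g).toLinearMap).map (matAct d (oneParam w a)) =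
      gradedPiece (translate (oneParamGL w a ha) (translate g I)) d := by
  rw [gradedPiece_translate, gradedPiece_translate]
  rfl

theorem isPath_iff [Infinite K] (w : Fin (n + 1) → ℤ) (hm : IsRegularityBound K n P m)
    {I : Ideal (MvPolynomial (Fin (n + 1)) K)} (hI : IsSaturatedIdeal I)
    (hP : HasHilbertPoly I P) (g : GL (Fin (n + 1)) K)
    (M : Submodule K[X] (Forms K[X] n m)) :
    IsPath P w g (gradedPiece I m) M ↔ M = idealForms (familyIdeal w (translate g I)) m := by
  constructor
  · rintro ⟨⟨hflat, -⟩, hpath⟩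
    exact eq_idealForms_familyIdeal_of_fibre_eq hflat fun a ha => by
      rw [hpath a ha, map_matAct_oneParam_map_glAct w g I m ha]
  · rintro rfl
    refine ⟨isHilbCurve_idealForms_familyIdeal w hm (isSaturatedIdeal_translate g hI)
      (hasHilbertPoly_translate g hP), fun a ha => ?_⟩
    rw [fibre_idealForms_familyIdeal w _ m ha, map_matAct_oneParam_map_glAct w g I m ha]

end Limit

/-! ### Flatness of first order deformations -/

section Flat

open TensorProduct in
theorem exists_eq_tmul_of_eq_span_singleton {R N : Type*} [CommRing R] [AddCommGroup N]
    [Module R N] {I : Ideal R} {e : R} (he : e ∈ I) (hI : I = Ideal.span {e}) (t : I ⊗[R] N) :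
    ∃ x : N, t = (⟨e, he⟩ : I) ⊗ₜ[R] x := by
  induction t using TensorProduct.induction_on with
  | zero => exact ⟨0, (tmul_zero _ _).symm⟩
  | tmul a x =>
    obtain ⟨c, hc⟩ := Ideal.mem_span_singleton'.1 (hI.le a.2)
    have ha : a = c • (⟨e, he⟩ : I) := Subtype.ext hc.symm
    exact ⟨c • x, by rw [ha, smul_tmul]⟩
  | add s t hs ht =>
    obtain ⟨x, rfl⟩ := hs
    obtain ⟨y, rfl⟩ := ht
    exact ⟨x + y, (tmul_add _ _ _).symm⟩

open TensorProduct in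
theorem injective_lift_lsmul_of_eq_span_singleton {R N : Type*} [CommRing R] [AddCommGroup N]
    [Module R N] {I : Ideal R} {e : R} (he : e ∈ I) (hI : I = Ideal.span {e})
    (h : ∀ x : N, e • x = 0 → (⟨e, he⟩ : I) ⊗ₜ[R] x = 0) :
    Function.Injective (TensorProduct.lift ((LinearMap.lsmul R N).comp I.subtype)) := by
  rw [← LinearMap.ker_eq_bot, LinearMap.ker_eq_bot']
  intro t ht
  obtain ⟨x, rfl⟩ := exists_eq_tmul_of_eq_span_singleton he hI t
  exact h x ht

variable {K : Type*} [Field K] {n m : ℕ}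

open TensorProduct in
theorem flat_dualNumber_of_ker_le_range {N : Type*} [AddCommGroup N] [Module (DualNumber K) N]
    (h : ∀ x : N, (DualNumber.eps : DualNumber K) • x = 0 →
      ∃ y : N, x = (DualNumber.eps : DualNumber K) • y) : Module.Flat (DualNumber K) N := by
  rw [Module.Flat.iff_lift_lsmul_comp_subtype_injective]
  rintro I -
  obtain rfl | rfl | rfl := DualNumber.ideal_trichotomy I
  · exact injective_lift_lsmul_of_eq_span_singleton (zero_mem _) Ideal.span_singleton_zero.symm
      fun x _ => zero_tmul _ x
  · refine injective_lift_lsmul_of_eq_span_singleton (Ideal.mem_span_singleton_self _) rfl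
      fun x hx => ?_
    obtain ⟨y, rfl⟩ := h x hx
    have hsq : (DualNumber.eps : DualNumber K) • (⟨_, Ideal.mem_span_singleton_self _⟩ :
        Ideal.span {(DualNumber.eps : DualNumber K)}) = 0 := Subtype.ext DualNumber.eps_mul_eps
    rw [tmul_smul, smul_tmul', hsq, zero_tmul]
  · refine injective_lift_lsmul_of_eq_span_singleton Submodule.mem_top
      Ideal.span_singleton_one.symm fun x hx => ?_
    rw [← one_smul (DualNumber K) x, hx, tmul_zero]

section DualPoly

variable {σ : Type*}

/-- The polynomial `p + ε q` over the dual numbers. -/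
def dualPoly (p q : MvPolynomial σ K) : MvPolynomial σ (DualNumber K) :=
  MvPolynomial.map (algebraMap K (DualNumber K)) p +
    C DualNumber.eps * MvPolynomial.map (algebraMap K (DualNumber K)) q

theorem dualPoly_add (p q p' q' : MvPolynomial σ K) :
    dualPoly p q + dualPoly p' q' = dualPoly (p + p') (q + q') := by
  simp only [dualPoly, map_add]
  ring

theorem dualPoly_mul (p q p' q' : MvPolynomial σ K) :
    dualPoly p q * dualPoly p' q' = dualPoly (p * p') (p * q' + q * p') := by
  have h : (C DualNumber.eps : MvPolynomial σ (DualNumber K)) * C DualNumber.eps = 0 := by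
    rw [← C_mul, DualNumber.eps_mul_eps, C_0]
  simp only [dualPoly, map_add, map_mul]
  linear_combination (MvPolynomial.map (algebraMap K (DualNumber K)) q *
    MvPolynomial.map (algebraMap K (DualNumber K)) q') * h

theorem eps_smul_dualPoly (p q : MvPolynomial σ K) :
    (DualNumber.eps : DualNumber K) • dualPoly p q = dualPoly 0 p := by
  have h := dualPoly_mul 0 1 p q
  rw [zero_mul, zero_mul, zero_add, one_mul] at h
  rw [← h, smul_eq_C_mul]
  congr 1
  simp [dualPoly]

theorem exists_eq_dualPoly (y : MvPolynomial σ (DualNumber K)) :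
    ∃ p q : MvPolynomial σ K, y = dualPoly p q := by
  induction y using MvPolynomial.induction_on with
  | C a =>
    refine ⟨C a.fst, C a.snd, ?_⟩
    simp only [dualPoly, map_C, ← C_mul, ← C_add, TrivSqZeroExt.algebraMap_eq_inl]
    congr 1
    ext <;> simp
  | add y y' hy hy' =>
    obtain ⟨p, q, rfl⟩ := hy
    obtain ⟨p', q', rfl⟩ := hy'
    exact ⟨_, _, dualPoly_add p q p' q'⟩
  | mul_X y i hy =>
    obtain ⟨p, q, rfl⟩ := hy
    refine ⟨p * X i, q * X i, ?_⟩
    simp only [dualPoly, map_mul, map_X]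
    ring

/-- The polynomials with coefficients in `K[t]` that are divisible by `t ^ k`. -/
abbrev jetIdeal (K σ : Type*) [Field K] (k : ℕ) : Ideal (MvPolynomial σ K[X]) :=
  Ideal.span {C (Polynomial.X ^ k)}

/-- The reduction modulo `t ^ (k + 2)` of polynomials over the dual numbers along `ε ↦ t ^ (k + 1)`.
It compares the first order deformation defined by a tangent vector with the curve to which the
vector is tangent to order `k + 1`. -/
def jetHom (K σ : Type*) [Field K] (k : ℕ) :
    MvPolynomial σ (DualNumber K) →+* MvPolynomial σ K[X] ⧸ jetIdeal K σ (k + 2) :=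
  let t := Ideal.Quotient.mk (jetIdeal K σ (k + 2)) (C (Polynomial.X ^ (k + 1)))
  have ht : t * t = 0 := by
    rw [← map_mul, Ideal.Quotient.eq_zero_iff_mem, Ideal.mem_span_singleton]
    exact ⟨C (Polynomial.X ^ k), by rw [← C_mul, ← C_mul]; ring_nf⟩
  eval₂Hom (S₁ := MvPolynomial σ K[X] ⧸ jetIdeal K σ (k + 2))
    (DualNumber.lift (R := K) ⟨(Algebra.ofId K _, t), ht, fun _ => Commute.all t _⟩).toRingHom
    fun i => Ideal.Quotient.mk _ (X i)

theorem jetHom_dualPoly (k : ℕ) (p q : MvPolynomial σ K) :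
    jetHom K σ k (dualPoly p q) = Ideal.Quotient.mk _ (MvPolynomial.map Polynomial.C p +
      C (Polynomial.X ^ (k + 1)) * MvPolynomial.map Polynomial.C q) := by
  have hmap (s : MvPolynomial σ K) :
      jetHom K σ k (MvPolynomial.map (algebraMap K (DualNumber K)) s) =
        Ideal.Quotient.mk _ (MvPolynomial.map Polynomial.C s) := by
    refine congrArg (fun f : MvPolynomial σ K →+* _ => f s) (MvPolynomial.ringHom_ext
      (f := (jetHom K σ k).comp (MvPolynomial.map (algebraMap K (DualNumber K))))
      (g := (Ideal.Quotient.mk _).comp (MvPolynomial.map Polynomial.C)) (fun c => ?_) fun i => ?_)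
    · rw [RingHom.comp_apply, RingHom.comp_apply, map_C, map_C]
      simp only [jetHom, eval₂Hom_C, TrivSqZeroExt.algebraMap_eq_inl]
      exact DualNumber.lift_apply_inl _ c
    · simp [jetHom]
  have heps : jetHom K σ k (C DualNumber.eps) =
      Ideal.Quotient.mk _ (C (Polynomial.X ^ (k + 1))) := by
    rw [jetHom, eval₂Hom_C]
    exact DualNumber.lift_apply_eps _
  rw [dualPoly, map_add, map_mul, hmap, hmap, heps, map_add, map_mul]

theorem map_evalRingHom_map_C (a : K) (p : MvPolynomial σ K) :
    MvPolynomial.map (Polynomial.evalRingHom a) (MvPolynomial.map Polynomial.C p) = p := by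
  rw [MvPolynomial.map_map, show (Polynomial.evalRingHom a).comp Polynomial.C = RingHom.id K by
    ext; simp, MvPolynomial.map_id]

theorem exists_eq_map_C_add (p : MvPolynomial σ K[X]) : ∃ q, p =
    MvPolynomial.map Polynomial.C (MvPolynomial.map (Polynomial.evalRingHom 0) p) +
      C Polynomial.X * q := by
  have hmem : p - MvPolynomial.map Polynomial.C (MvPolynomial.map (Polynomial.evalRingHom 0) p) ∈
      RingHom.ker (MvPolynomial.map (σ := σ) (Polynomial.evalRingHom (0 : K))) := by
    rw [RingHom.mem_ker, map_sub, map_evalRingHom_map_C, sub_self]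
  rw [MvPolynomial.ker_map, Polynomial.ker_evalRingHom, map_zero, sub_zero, Ideal.map_span,
    Set.image_singleton, Ideal.mem_span_singleton] at hmem
  obtain ⟨q, hq⟩ := hmem
  exact ⟨q, sub_eq_iff_eq_add'.1 hq⟩

end DualPoly

theorem exists_dualPoly_mem_deformationIdeal {V : Submodule K (Forms K n m)}
    {φ : GrassTangent V} {s : MvPolynomial (Fin (n + 1)) K}
    (hs : s ∈ Ideal.span ((fun p : Forms K n m => p.1) '' (V : Set (Forms K n m)))) :
    ∃ s', dualPoly s s' ∈ deformationIdeal V φ := by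
  induction hs using Submodule.span_induction with
  | mem s hs =>
    obtain ⟨v, hv, rfl⟩ := hs
    obtain ⟨u, hu⟩ := V.mkQ_surjective (φ ⟨v, hv⟩)
    exact ⟨u.1, Ideal.subset_span ⟨⟨v, hv⟩, u, hu, rfl⟩⟩
  | zero => exact ⟨0, by simp [dualPoly]⟩
  | add s t _ _ hs ht =>
    obtain ⟨s', hs⟩ := hs
    obtain ⟨t', ht⟩ := ht
    exact ⟨s' + t', by rw [← dualPoly_add]; exact Ideal.add_mem _ hs ht⟩
  | smul a s _ hs =>
    obtain ⟨s', hs⟩ := hs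
    refine ⟨a * s', ?_⟩
    have := Ideal.mul_mem_left _ (dualPoly a 0) hs
    rwa [dualPoly_mul, zero_mul, add_zero] at this

theorem deformationIdeal_le_comap_jetHom {M : Submodule K[X] (Forms K[X] n m)}
    {φ : GrassTangent (fibre M 0)} {k : ℕ}
    (hφ : ∀ v : fibre M 0, ∃ (u : Forms K n m) (q : Forms K[X] n m),
      (fibre M 0).mkQ u = φ v ∧ coeffMap Polynomial.C (v : Forms K n m) +
        (Polynomial.X ^ (k + 1) : K[X]) • coeffMap Polynomial.C u +
        (Polynomial.X ^ (k + 1 + 1) : K[X]) • q ∈ M) :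
    deformationIdeal (fibre M 0) φ ≤
      ((Ideal.span ((fun p : Forms K[X] n m => p.1) '' (M : Set (Forms K[X] n m)))).map
        (Ideal.Quotient.mk _)).comap (jetHom K (Fin (n + 1)) k) := by
  refine Ideal.span_le.2 ?_
  rintro _ ⟨v, u, hu, rfl⟩
  obtain ⟨u', q, hu', hsection⟩ := hφ v
  obtain ⟨z, hz, hzu⟩ := mem_fibre.1 ((Submodule.Quotient.eq _).1 (hu'.trans hu.symm))
  obtain ⟨z', hz'⟩ := exists_eq_map_C_add z.1
  replace hzu : MvPolynomial.map (Polynomial.evalRingHom 0) z.1 = u'.1 - u.1 :=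
    congrArg Subtype.val hzu
  change dualPoly v.1.1 u.1 ∈ Ideal.comap _ _
  rw [Ideal.mem_comap, jetHom_dualPoly, Ideal.mem_quotient_iff_mem_sup, Submodule.mem_sup]
  -- Correcting `u'` to `u` costs `t ^ (k + 1)` times the section `z` through `u' - u`.
  refine ⟨_, Ideal.sub_mem _ (Ideal.subset_span ⟨_, hsection, rfl⟩)
    (Ideal.mul_mem_left _ (C (Polynomial.X ^ (k + 1))) (Ideal.subset_span ⟨z, hz, rfl⟩)), _,
    Ideal.mul_mem_left _ (z' - q.1) (Ideal.mem_span_singleton_self _), ?_⟩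
  simp only [Submodule.coe_add, Submodule.coe_smul, smul_eq_C_mul, coeffMap]
  rw [hz', hzu]
  simp only [map_sub, map_pow]
  ring

variable {𝓜 : Ideal (MvPolynomial (Fin (n + 1)) K[X])}

theorem mem_span_fibre_zero_of_X_pow_mul_mem (hhom : IsHomogeneousIdeal 𝓜)
    (hsat : ∀ (k : ℕ) (q : MvPolynomial (Fin (n + 1)) K[X]),
      C (Polynomial.X ^ k) * q ∈ 𝓜 → q ∈ 𝓜)
    (hgen : ∀ d ≥ m, gradedPiece (Ideal.span ((fun p : Forms K n m => p.1) ''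
      (gradedPiece (𝓜.map (MvPolynomial.map (Polynomial.evalRingHom 0))) m : Set _))) d =
        gradedPiece (𝓜.map (MvPolynomial.map (Polynomial.evalRingHom 0))) d)
    {k : ℕ} {p : MvPolynomial (Fin (n + 1)) K[X]}
    (hp : C (Polynomial.X ^ k) * p ∈ Ideal.span ((fun p : Forms K[X] n m => p.1) ''
      (idealForms 𝓜 m : Set (Forms K[X] n m)))) :
    MvPolynomial.map (Polynomial.evalRingHom 0) p ∈ Ideal.span ((fun p : Forms K n m => p.1) ''
      (fibre (idealForms 𝓜 m) 0 : Set (Forms K n m))) := by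
  refine mem_of_homogeneousComponent_mem fun d => ?_
  obtain hd | hd := lt_or_ge d m
  · have hcomponent : homogeneousComponent d p = 0 := by
      refine MvPolynomial.ext _ _ fun A => ?_
      rw [coeff_homogeneousComponent, coeff_zero]
      split_ifs with hA
      · have hcoeff := coeff_eq_zero_of_mem_span (by rintro _ ⟨v, -, rfl⟩; exact v.2) hp
          (hA.trans_lt hd)
        rw [coeff_C_mul] at hcoeff
        exact (mul_eq_zero.1 hcoeff).resolve_left (pow_ne_zero _ Polynomial.X_ne_zero)
      · rfl
    rw [homogeneousComponent_map, hcomponent, map_zero]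
    exact Ideal.zero_mem _
  · have hp𝓜 : p ∈ 𝓜 := hsat k p (Ideal.span_le.2 (by rintro _ ⟨v, hv, rfl⟩; exact hv) hp)
    have hmem : (⟨_, homogeneousComponent_mem d
        (MvPolynomial.map (Polynomial.evalRingHom 0) p)⟩ : Forms K n d) ∈
          gradedPiece (𝓜.map (MvPolynomial.map (Polynomial.evalRingHom 0))) d :=
      isHomogeneousIdeal_map hhom _ (evalRingHom_surjective 0) _ (Ideal.mem_map_of_mem _ hp𝓜) d
    rw [← hgen d hd, ← fibre_idealForms hhom m 0] at hmem
    exact hmem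

theorem isHilbTangent_of_isTangentVectorAtZero (hhom : IsHomogeneousIdeal 𝓜)
    (hsat : ∀ (k : ℕ) (q : MvPolynomial (Fin (n + 1)) K[X]),
      C (Polynomial.X ^ k) * q ∈ 𝓜 → q ∈ 𝓜)
    (hgen : ∀ d ≥ m, gradedPiece (Ideal.span ((fun p : Forms K n m => p.1) ''
      (gradedPiece (𝓜.map (MvPolynomial.map (Polynomial.evalRingHom 0))) m : Set _))) d =
        gradedPiece (𝓜.map (MvPolynomial.map (Polynomial.evalRingHom 0))) d)
    {φ : GrassTangent (fibre (idealForms 𝓜 m) 0)}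
    (hφ : IsTangentVectorAtZero (idealForms 𝓜 m) φ) :
    IsHilbTangent (fibre (idealForms 𝓜 m) 0) φ := by
  obtain ⟨-, k, hk, hφ⟩ := hφ
  obtain ⟨k, rfl⟩ := Nat.exists_eq_add_of_le' hk
  refine flat_dualNumber_of_ker_le_range fun x hx => ?_
  obtain ⟨y, rfl⟩ := Ideal.Quotient.mk_surjective x
  obtain ⟨s, s', rfl⟩ := exists_eq_dualPoly y
  have heps : dualPoly 0 s ∈ deformationIdeal (fibre (idealForms 𝓜 m) 0) φ := by
    rw [← eps_smul_dualPoly s s']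
    exact Ideal.Quotient.eq_zero_iff_mem.1 hx
  obtain ⟨q, hq⟩ : ∃ q, C (Polynomial.X ^ (k + 1)) *
      (MvPolynomial.map Polynomial.C s + C Polynomial.X * q) ∈
        Ideal.span ((fun p : Forms K[X] n m => p.1) '' (idealForms 𝓜 m : Set _)) := by
    have hjet := deformationIdeal_le_comap_jetHom hφ heps
    rw [Ideal.mem_comap, jetHom_dualPoly, Ideal.mem_quotient_iff_mem_sup, Submodule.mem_sup] at hjet
    obtain ⟨p, hp, _, hqt, heq⟩ := hjet
    obtain ⟨q, rfl⟩ := Ideal.mem_span_singleton'.1 hqt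
    refine ⟨-q, ?_⟩
    convert hp using 1
    rw [map_zero, zero_add] at heq
    rw [eq_sub_of_add_eq heq, pow_succ Polynomial.X (k + 1), C_mul]
    ring
  have hs := mem_span_fibre_zero_of_X_pow_mul_mem hhom hsat hgen hq
  rw [map_add, map_mul, map_C, map_evalRingHom_map_C, Polynomial.coe_evalRingHom,
    Polynomial.eval_X, C_0, zero_mul, add_zero] at hs
  obtain ⟨s'', hs''⟩ := exists_dualPoly_mem_deformationIdeal (φ := φ) hs
  refine ⟨Ideal.Quotient.mk _ (dualPoly (s' - s'') 0), ?_⟩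
  have hsub : dualPoly s s' =
      (DualNumber.eps : DualNumber K) • dualPoly (s' - s'') 0 + dualPoly s s'' := by
    rw [eps_smul_dualPoly, dualPoly_add, zero_add, sub_add_cancel]
  rw [hsub, map_add, Ideal.Quotient.eq_zero_iff_mem.2 hs'', add_zero]
  rfl

end Flat

/-! ### The action of upper triangular matrices on monomials -/

section Triangular

variable {R : Type*} [CommRing R] {n : ℕ}

theorem wt_add (w : Fin (n + 1) → ℤ) (A B : Fin (n + 1) →₀ ℕ) :
    wt w (A + B) = wt w A + wt w B := by
  simp [wt, mul_add, Finset.sum_add_distrib]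

theorem wt_single (w : Fin (n + 1) → ℤ) (i : Fin (n + 1)) :
    wt w (Finsupp.single i 1) = w i := by
  simp [wt, Finsupp.single_apply]

/-- The monomial `x^A` occurs in `p` with coefficient `c`, and all other monomials of `p` have
greater weight. -/
def HasLowest (w : Fin (n + 1) → ℤ) (A : Fin (n + 1) →₀ ℕ) (c : R)
    (p : MvPolynomial (Fin (n + 1)) R) : Prop :=
  coeff A p = c ∧ ∀ B, coeff B p ≠ 0 → B = A ∨ wt w A < wt w B

namespace HasLowest

variable {w : Fin (n + 1) → ℤ} {A B : Fin (n + 1) →₀ ℕ} {c d : R}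
  {p q : MvPolynomial (Fin (n + 1)) R}

protected theorem one (w : Fin (n + 1) → ℤ) :
    HasLowest w 0 1 (1 : MvPolynomial (Fin (n + 1)) R) := by
  refine ⟨by simp, fun B hB => Or.inl ?_⟩
  by_contra h
  exact hB (by rw [coeff_one, if_neg (Ne.symm h)])

theorem eq_and_eq_or_wt_lt (hp : HasLowest w A c p) (hq : HasLowest w B d q)
    {A' B' : Fin (n + 1) →₀ ℕ} (hne : coeff A' p * coeff B' q ≠ 0) :
    (A' = A ∧ B' = B) ∨ wt w (A + B) < wt w (A' + B') := by
  rw [wt_add, wt_add]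
  obtain rfl | hA := hp.2 A' (left_ne_zero_of_mul hne) <;>
    obtain rfl | hB := hq.2 B' (right_ne_zero_of_mul hne)
  · exact Or.inl ⟨rfl, rfl⟩
  all_goals exact Or.inr (by omega)

protected theorem mul (hp : HasLowest w A c p) (hq : HasLowest w B d q) :
    HasLowest w (A + B) (c * d) (p * q) := by
  classical
  constructor
  · rw [coeff_mul, Finset.sum_eq_single (A, B), hp.1, hq.1]
    · rintro ⟨A', B'⟩ hmem hne
      have hadd : A' + B' = A + B := Finset.HasAntidiagonal.mem_antidiagonal.1 hmem
      by_contra h0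
      obtain ⟨rfl, rfl⟩ | hlt := hp.eq_and_eq_or_wt_lt hq h0
      · exact hne rfl
      · exact hlt.ne (by rw [hadd])
    · intro hnotMem
      rw [Finset.HasAntidiagonal.mem_antidiagonal] at hnotMem
      exact absurd rfl hnotMem
  · intro D hD
    rw [coeff_mul] at hD
    obtain ⟨⟨A', B'⟩, hmem, h0⟩ := Finset.exists_ne_zero_of_sum_ne_zero hD
    rw [← Finset.HasAntidiagonal.mem_antidiagonal.1 hmem]
    exact (hp.eq_and_eq_or_wt_lt hq h0).imp_left fun h => by rw [h.1, h.2]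

protected theorem pow (hp : HasLowest w A c p) (k : ℕ) :
    HasLowest w (k • A) (c ^ k) (p ^ k) := by
  induction k with
  | zero => simpa only [zero_smul, pow_zero] using HasLowest.one w
  | succ k ih => simpa only [succ_nsmul, pow_succ] using ih.mul hp

protected theorem prod {ι : Type*} {s : Finset ι} {A : ι → Fin (n + 1) →₀ ℕ} {c : ι → R}
    {p : ι → MvPolynomial (Fin (n + 1)) R} (hp : ∀ i ∈ s, HasLowest w (A i) (c i) (p i)) :
    HasLowest w (∑ i ∈ s, A i) (∏ i ∈ s, c i) (∏ i ∈ s, p i) := by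
  induction s using Finset.cons_induction with
  | empty => exact HasLowest.one w
  | cons i s hi ih =>
    rw [Finset.sum_cons, Finset.prod_cons, Finset.prod_cons]
    exact (hp i (Finset.mem_cons_self i s)).mul
      (ih fun j hj => hp j (Finset.mem_cons_of_mem hj))

end HasLowest

/-- The character by which diagonal matrices act on the monomial `x^A`, as a function of the
diagonal entries of an arbitrary matrix. -/
def diagChar (h : Matrix (Fin (n + 1)) (Fin (n + 1)) R) (A : Fin (n + 1) →₀ ℕ) : R :=
  ∏ i, h i i ^ A i

theorem diagChar_add (h : Matrix (Fin (n + 1)) (Fin (n + 1)) R) (A B : Fin (n + 1) →₀ ℕ) :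
    diagChar h (A + B) = diagChar h A * diagChar h B := by
  simp [diagChar, pow_add, Finset.prod_mul_distrib]

theorem hasLowest_linSubst_X {w : Fin (n + 1) → ℤ} (hw : StrictAnti w)
    {h : Matrix (Fin (n + 1)) (Fin (n + 1)) R} (hh : ∀ i j, j < i → h i j = 0)
    (i : Fin (n + 1)) : HasLowest w (Finsupp.single i 1) (h i i) (linSubst h (X i)) := by
  rw [linSubst, aeval_X]
  constructor
  · simp [coeff_sum, coeff_X, Finsupp.single_left_inj]
  · intro B hB
    rw [coeff_sum] at hB
    obtain ⟨j, -, hj⟩ := Finset.exists_ne_zero_of_sum_ne_zero hB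
    rw [coeff_C_mul, coeff_X] at hj
    obtain rfl : Finsupp.single j 1 = B := (ite_ne_right_iff.1 (right_ne_zero_of_mul hj)).1
    rw [wt_single, wt_single]
    obtain hlt | rfl | hgt := lt_trichotomy j i
    · exact Or.inr (hw hlt)
    · exact Or.inl rfl
    · exact absurd (hh j i hgt) (left_ne_zero_of_mul hj)

theorem hasLowest_linSubst_monomial {w : Fin (n + 1) → ℤ} (hw : StrictAnti w)
    {h : Matrix (Fin (n + 1)) (Fin (n + 1)) R} (hh : ∀ i j, j < i → h i j = 0)
    (A : Fin (n + 1) →₀ ℕ) : HasLowest w A (diagChar h A) (linSubst h (monomial A 1)) := by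
  have hmonomial : linSubst h (monomial A 1) = ∏ i, linSubst h (X i) ^ A i := by
    rw [monomial_eq, Finsupp.prod_fintype _ _ fun i => pow_zero _, C_1, one_mul, map_prod]
    simp only [map_pow]
  have hA : A = ∑ i, A i • Finsupp.single i 1 := by
    simp only [Finsupp.smul_single_one, Finsupp.univ_sum_single]
  rw [hmonomial]
  conv => arg 2; rw [hA]
  exact HasLowest.prod fun i _ => (hasLowest_linSubst_X hw hh i).pow (A i)

theorem diagChar_ne_zero [IsDomain R] {h : Matrix (Fin (n + 1)) (Fin (n + 1)) R}
    (hh : h.IsUpperTriangular) (hdet : h.det ≠ 0) (A : Fin (n + 1) →₀ ℕ) :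
    diagChar h A ≠ 0 := by
  rw [Matrix.det_of_isUpperTriangular hh] at hdet
  exact Finset.prod_ne_zero_iff.2 fun i hi =>
    pow_ne_zero _ (Finset.prod_ne_zero_iff.1 hdet i hi)

section Matrix

variable {κ L : Type*} [Fintype κ] [LinearOrder L] {p : Matrix κ κ R} {ω : κ → L}

theorem exists_mulVec_eq_of_triangular (hp : ∀ i j, p i j ≠ 0 → i = j ∨ ω i < ω j)
    {Y : κ → R} (hY : Y ≠ 0) : ∃ i, Y i ≠ 0 ∧ p.mulVec Y i = p i i * Y i := by
  obtain ⟨i₀, hi₀⟩ := Function.ne_iff.1 hY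
  obtain ⟨i, hi, hmax⟩ := Set.exists_max_image {i | Y i ≠ 0} ω (Set.toFinite _) ⟨i₀, hi₀⟩
  refine ⟨i, hi, ?_⟩
  rw [Matrix.mulVec, dotProduct]
  refine Finset.sum_eq_single i (fun j _ hj => ?_) (by simp)
  by_contra h0
  obtain rfl | hlt := hp i j (left_ne_zero_of_mul h0)
  · exact hj rfl
  · exact (hmax j (right_ne_zero_of_mul h0)).not_gt hlt

theorem det_ne_zero_of_triangular [IsDomain R] [DecidableEq κ]
    (hp : ∀ i j, p i j ≠ 0 → i = j ∨ ω i < ω j) (hd : ∀ i, p i i ≠ 0) : p.det ≠ 0 := by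
  rw [Ne, ← Matrix.exists_mulVec_eq_zero_iff]
  rintro ⟨Y, hY, h0⟩
  obtain ⟨i, hi, h⟩ := exists_mulVec_eq_of_triangular hp hY
  rw [h0] at h
  exact mul_ne_zero (hd i) hi h.symm

end Matrix

end Triangular

/-! ### The limit of a generic translate is fixed by the Borel group -/

section Borel

variable {K : Type*} [Field K] {n m r : ℕ}

/-- `W` is in general coordinates: it has all the states of its translates. -/
def IsGeneric (r : ℕ) (W : Submodule K (Forms K n m)) : Prop :=
  ∀ (h : GL (Fin (n + 1)) K) (B : Fin r → (Fin (n + 1) →₀ ℕ)), (∀ j, (B j).degree = m) →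
    IsState (W.map (glAct m h).toLinearMap) B → IsState W B

theorem isGeneric_gradedPiece_translate {I : Ideal (MvPolynomial (Fin (n + 1)) K)}
    (f : Module.Basis (Fin r) K (gradedPiece I m)) {g : GL (Fin (n + 1)) K}
    (hg : g ∈ genericSet m fun i => (f i).1.1) :
    IsGeneric r (gradedPiece (translate g I) m) := by
  intro h B hB hs
  rw [← gradedPiece_translate, ← translate_mul, gradedPiece_translate] at hs
  rw [gradedPiece_translate]
  exact isState_of_mem_genericSet f hg (h * g) hB hs

variable {w : Fin (n + 1) → ℤ} {J : Ideal (MvPolynomial (Fin (n + 1)) K)}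
  {b : Fin r → (Fin (n + 1) →₀ ℕ)} {F : Fin r → Forms K n m}

/-- The coefficients of the translates by `h` of the sections of the family. -/
def transCoeff (w : Fin (n + 1) → ℤ) (b : Fin r → (Fin (n + 1) →₀ ℕ)) (F : Fin r → Forms K n m)
    (h : GL (Fin (n + 1)) K) (i : Fin r) (A : Fin (n + 1) →₀ ℕ) : K[X] :=
  coeff A (linSubst ((h : Matrix (Fin (n + 1)) (Fin (n + 1)) K).map Polynomial.C)
    (graphSection m (familyCoeff w b F) i).1)

/-- The matrix of the coefficients at the monomials `x^{B_j}` of the translates by `h` of the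
sections of the family. -/
def transMatrix (w : Fin (n + 1) → ℤ) (b : Fin r → (Fin (n + 1) →₀ ℕ)) (F : Fin r → Forms K n m)
    (h : GL (Fin (n + 1)) K) (B : Fin r → (Fin (n + 1) →₀ ℕ)) : Matrix (Fin r) (Fin r) K[X] :=
  Matrix.of fun i j => transCoeff w b F h i (B j)

theorem transCoeff_eq_zero (h : GL (Fin (n + 1)) K) (i : Fin r) {A : Fin (n + 1) →₀ ℕ}
    (hA : A.degree ≠ m) : transCoeff w b F h i A = 0 :=
  Forms.coeff_eq_zero (matAct m _ (graphSection m (familyCoeff w b F) i)) hA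

theorem eval_transCoeff (h : GL (Fin (n + 1)) K) (i : Fin r) (A : Fin (n + 1) →₀ ℕ) (a : K) :
    (transCoeff w b F h i A).eval a =
      coeff A (linSubst (h : Matrix (Fin (n + 1)) (Fin (n + 1)) K)
        (coeffMap (Polynomial.evalRingHom a) (graphSection m (familyCoeff w b F) i)).1) := by
  rw [← Polynomial.coe_evalRingHom, transCoeff, ← coeff_map, map_linSubst, Matrix.map_map]
  have : (Polynomial.evalRingHom a : K[X] → K) ∘ Polynomial.C = id := by
    ext x
    simp
  rw [this, Matrix.map_id]
  rfl

theorem IsReduced.coeff_glAct_eq_vecMul {W : Submodule K (Forms K n m)}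
    (hred : IsReduced w W b F) (h : GL (Fin (n + 1)) K) {a : K} {y : Forms K n m}
    (hy : y ∈ graphForms b fun i A => (familyCoeff w b F i A).eval a)
    (B : Fin r → (Fin (n + 1) →₀ ℕ)) (j : Fin r) :
    coeff (B j) (glAct m h y).1 = Matrix.vecMul (fun k => coeff (b k) y.1)
      ((transMatrix w b F h B).map (Polynomial.evalRingHom a)) j := by
  have hdata := hred.isGraphData.map (Polynomial.evalRingHom a)
  have hsection : ∀ k, coeffMap (Polynomial.evalRingHom a) (graphSection m (familyCoeff w b F) k) =
      graphSection m (fun i A => (familyCoeff w b F i A).eval a) k := fun k =>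
    Forms.ext_coeff fun A => by
      rw [coeff_coeffMap, hred.isGraphData.coeff_graphSection]
      exact (hdata.coeff_graphSection k A).symm
  have hentry : ∀ k, (transCoeff w b F h k (B j)).eval a =
      coeff (B j) (glAct m h (graphSection m (fun i A => (familyCoeff w b F i A).eval a) k)).1 :=
    fun k => by rw [eval_transCoeff, hsection, glAct_apply]
  conv_lhs => rw [hdata.eq_sum hy]
  rw [map_sum, Forms.coeff_sum]
  refine Finset.sum_congr rfl fun k _ => ?_
  rw [map_smul, Forms.coeff_smul]
  exact congrArg _ (hentry k).symm

/-- If the determinant does not vanish, it does not vanish at some `a ≠ 0`, where the members of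
the family are translates of `J`. -/
theorem isState_of_det_transMatrix_ne_zero [Infinite K] (hgen : IsGeneric r (gradedPiece J m))
    (hred : IsReduced w (gradedPiece J m) b F) (h : GL (Fin (n + 1)) K)
    {B : Fin r → (Fin (n + 1) →₀ ℕ)} (hdet : (transMatrix w b F h B).det ≠ 0) :
    IsState (gradedPiece J m) B := by
  have hB : ∀ j, (B j).degree = m := by
    intro j
    by_contra hj
    exact hdet (Matrix.det_eq_zero_of_column_eq_zero j fun i => transCoeff_eq_zero h i hj)
  obtain ⟨a, ha⟩ : ∃ a : K, (Polynomial.X * (transMatrix w b F h B).det).eval a ≠ 0 := by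
    by_contra! h0
    exact mul_ne_zero Polynomial.X_ne_zero hdet
      (Polynomial.funext fun a => by rw [h0, Polynomial.eval_zero])
  rw [Polynomial.eval_mul, Polynomial.eval_X] at ha
  have ha0 : a ≠ 0 := left_ne_zero_of_mul ha
  have hdeta : ((transMatrix w b F h B).map (Polynomial.evalRingHom a)).det ≠ 0 := by
    rw [← RingHom.mapMatrix_apply, ← RingHom.map_det]
    exact right_ne_zero_of_mul ha
  refine hgen (h * oneParamGL w a ha0) B hB ?_
  rw [← gradedPiece_translate, translate_mul, gradedPiece_translate,
    hred.gradedPiece_translate_eq ha0]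
  rintro _ ⟨y, hy, rfl⟩ hcoeff
  have hy0 : (fun k => coeff (b k) y.1) = 0 := Matrix.eq_zero_of_vecMul_eq_zero hdeta
    (funext fun j => (hred.coeff_glAct_eq_vecMul h hy B j).symm.trans (hcoeff j))
  rw [(hred.isGraphData.map (Polynomial.evalRingHom a)).eq_sum hy, map_sum]
  exact Finset.sum_eq_zero fun k _ => by rw [congrFun hy0 k, Pi.zero_apply, zero_smul, map_zero]

theorem IsReduced.b_injective {W : Submodule K (Forms K n m)} (hred : IsReduced w W b F) :
    Function.Injective b := by
  intro i j hij
  by_contra hne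
  have hcoeff := hred.coeff_eq i j
  rw [if_neg hne, ← hij, hred.coeff_eq, if_pos rfl] at hcoeff
  exact one_ne_zero hcoeff

/-- The leading monomials have strictly greater weight than the other monomials of the `F_i`. -/
def StrictlyReduced (w : Fin (n + 1) → ℤ) (b : Fin r → (Fin (n + 1) →₀ ℕ))
    (F : Fin r → Forms K n m) : Prop :=
  ∀ i A, coeff A (F i).1 ≠ 0 → A ≠ b i → wt w A < wt w (b i)

theorem IsReduced.eval_zero_familyCoeff {W : Submodule K (Forms K n m)}
    (hred : IsReduced w W b F) (hlt : StrictlyReduced w b F) (i : Fin r)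
    (A : Fin (n + 1) →₀ ℕ) : (familyCoeff w b F i A).eval 0 = if A = b i then 1 else 0 := by
  split_ifs with h
  · rw [h, hred.isGraphData.apply_eq, if_pos rfl, Polynomial.eval_one]
  · rw [familyCoeff, Polynomial.eval_mul, Polynomial.eval_C, Polynomial.eval_pow,
      Polynomial.eval_X]
    by_cases h0 : coeff A (F i).1 = 0
    · rw [h0, zero_mul]
    · have := hlt i A h0 h
      rw [zero_pow (by omega), mul_zero]

theorem IsReduced.mem_fibre_zero_iff {W : Submodule K (Forms K n m)}
    (hred : IsReduced w W b F) (hlt : StrictlyReduced w b F) {v : Forms K n m} :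
    v ∈ fibre (familyForms w b F) 0 ↔ ∀ A, A ∉ Set.range b → coeff A v.1 = 0 := by
  rw [hred.isGraphData.fibre_eq, mem_graphForms]
  simp only [hred.eval_zero_familyCoeff hlt]
  constructor
  · intro h A hA
    rw [h A]
    refine Finset.sum_eq_zero fun i _ => ?_
    rw [if_neg fun h => hA ⟨i, h.symm⟩, mul_zero]
  · intro h A
    by_cases hA : A ∈ Set.range b
    · obtain ⟨i, rfl⟩ := hA
      rw [Finset.sum_eq_single i]
      · simp
      · intro j _ hj
        rw [if_neg fun h => hj (hred.b_injective h).symm, mul_zero]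
      · simp
    · rw [h A hA]
      refine (Finset.sum_eq_zero fun i _ => ?_).symm
      rw [if_neg fun h => hA ⟨i, h.symm⟩, mul_zero]

theorem IsReduced.eval_zero_transCoeff {W : Submodule K (Forms K n m)}
    (hred : IsReduced w W b F) (hlt : StrictlyReduced w b F) (h : GL (Fin (n + 1)) K) (i : Fin r)
    (A : Fin (n + 1) →₀ ℕ) : (transCoeff w b F h i A).eval 0 =
      coeff A (linSubst (h : Matrix (Fin (n + 1)) (Fin (n + 1)) K) (monomial (b i) 1)) := by
  rw [eval_transCoeff]
  congr 3
  ext B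
  rw [coeff_coeffMap, hred.isGraphData.coeff_graphSection, Polynomial.coe_evalRingHom,
    hred.eval_zero_familyCoeff hlt, coeff_monomial]
  simp only [eq_comm]

/-- The matrix by which an upper triangular matrix acts on the limit, whose basis consists of the
monomials `x^{b_i}`. -/
def limitMatrix (b : Fin r → (Fin (n + 1) →₀ ℕ)) (h : GL (Fin (n + 1)) K) :
    Matrix (Fin r) (Fin r) K :=
  Matrix.of fun i j =>
    coeff (b j) (linSubst (h : Matrix (Fin (n + 1)) (Fin (n + 1)) K) (monomial (b i) 1))

/-- The Cramer solution is a quotient of coefficients of states, the numerator belonging to the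
state with `x^{b_i}` replaced by `x^A`. -/
theorem coeff_ne_zero_of_cramer_ne_zero [Infinite K] (hgen : IsGeneric r (gradedPiece J m))
    (hred : IsReduced w (gradedPiece J m) b F) (hlt : StrictlyReduced w b F)
    {h : GL (Fin (n + 1)) K} {A : Fin (n + 1) →₀ ℕ} {k : ℕ} {s : Fin r → K[X]}
    (hs : ∀ j, transCoeff w b F h j A = Polynomial.X ^ k * s j) {i : Fin r}
    (hi : (limitMatrix b h).cramer (fun j => (s j).eval 0) i ≠ 0) : coeff A (F i).1 ≠ 0 := by
  have hupdate : transMatrix w b F h (Function.update b i A) =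
      (transMatrix w b F h b).updateCol i ((Polynomial.X ^ k : K[X]) • s) := by
    ext1 j l
    by_cases hl : l = i
    · subst hl
      simp [transMatrix, hs]
    · simp [transMatrix, hl]
  have hlimit : (transMatrix w b F h b).map (Polynomial.evalRingHom 0) = limitMatrix b h :=
    Matrix.ext fun j l => hred.eval_zero_transCoeff hlt h j (b l)
  rw [← hred.isState_update_iff]
  refine isState_of_det_transMatrix_ne_zero hgen hred h fun hdet => hi ?_
  rw [hupdate, Matrix.det_updateCol_smul, mul_eq_zero] at hdet
  have hdet0 := congrArg (Polynomial.evalRingHom 0)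
    (hdet.resolve_left (pow_ne_zero k Polynomial.X_ne_zero))
  rw [RingHom.map_det, RingHom.mapMatrix_apply, Matrix.map_updateCol, hlimit, map_zero] at hdet0
  exact hdet0

theorem coeff_ne_zero_of_cramer_coeff_ne_zero [Infinite K]
    (hgen : IsGeneric r (gradedPiece J m)) (hred : IsReduced w (gradedPiece J m) b F)
    (hlt : StrictlyReduced w b F) {h : GL (Fin (n + 1)) K} {A : Fin (n + 1) →₀ ℕ} {i : Fin r}
    (hi : (limitMatrix b h).cramer (fun j => coeff A
      (linSubst (h : Matrix (Fin (n + 1)) (Fin (n + 1)) K) (monomial (b j) 1))) i ≠ 0) :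
    coeff A (F i).1 ≠ 0 := by
  refine coeff_ne_zero_of_cramer_ne_zero hgen hred hlt (k := 0)
    (s := fun j => transCoeff w b F h j A) (fun j => by rw [pow_zero, one_mul]) ?_
  simpa only [hred.eval_zero_transCoeff hlt] using hi

theorem limitMatrix_triangular (hw : StrictAnti w) (hb : Function.Injective b)
    {h : GL (Fin (n + 1)) K} (hh : IsUpperTri h) (i j : Fin r)
    (hij : limitMatrix b h i j ≠ 0) : i = j ∨ wt w (b i) < wt w (b j) :=
  ((hasLowest_linSubst_monomial hw hh (b i)).2 (b j) hij).imp_left fun h => (hb h).symm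

theorem limitMatrix_apply_self (hw : StrictAnti w) {h : GL (Fin (n + 1)) K} (hh : IsUpperTri h)
    (i : Fin r) : limitMatrix b h i i =
      diagChar (h : Matrix (Fin (n + 1)) (Fin (n + 1)) K) (b i) :=
  (hasLowest_linSubst_monomial hw hh (b i)).1

theorem det_limitMatrix_ne_zero (hw : StrictAnti w) (hb : Function.Injective b)
    {h : GL (Fin (n + 1)) K} (hh : IsUpperTri h) : (limitMatrix b h).det ≠ 0 :=
  det_ne_zero_of_triangular (limitMatrix_triangular hw hb hh) fun i => by
    rw [limitMatrix_apply_self hw hh]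
    exact diagChar_ne_zero hh h.det_ne_zero _

/-- Among the indices in the support of the Cramer solution take one of maximal weight: there the
system is diagonal, so `x^A` would have greater weight than `x^{b_i}` in `h · x^{b_i}`, but smaller
weight in the reduced basis. -/
theorem coeff_linSubst_monomial_eq_zero [Infinite K] (hw : StrictAnti w)
    (hgen : IsGeneric r (gradedPiece J m)) (hred : IsReduced w (gradedPiece J m) b F)
    (hlt : StrictlyReduced w b F) {h : GL (Fin (n + 1)) K} (hh : IsUpperTri h)
    {A : Fin (n + 1) →₀ ℕ} (hA : A ∉ Set.range b) (j : Fin r) : coeff A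
      (linSubst (h : Matrix (Fin (n + 1)) (Fin (n + 1)) K) (monomial (b j) 1)) = 0 := by
  let q : Fin r → K := fun j =>
    coeff A (linSubst (h : Matrix (Fin (n + 1)) (Fin (n + 1)) K) (monomial (b j) 1))
  have hsolve := Matrix.mulVec_cramer (limitMatrix b h) q
  have hcramer : (limitMatrix b h).cramer q = 0 := by
    by_contra hne
    obtain ⟨i, hi, hdiag⟩ :=
      exists_mulVec_eq_of_triangular (limitMatrix_triangular hw hred.b_injective hh) hne
    rw [hsolve, limitMatrix_apply_self hw hh, Pi.smul_apply, smul_eq_mul] at hdiag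
    have hqi : q i ≠ 0 := right_ne_zero_of_mul
      (hdiag.trans_ne (mul_ne_zero (diagChar_ne_zero hh h.det_ne_zero _) hi))
    have hAb : A ≠ b i := fun h => hA ⟨i, h.symm⟩
    have hlower : wt w A < wt w (b i) :=
      hlt i A (coeff_ne_zero_of_cramer_coeff_ne_zero hgen hred hlt hi) hAb
    exact hlower.not_gt (((hasLowest_linSubst_monomial hw hh (b i)).2 A hqi).resolve_left hAb)
  rw [hcramer, Matrix.mulVec_zero] at hsolve
  exact (mul_eq_zero.1 (congrFun hsolve.symm j)).resolve_left
    (det_limitMatrix_ne_zero hw hred.b_injective hh)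

theorem eq_sum_coeff_smul_monomial {R σ ι : Type*} [CommSemiring R] [Fintype ι]
    {b : ι → σ →₀ ℕ} (hb : Function.Injective b) {p : MvPolynomial σ R}
    (hp : ∀ A, A ∉ Set.range b → coeff A p = 0) :
    p = ∑ i, coeff (b i) p • monomial (b i) 1 := by
  classical
  ext A
  simp only [coeff_sum, coeff_smul, coeff_monomial, smul_eq_mul, mul_ite, mul_one, mul_zero]
  by_cases hA : A ∈ Set.range b
  · obtain ⟨i, rfl⟩ := hA
    simp [hb.eq_iff]
  · rw [hp A hA, Finset.sum_eq_zero fun i _ => if_neg fun h => hA ⟨i, h⟩]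

theorem borelFixed_fibre_zero [Infinite K] (hw : StrictAnti w)
    (hgen : IsGeneric r (gradedPiece J m)) (hred : IsReduced w (gradedPiece J m) b F)
    (hlt : StrictlyReduced w b F) :
    BorelFixed (fibre (familyForms w b F) 0) := by
  intro h hh
  refine Submodule.eq_of_le_of_finrank_eq ?_ (LinearEquiv.finrank_map_eq _ _)
  rintro _ ⟨v, hv, rfl⟩
  rw [SetLike.mem_coe, hred.mem_fibre_zero_iff hlt] at hv
  rw [hred.mem_fibre_zero_iff hlt]
  intro A hA
  change coeff A (linSubst (h : Matrix (Fin (n + 1)) (Fin (n + 1)) K) v.1) = 0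
  rw [eq_sum_coeff_smul_monomial hred.b_injective hv, map_sum, coeff_sum]
  refine Finset.sum_eq_zero fun i _ => ?_
  rw [map_smul, coeff_smul, coeff_linSubst_monomial_eq_zero hw hgen hred hlt hh hA, smul_zero]

end Borel

/-! ### The limit of a generic translate differs from the translate -/

section NonInvariance

variable {K : Type*} [Field K] {n m r : ℕ}

/-- The generic translate is evaluated at the matrix all of whose entries are `1`. -/
theorem coeff_linSubst_mvPolynomialX_monomial_ne_zero [CharZero K] {A B : Fin (n + 1) →₀ ℕ}
    (hAB : A.degree = B.degree) :
    coeff A (linSubst (Matrix.mvPolynomialX (Fin (n + 1)) (Fin (n + 1)) K)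
      (MvPolynomial.map C (monomial B (1 : K)))) ≠ 0 := by
  intro hzero
  have heval := congrArg (MvPolynomial.eval fun _ => (1 : K)) hzero
  have heval_C : (MvPolynomial.eval fun _ : Fin (n + 1) × Fin (n + 1) => (1 : K)).comp C =
      RingHom.id K := by
    ext x
    simp
  rw [← coeff_map, map_linSubst, MvPolynomial.map_map, heval_C, MvPolynomial.map_id, map_zero,
    linSubst, aeval_monomial, map_one, one_mul, Finsupp.prod] at heval
  simp only [Matrix.map_apply, Matrix.mvPolynomialX_apply, eval_X, C_1, one_mul] at heval
  rw [Finset.prod_pow_eq_pow_sum, ← Finsupp.degree_apply, coeff_sum_X_pow_of_fintype,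
    if_pos (show (A.sum fun _ k => k) = B.degree from hAB)] at heval
  exact Nat.cast_ne_zero.2 (Nat.multinomial_pos _ _).ne' heval

theorem stateCoeff_monomial_ne_zero {b : Fin r → (Fin (n + 1) →₀ ℕ)} (hb : Function.Injective b) :
    stateCoeff (fun i => monomial (b i) (1 : K)) b ≠ 0 := by
  intro hzero
  have heval := evalMatrix_stateCoeff 1 (fun i => monomial (b i) (1 : K)) b
  have hone : (Matrix.of fun i j => coeff (b j)
      (linSubst ((1 : GL (Fin (n + 1)) K) : Matrix (Fin (n + 1)) (Fin (n + 1)) K)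
        (monomial (b i) (1 : K)))) = 1 := by
    ext i j
    rw [Matrix.of_apply, Units.val_one, linSubst_one, coeff_monomial, Matrix.one_apply]
    simp only [hb.eq_iff]
  rw [hzero, hone, evalMatrix, map_zero, Matrix.det_one] at heval
  exact zero_ne_one heval

theorem exists_det_limitMatrix_ne_zero_and_coeff_ne_zero [CharZero K]
    {b : Fin r → (Fin (n + 1) →₀ ℕ)} (hb : Function.Injective b) {A : Fin (n + 1) →₀ ℕ}
    {i : Fin r} (hA : A.degree = (b i).degree) :
    ∃ h : GL (Fin (n + 1)) K, (limitMatrix b h).det ≠ 0 ∧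
      coeff A (linSubst (h : Matrix (Fin (n + 1)) (Fin (n + 1)) K) (monomial (b i) 1)) ≠ 0 := by
  obtain ⟨h, hh⟩ := exists_evalMatrix_ne_zero (mul_ne_zero (stateCoeff_monomial_ne_zero hb)
    (coeff_linSubst_mvPolynomialX_monomial_ne_zero (K := K) hA))
  rw [evalMatrix, map_mul, ← evalMatrix, ← evalMatrix, evalMatrix_stateCoeff,
    eval_coeff_linSubst_mvPolynomialX] at hh
  exact ⟨h, left_ne_zero_of_mul hh, right_ne_zero_of_mul hh⟩

variable {w : Fin (n + 1) → ℤ} {J : Ideal (MvPolynomial (Fin (n + 1)) K)}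
  {b : Fin r → (Fin (n + 1) →₀ ℕ)} {F : Fin r → Forms K n m}

/-- If the reduced basis consisted of monomials, then by genericity all translates of their span
would have the same states, hence be spanned by the same monomials. -/
theorem exists_coeff_ne_zero [CharZero K] (hgen : IsGeneric r (gradedPiece J m))
    (hred : IsReduced w (gradedPiece J m) b F) (hlt : StrictlyReduced w b F) (i₀ : Fin r)
    {A : Fin (n + 1) →₀ ℕ} (hdeg : A.degree = m) (hA : A ∉ Set.range b) :
    ∃ i B, coeff B (F i).1 ≠ 0 ∧ B ≠ b i := by
  by_contra! hmonomial
  obtain ⟨h, hdet, hcoeff⟩ := exists_det_limitMatrix_ne_zero_and_coeff_ne_zero (K := K)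
    hred.b_injective (hdeg.trans (hred.degree_eq i₀).symm)
  let q : Fin r → K := fun j =>
    coeff A (linSubst (h : Matrix (Fin (n + 1)) (Fin (n + 1)) K) (monomial (b j) 1))
  have hsolve := Matrix.mulVec_cramer (limitMatrix b h) q
  have hcramer : (limitMatrix b h).cramer q = 0 := by
    funext i
    by_contra hi
    exact hA ⟨i, (hmonomial i A (coeff_ne_zero_of_cramer_coeff_ne_zero hgen hred hlt hi)).symm⟩
  rw [hcramer, Matrix.mulVec_zero] at hsolve
  exact mul_ne_zero hdet hcoeff (congrFun hsolve i₀).symm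

theorem eq_bot_of_gradedPiece_eq_bot {I : Ideal (MvPolynomial (Fin (n + 1)) K)}
    (hI : IsHomogeneousIdeal I) (hm : IsRegular m I) (hbot : gradedPiece I m = ⊥) : I = ⊥ := by
  have hform : ∀ d ≥ m, ∀ q : Forms K n d, q.1 ∈ I → q.1 = 0 := by
    intro d hd q hq
    rw [← mem_gradedPiece, ← hm.gradedPiece_span hd, hbot, mem_gradedPiece,
      Submodule.bot_coe, Set.image_singleton] at hq
    exact zero_dvd_iff.1 (Ideal.mem_span_singleton.1 hq)
  refine (Submodule.eq_bot_iff _).2 fun p hp => ?_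
  rw [← sum_homogeneousComponent p]
  refine Finset.sum_eq_zero fun d _ => ?_
  have hmul := hform (m + d) (Nat.le_add_right m d) ⟨X 0 ^ m * homogeneousComponent d p,
    (isHomogeneous_X_pow _ _).mul (homogeneousComponent_isHomogeneous d p)⟩
    (I.mul_mem_left _ (hI p hp d))
  exact (mul_eq_zero.1 hmul).resolve_left (pow_ne_zero _ (X_ne_zero 0))

theorem eq_top_of_gradedPiece_eq_top {I : Ideal (MvPolynomial (Fin (n + 1)) K)}
    (hI : IsSaturatedIdeal I) (htop : gradedPiece I m = ⊤) : I = ⊤ := by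
  refine (Ideal.eq_top_iff_one I).2 (hI.2 1 fun i => ⟨m, ?_⟩)
  let q : Forms K n m := ⟨X i ^ m, isHomogeneous_X_pow _ _⟩
  have hq : q ∈ gradedPiece I m := htop ▸ Submodule.mem_top
  rwa [mul_one]

theorem exists_notMem_range {I : Ideal (MvPolynomial (Fin (n + 1)) K)}
    (hI : IsSaturatedIdeal I) (htop : I ≠ ⊤) (hr : Module.finrank K (gradedPiece I m) = r)
    {b : Fin r → (Fin (n + 1) →₀ ℕ)} (hinj : Function.Injective b)
    (hb : ∀ i, (b i).degree = m) :
    ∃ A : Fin (n + 1) →₀ ℕ, A.degree = m ∧ A ∉ Set.range b := by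
  by_contra! h
  have himage : Finset.univ.image b = Exps n m := by
    ext A
    simp only [Finset.mem_image, Finset.mem_univ, true_and, mem_exps]
    exact ⟨fun ⟨i, hi⟩ => hi ▸ hb i, h A⟩
  refine htop (eq_top_of_gradedPiece_eq_top (m := m) hI (Submodule.eq_top_of_finrank_eq ?_))
  rw [hr, finrank_forms, ← card_exps, ← himage, Finset.card_image_of_injective _ hinj,
    Finset.card_univ, Fintype.card_fin]

end NonInvariance

/-! ### The tangent vector -/

section Tangent

variable {K : Type*} [Field K] {n m r : ℕ} {w : Fin (n + 1) → ℤ} {W : Submodule K (Forms K n m)}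
  {b : Fin r → (Fin (n + 1) →₀ ℕ)} {F : Fin r → Forms K n m} {k : ℕ}

/-- `k` is the least difference between the weight of a leading monomial and of another monomial
of the reduced basis: the order to which the family is constant at `t = 0`. -/
structure IsGap (w : Fin (n + 1) → ℤ) (b : Fin r → (Fin (n + 1) →₀ ℕ)) (F : Fin r → Forms K n m)
    (k : ℕ) : Prop where
  pos : 0 < k
  wt_add_le : ∀ i A, coeff A (F i).1 ≠ 0 → A ≠ b i → wt w A + k ≤ wt w (b i)
  exists_eq : ∃ i A, coeff A (F i).1 ≠ 0 ∧ wt w A + k = wt w (b i)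

theorem exists_isGap (hlt : StrictlyReduced w b F)
    (h : ∃ i A, coeff A (F i).1 ≠ 0 ∧ A ≠ b i) : ∃ k, IsGap w b F k := by
  classical
  have hex : ∃ k : ℕ, ∃ i A, (coeff A (F i).1 ≠ 0 ∧ A ≠ b i) ∧ wt w A + k = wt w (b i) := by
    obtain ⟨i, A, hA, hne⟩ := h
    have := hlt i A hA hne
    exact ⟨(wt w (b i) - wt w A).toNat, i, A, ⟨hA, hne⟩, by omega⟩
  obtain ⟨i, A, ⟨hA, hne⟩, hk⟩ := Nat.find_spec hex
  refine ⟨Nat.find hex, ⟨?_, fun j B hB hBne => ?_, ⟨i, A, hA, hk⟩⟩⟩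
  · have := hlt i A hA hne
    omega
  · have hwt := hlt j B hB hBne
    have hmin := Nat.find_min' hex (m := (wt w (b j) - wt w B).toNat)
      ⟨j, B, ⟨hB, hBne⟩, by omega⟩
    omega

/-- The coefficients of `t ^ k` in the reduced bases of the family: those of the derivative of
order `k`. -/
def gapCoeff (w : Fin (n + 1) → ℤ) (b : Fin r → (Fin (n + 1) →₀ ℕ)) (F : Fin r → Forms K n m)
    (k : ℕ) (i : Fin r) (A : Fin (n + 1) →₀ ℕ) : K :=
  if wt w A + k = wt w (b i) then coeff A (F i).1 else 0

theorem wt_add_eq_of_gapCoeff_ne_zero {i : Fin r} {A : Fin (n + 1) →₀ ℕ}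
    (h : gapCoeff w b F k i A ≠ 0) : wt w A + k = wt w (b i) :=
  (ite_ne_right_iff.1 h).1

theorem coeff_ne_zero_of_gapCoeff_ne_zero {i : Fin r} {A : Fin (n + 1) →₀ ℕ}
    (h : gapCoeff w b F k i A ≠ 0) : coeff A (F i).1 ≠ 0 :=
  (ite_ne_right_iff.1 h).2

theorem degree_eq_of_gapCoeff_ne_zero {i : Fin r} {A : Fin (n + 1) →₀ ℕ}
    (h : gapCoeff w b F k i A ≠ 0) : A.degree = m :=
  not_imp_comm.1 (Forms.coeff_eq_zero (F i)) (coeff_ne_zero_of_gapCoeff_ne_zero h)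

theorem IsGap.exists_gapCoeff_ne_zero (hk : IsGap w b F k) : ∃ i A, gapCoeff w b F k i A ≠ 0 := by
  obtain ⟨i, A, hA, hwt⟩ := hk.exists_eq
  exact ⟨i, A, ite_ne_right_iff.2 ⟨hwt, hA⟩⟩

theorem IsGap.notMem_range (hk : IsGap w b F k) (hred : IsReduced w W b F) {i : Fin r}
    {A : Fin (n + 1) →₀ ℕ} (h : gapCoeff w b F k i A ≠ 0) : A ∉ Set.range b := by
  rintro ⟨j, rfl⟩
  have hcoeff := coeff_ne_zero_of_gapCoeff_ne_zero h
  have hwt := wt_add_eq_of_gapCoeff_ne_zero h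
  rw [hred.coeff_eq, ite_ne_right_iff] at hcoeff
  rw [hcoeff.1] at hwt
  have := hk.pos
  omega

/-- The forms with coefficients `gapCoeff`. -/
def gapForm (w : Fin (n + 1) → ℤ) (b : Fin r → (Fin (n + 1) →₀ ℕ)) (F : Fin r → Forms K n m)
    (k : ℕ) (i : Fin r) : Forms K n m :=
  graphSection m (gapCoeff w b F k) i

theorem coeff_gapForm (i : Fin r) (A : Fin (n + 1) →₀ ℕ) :
    coeff A (gapForm w b F k i).1 = gapCoeff w b F k i A :=
  coeff_formsEquiv_symm _ (fun _ h => degree_eq_of_gapCoeff_ne_zero h) A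

/-- The remainder of order `k + 1` of the coefficients of the reduced bases of the family. -/
def tailCoeff (w : Fin (n + 1) → ℤ) (b : Fin r → (Fin (n + 1) →₀ ℕ)) (F : Fin r → Forms K n m)
    (k : ℕ) (i : Fin r) (A : Fin (n + 1) →₀ ℕ) : K[X] :=
  if wt w A + k < wt w (b i) then
    Polynomial.C (coeff A (F i).1) * Polynomial.X ^ (wt w (b i) - wt w A - k - 1).toNat
  else 0

/-- The forms with coefficients `tailCoeff`. -/
def tailForm (w : Fin (n + 1) → ℤ) (b : Fin r → (Fin (n + 1) →₀ ℕ)) (F : Fin r → Forms K n m)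
    (k : ℕ) (i : Fin r) : Forms K[X] n m :=
  graphSection m (tailCoeff w b F k) i

theorem coeff_tailForm (i : Fin r) (A : Fin (n + 1) →₀ ℕ) :
    coeff A (tailForm w b F k i).1 = tailCoeff w b F k i A := by
  refine coeff_formsEquiv_symm _ (fun B hB => ?_) A
  by_contra hdeg
  refine hB ?_
  rw [tailCoeff, Forms.coeff_eq_zero _ hdeg, map_zero, zero_mul, ite_self]

theorem IsGap.familyCoeff_eq (hk : IsGap w b F k) (hred : IsReduced w W b F) (i : Fin r)
    (A : Fin (n + 1) →₀ ℕ) :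
    familyCoeff w b F i A = Polynomial.C (if b i = A then 1 else 0) +
      Polynomial.X ^ k * Polynomial.C (gapCoeff w b F k i A) +
        Polynomial.X ^ (k + 1) * tailCoeff w b F k i A := by
  have hpos := hk.pos
  by_cases hA : b i = A
  · subst hA
    rw [hred.isGraphData.apply_eq, gapCoeff, tailCoeff, if_pos rfl, if_pos rfl,
      if_neg (by omega), if_neg (by omega)]
    simp
  · rw [if_neg hA, familyCoeff, gapCoeff, tailCoeff]
    by_cases hcoeff : coeff A (F i).1 = 0
    · simp [hcoeff]
    · obtain hwt | hwt := (hk.wt_add_le i A hcoeff (Ne.symm hA)).eq_or_lt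
      · rw [if_pos hwt, if_neg (by omega), show (wt w (b i) - wt w A).toNat = k by omega,
          map_zero, zero_add, mul_zero, add_zero, mul_comm]
      · rw [if_neg (by omega), if_pos hwt, show (wt w (b i) - wt w A).toNat =
          k + 1 + (wt w (b i) - wt w A - k - 1).toNat by omega, pow_add]
        simp only [map_zero, mul_zero, zero_add]
        ring

theorem coeff_monoForm {A : Fin (n + 1) →₀ ℕ} (hA : A.degree = m) (B : Fin (n + 1) →₀ ℕ) :
    coeff B (monoForm K A hA).1 = if A = B then 1 else 0 :=
  coeff_monomial _ _ _

theorem IsGap.graphSection_eq (hk : IsGap w b F k) (hred : IsReduced w W b F) (i : Fin r) :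
    graphSection m (familyCoeff w b F) i =
      coeffMap Polynomial.C (monoForm K (b i) (hred.degree_eq i)) +
        (Polynomial.X ^ k : K[X]) • coeffMap Polynomial.C (gapForm w b F k i) +
          (Polynomial.X ^ (k + 1) : K[X]) • tailForm w b F k i := by
  refine Forms.ext_coeff fun A => ?_
  rw [hred.isGraphData.coeff_graphSection, hk.familyCoeff_eq hred, Forms.coeff_add,
    Forms.coeff_add, Forms.coeff_smul, Forms.coeff_smul, coeff_coeffMap, coeff_coeffMap,
    coeff_gapForm, coeff_tailForm, coeff_monoForm]

/-- The linear map sending the leading monomials to the derivative of the family. -/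
def gapMap (w : Fin (n + 1) → ℤ) (b : Fin r → (Fin (n + 1) →₀ ℕ)) (F : Fin r → Forms K n m)
    (k : ℕ) : Forms K n m →ₗ[K] Forms K n m :=
  ∑ i, (coeffForm (b i)).smulRight (gapForm w b F k i)

theorem gapMap_apply (v : Forms K n m) :
    gapMap w b F k v = ∑ i, coeff (b i) v.1 • gapForm w b F k i := by
  rw [gapMap, LinearMap.sum_apply]
  rfl

theorem coeff_gapMap (v : Forms K n m) (A : Fin (n + 1) →₀ ℕ) :
    coeff A (gapMap w b F k v).1 = ∑ i, coeff (b i) v.1 * gapCoeff w b F k i A := by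
  rw [gapMap_apply, Forms.coeff_sum]
  exact Finset.sum_congr rfl fun i _ => by rw [Forms.coeff_smul, coeff_gapForm]

/-- The derivative of the family, as a tangent vector. -/
def gapTangent (w : Fin (n + 1) → ℤ) (b : Fin r → (Fin (n + 1) →₀ ℕ)) (F : Fin r → Forms K n m)
    (k : ℕ) (V : Submodule K (Forms K n m)) : GrassTangent V :=
  V.mkQ ∘ₗ gapMap w b F k ∘ₗ V.subtype

theorem gapTangent_apply (V : Submodule K (Forms K n m)) (v : V) :
    gapTangent w b F k V v = V.mkQ (gapMap w b F k v) := rfl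

theorem IsReduced.mkQ_eq_zero_iff (hred : IsReduced w W b F) (hlt : StrictlyReduced w b F)
    {x : Forms K n m} : (fibre (familyForms w b F) 0).mkQ x = 0 ↔
      ∀ A, A ∉ Set.range b → coeff A x.1 = 0 :=
  (Submodule.Quotient.mk_eq_zero _).trans (hred.mem_fibre_zero_iff hlt)

theorem IsReduced.mkQ_eq_mkQ_iff (hred : IsReduced w W b F) (hlt : StrictlyReduced w b F)
    {x y : Forms K n m} :
    (fibre (familyForms w b F) 0).mkQ x = (fibre (familyForms w b F) 0).mkQ y ↔
      ∀ A, A ∉ Set.range b → coeff A x.1 = coeff A y.1 := by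
  rw [← sub_eq_zero, ← map_sub, hred.mkQ_eq_zero_iff hlt]
  simp only [Forms.coeff_sub, sub_eq_zero]

theorem IsGap.gapTangent_ne_zero (hk : IsGap w b F k) (hred : IsReduced w W b F)
    (hlt : StrictlyReduced w b F) : gapTangent w b F k (fibre (familyForms w b F) 0) ≠ 0 := by
  intro hzero
  obtain ⟨i, A, hA⟩ := hk.exists_gapCoeff_ne_zero
  let x : Forms K n m := monoForm K (b i) (hred.degree_eq i)
  have hx : x ∈ fibre (familyForms w b F) 0 := (hred.mem_fibre_zero_iff hlt).2 fun B hB =>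
    (coeff_monoForm _ B).trans (if_neg fun h => hB ⟨i, h⟩)
  have hcoeff := (hred.mkQ_eq_zero_iff hlt).1 (LinearMap.congr_fun hzero ⟨x, hx⟩) A
    (hk.notMem_range hred hA)
  refine hA ?_
  simpa [x, coeff_gapMap, coeff_monoForm, hred.b_injective.eq_iff] using hcoeff

theorem IsGap.sum_smul_graphSection_eq (hk : IsGap w b F k) (hred : IsReduced w W b F)
    {v : Forms K n m} (hv : ∀ A, A ∉ Set.range b → coeff A v.1 = 0) :
    ∑ i, Polynomial.C (coeff (b i) v.1) • graphSection m (familyCoeff w b F) i =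
      coeffMap Polynomial.C v +
        (Polynomial.X ^ k : K[X]) • coeffMap Polynomial.C (gapMap w b F k v) +
          (Polynomial.X ^ (k + 1) : K[X]) •
            ∑ i, Polynomial.C (coeff (b i) v.1) • tailForm w b F k i := by
  have hv_coeff (A : Fin (n + 1) →₀ ℕ) :
      coeff A v.1 = ∑ i, coeff (b i) v.1 * if b i = A then 1 else 0 := by
    conv_lhs => rw [eq_sum_coeff_smul_monomial hred.b_injective hv]
    simp only [coeff_sum, coeff_smul, coeff_monomial, smul_eq_mul]
  refine Forms.ext_coeff fun A => ?_
  simp only [Forms.coeff_add, Forms.coeff_smul, Forms.coeff_sum, coeff_coeffMap, coeff_gapMap,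
    hk.graphSection_eq hred, coeff_gapForm, coeff_monoForm, hv_coeff A, map_sum, map_mul,
    Finset.mul_sum, ← Finset.sum_add_distrib]
  exact Finset.sum_congr rfl fun i _ => by ring

theorem IsGap.isTangentVectorAtZero (hk : IsGap w b F k) (hred : IsReduced w W b F)
    (hlt : StrictlyReduced w b F) :
    IsTangentVectorAtZero (familyForms w b F) (gapTangent w b F k _) := by
  refine ⟨hk.gapTangent_ne_zero hred hlt, k, hk.pos, fun v => ⟨gapMap w b F k v,
    ∑ i, Polynomial.C (coeff (b i) v.1.1) • tailForm w b F k i, rfl, ?_⟩⟩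
  rw [← hk.sum_smul_graphSection_eq hred ((hred.mem_fibre_zero_iff hlt).1 v.2)]
  exact Submodule.sum_mem _ fun i _ =>
    Submodule.smul_mem _ _ (hred.isGraphData.graphSection_mem i)

theorem eval_zero_eq_zero_of_X_pow_mul_eq {R : Type*} [CommRing R] {p q : R[X]} {a c : ℕ}
    (h : Polynomial.X ^ a * p = Polynomial.X ^ c * q) (hac : a < c) : p.eval 0 = 0 := by
  have hcoeff := congrArg (Polynomial.coeff · a) h
  simp only [Polynomial.coeff_X_pow_mul', le_refl, if_true, Nat.sub_self, hac.not_ge,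
    if_false] at hcoeff
  rwa [← Polynomial.coeff_zero_eq_eval_zero]

theorem IsGap.exists_coeff_eq_X_pow_mul (hk : IsGap w b F k) (hred : IsReduced w W b F)
    {x : Forms K[X] n m} (hx : x ∈ familyForms w b F) {A : Fin (n + 1) →₀ ℕ}
    (hA : A ∉ Set.range b) :
    ∃ p : K[X], coeff A x.1 = Polynomial.X ^ k * p ∧ p.eval 0 =
      coeff A (gapMap w b F k (coeffMap (Polynomial.evalRingHom 0) x)).1 := by
  refine ⟨∑ i, coeff (b i) x.1 * (Polynomial.C (gapCoeff w b F k i A) +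
    Polynomial.X * tailCoeff w b F k i A), ?_, ?_⟩
  · rw [hx A, Finset.mul_sum]
    refine Finset.sum_congr rfl fun i _ => ?_
    rw [hk.familyCoeff_eq hred, if_neg fun h => hA ⟨i, h⟩, map_zero]
    ring
  · simp [Polynomial.eval_finsetSum, coeff_gapMap, coeff_coeffMap]

theorem IsGap.exists_X_pow_mul_eq (hk : IsGap w b F k) (hred : IsReduced w W b F) {l : ℕ}
    (hl : 1 ≤ l) {v u : Forms K n m} {q : Forms K[X] n m}
    (hmem : coeffMap Polynomial.C v + (Polynomial.X ^ l : K[X]) • coeffMap Polynomial.C u +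
      (Polynomial.X ^ (l + 1) : K[X]) • q ∈ familyForms w b F)
    {A : Fin (n + 1) →₀ ℕ} (hA : A ∉ Set.range b) (hvA : coeff A v.1 = 0) :
    ∃ s p : K[X], Polynomial.X ^ l * s = Polynomial.X ^ k * p ∧ s.eval 0 = coeff A u.1 ∧
      p.eval 0 = coeff A (gapMap w b F k v).1 := by
  obtain ⟨p, hp, hp0⟩ := hk.exists_coeff_eq_X_pow_mul hred hmem hA
  refine ⟨Polynomial.C (coeff A u.1) + Polynomial.X * coeff A q.1, p, ?_, by simp, ?_⟩
  · rw [← hp, Forms.coeff_add, Forms.coeff_add, Forms.coeff_smul, Forms.coeff_smul,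
      coeff_coeffMap, coeff_coeffMap, hvA, map_zero]
    ring
  · rw [hp0]
    congr 3
    exact Forms.ext_coeff fun B => by simp [coeff_coeffMap, Nat.ne_of_gt hl]

/-- Compare the orders at `t = 0` of both sides of `IsGap.exists_X_pow_mul_eq`: if they were
different, `ψ` or the derivative of the family would vanish. -/
theorem IsGap.eq_gapTangent (hk : IsGap w b F k) (hred : IsReduced w W b F)
    (hlt : StrictlyReduced w b F) {ψ : GrassTangent (fibre (familyForms w b F) 0)}
    (hψ : IsTangentVectorAtZero (familyForms w b F) ψ) : ψ = gapTangent w b F k _ := by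
  obtain ⟨hψ0, l, hl, hψ⟩ := hψ
  choose u q hu hmem using hψ
  have hleading (v) {A : Fin (n + 1) →₀ ℕ} (hA : A ∉ Set.range b) :=
    hk.exists_X_pow_mul_eq hred hl (hmem v) hA ((hred.mem_fibre_zero_iff hlt).1 v.2 A hA)
  obtain hlk | rfl | hkl := lt_trichotomy l k
  · refine absurd (LinearMap.ext fun v => ?_) hψ0
    rw [← hu v, LinearMap.zero_apply, hred.mkQ_eq_zero_iff hlt]
    intro A hA
    obtain ⟨s, p, hsp, hs, -⟩ := hleading v hA
    rw [← hs, eval_zero_eq_zero_of_X_pow_mul_eq hsp hlk]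
  · refine LinearMap.ext fun v => ?_
    rw [← hu v, gapTangent_apply, hred.mkQ_eq_mkQ_iff hlt]
    intro A hA
    obtain ⟨s, p, hsp, hs, hp⟩ := hleading v hA
    rw [← hs, ← hp, mul_left_cancel₀ (pow_ne_zero l Polynomial.X_ne_zero) hsp]
  · refine absurd (LinearMap.ext fun v => ?_) (hk.gapTangent_ne_zero hred hlt)
    rw [gapTangent_apply, LinearMap.zero_apply, hred.mkQ_eq_zero_iff hlt]
    intro A hA
    obtain ⟨s, p, hsp, -, hp⟩ := hleading v hA
    rw [← hp, eval_zero_eq_zero_of_X_pow_mul_eq hsp.symm hkl]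

end Tangent

/-! ### The tangent vector is an eigenvector -/

section Eigenvector

variable {K : Type*} [Field K] {n m r : ℕ} {w : Fin (n + 1) → ℤ}
  {b : Fin r → (Fin (n + 1) →₀ ℕ)} {F : Fin r → Forms K n m} {k : ℕ}

theorem sum_update_add {ι M : Type*} [Fintype ι] [DecidableEq ι] [AddCommMonoid M] (f : ι → M)
    (i : ι) (a : M) : ∑ l, Function.update f i a l + f i = a + ∑ l, f l := by
  rw [Finset.sum_update_of_mem (Finset.mem_univ i), Finset.sdiff_singleton_eq_erase, add_assoc,
    Finset.sum_erase_add _ _ (Finset.mem_univ i)]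

/-- The monomials `x^A ∏_{l ≠ i} x^{b_l}` and `x^B ∏_{l ≠ j} x^{b_l}` have the same degree `r * m`
and the same weight. -/
theorem add_eq_add_of_gapCoeff_ne_zero (hw : Distinguishes w (r * m))
    (hb : ∀ i, (b i).degree = m) {i j : Fin r} {A B : Fin (n + 1) →₀ ℕ}
    (hA : gapCoeff w b F k i A ≠ 0) (hB : gapCoeff w b F k j B ≠ 0) : A + b j = B + b i := by
  have hdeg {l : Fin r} {D : Fin (n + 1) →₀ ℕ} (hD : gapCoeff w b F k l D ≠ 0) :
      (∑ l', Function.update b l D l').degree = r * m := by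
    have hupdate : ∀ l', (Function.update b l D l').degree = m := by
      rw [Function.forall_update_iff b fun _ E => E.degree = m]
      exact ⟨degree_eq_of_gapCoeff_ne_zero hD, fun l' _ => hb l'⟩
    simp [map_sum, hupdate]
  have hwt {l : Fin r} {D : Fin (n + 1) →₀ ℕ} (hD : gapCoeff w b F k l D ≠ 0) :
      wt w (∑ l', Function.update b l D l') = wt w (∑ l', b l') - k := by
    have hsum := congrArg (wt w) (sum_update_add b l D)
    rw [wt_add, wt_add, ← wt_add_eq_of_gapCoeff_ne_zero hD] at hsum
    omega
  have hstate : ∑ l, Function.update b i A l = ∑ l, Function.update b j B l := by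
    by_contra hne
    exact hw _ _ (hdeg hA) (hdeg hB) hne ((hwt hA).trans (hwt hB).symm)
  refine add_right_cancel (b := ∑ l, b l) ?_
  rw [add_right_comm, ← sum_update_add, add_right_comm B, ← sum_update_add, hstate, add_right_comm]

theorem IsGap.transCoeff_eq {W : Submodule K (Forms K n m)} (hk : IsGap w b F k)
    (hred : IsReduced w W b F) (h : GL (Fin (n + 1)) K) (i : Fin r) {A : Fin (n + 1) →₀ ℕ}
    (hA : coeff A (linSubst (h : Matrix (Fin (n + 1)) (Fin (n + 1)) K) (monomial (b i) 1)) = 0) :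
    transCoeff w b F h i A = Polynomial.X ^ k *
      (Polynomial.C (coeff A (glAct m h (gapForm w b F k i)).1) + Polynomial.X *
        coeff A (matAct m ((h : Matrix (Fin (n + 1)) (Fin (n + 1)) K).map Polynomial.C)
          (tailForm w b F k i)).1) := by
  have matAct_C (p : Forms K n m) :
      matAct m ((h : Matrix (Fin (n + 1)) (Fin (n + 1)) K).map Polynomial.C)
        (coeffMap Polynomial.C p) = coeffMap Polynomial.C (glAct m h p) :=
    Subtype.ext (map_linSubst Polynomial.C _ p.1).symm
  have hmono : coeff A (glAct m h (monoForm K (b i) (hred.degree_eq i))).1 = 0 := hA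
  change coeff A (matAct m ((h : Matrix (Fin (n + 1)) (Fin (n + 1)) K).map Polynomial.C)
    (graphSection m (familyCoeff w b F) i)).1 = _
  rw [hk.graphSection_eq hred, map_add, map_add, map_smul, map_smul, matAct_C, matAct_C,
    Forms.coeff_add, Forms.coeff_add, Forms.coeff_smul, Forms.coeff_smul, coeff_coeffMap,
    coeff_coeffMap, hmono, map_zero]
  ring

theorem coeff_glAct_gapForm (hw : StrictAnti w) {h : GL (Fin (n + 1)) K} (hh : IsUpperTri h)
    {i : Fin r} {A : Fin (n + 1) →₀ ℕ} (hA : wt w A + k ≤ wt w (b i)) :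
    coeff A (glAct m h (gapForm w b F k i)).1 =
      diagChar (h : Matrix (Fin (n + 1)) (Fin (n + 1)) K) A * gapCoeff w b F k i A := by
  have hmonomial (B : Fin (n + 1) →₀ ℕ) : monomial B (gapCoeff w b F k i B) =
      gapCoeff w b F k i B • monomial B (1 : K) := by
    rw [smul_monomial, smul_eq_mul, mul_one]
  rw [glAct_apply, (gapForm w b F k i).1.as_sum, map_sum, coeff_sum, Finset.sum_eq_single A]
  · rw [coeff_gapForm, hmonomial, map_smul, coeff_smul,
      (hasLowest_linSubst_monomial hw hh A).1, smul_eq_mul, mul_comm]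
  · intro B _ hB
    by_contra hne
    rw [coeff_gapForm, hmonomial, map_smul, coeff_smul, smul_eq_mul] at hne
    have hwtB := wt_add_eq_of_gapCoeff_ne_zero (left_ne_zero_of_mul hne)
    have hwt := ((hasLowest_linSubst_monomial hw hh B).2 A (right_ne_zero_of_mul hne)).resolve_left
      (Ne.symm hB)
    omega
  · intro hA
    rw [notMem_support_iff.1 hA, monomial_zero, map_zero, coeff_zero]

theorem limitMatrix_mulVec_gapCoeff (hw : StrictAnti w) (hb : Function.Injective b)
    {h : GL (Fin (n + 1)) K} (hh : IsUpperTri h)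
    {i : Fin r} {A : Fin (n + 1) →₀ ℕ} (hA : wt w A + k ≤ wt w (b i)) :
    (limitMatrix b h).mulVec (fun j => gapCoeff w b F k j A) i =
      diagChar (h : Matrix (Fin (n + 1)) (Fin (n + 1)) K) (b i) * gapCoeff w b F k i A := by
  rw [Matrix.mulVec, dotProduct, Finset.sum_eq_single i, limitMatrix_apply_self hw hh]
  · intro j _ hj
    by_contra hne
    have hwtj := wt_add_eq_of_gapCoeff_ne_zero (right_ne_zero_of_mul hne)
    have hwt := (limitMatrix_triangular hw hb hh i j (left_ne_zero_of_mul hne)).resolve_left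
      (Ne.symm hj)
    omega
  · simp

theorem IsGap.exists_diagChar_mul_gapCoeff_eq (hk : IsGap w b F k)
    (hw : Distinguishes w (r * m)) (hb : ∀ i, (b i).degree = m) {h : GL (Fin (n + 1)) K}
    (hh : IsUpperTri h) :
    ∃ c : K, ∀ i A,
      diagChar (h : Matrix (Fin (n + 1)) (Fin (n + 1)) K) A * gapCoeff w b F k i A =
        c * (diagChar (h : Matrix (Fin (n + 1)) (Fin (n + 1)) K) (b i) *
          gapCoeff w b F k i A) := by
  obtain ⟨i₀, A₀, h₀⟩ := hk.exists_gapCoeff_ne_zero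
  let χ := diagChar (h : Matrix (Fin (n + 1)) (Fin (n + 1)) K)
  refine ⟨χ A₀ / χ (b i₀), fun i A => ?_⟩
  by_cases hA : gapCoeff w b F k i A = 0
  · simp [hA]
  · have hχ : χ A * χ (b i₀) = χ A₀ * χ (b i) := by
      simpa only [χ, diagChar_add] using
        congrArg χ (add_eq_add_of_gapCoeff_ne_zero hw hb hA h₀)
    rw [← mul_assoc, div_mul_eq_mul_div, ← hχ,
      mul_div_cancel_right₀ _ (diagChar_ne_zero hh h.det_ne_zero _)]

variable {J : Ideal (MvPolynomial (Fin (n + 1)) K)}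

theorem IsGap.wt_add_le_of_cramer_ne_zero [Infinite K] (hw : StrictAnti w)
    (hgen : IsGeneric r (gradedPiece J m)) (hred : IsReduced w (gradedPiece J m) b F)
    (hlt : StrictlyReduced w b F) (hk : IsGap w b F k) {h : GL (Fin (n + 1)) K}
    (hh : IsUpperTri h) {A : Fin (n + 1) →₀ ℕ} (hA : A ∉ Set.range b) {i : Fin r}
    (hi : (limitMatrix b h).cramer
      (fun j => coeff A (glAct m h (gapForm w b F k j)).1) i ≠ 0) :
    wt w A + k ≤ wt w (b i) := by
  refine hk.wt_add_le i A (coeff_ne_zero_of_cramer_ne_zero hgen hred hlt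
    (fun j => hk.transCoeff_eq hred h j
      (coeff_linSubst_monomial_eq_zero hw hgen hred hlt hh hA j)) (i := i) ?_)
    fun h => hA ⟨i, h.symm⟩
  simpa only [Polynomial.eval_add, Polynomial.eval_C, Polynomial.eval_mul, Polynomial.eval_X,
    zero_mul, add_zero] using hi

/-- The difference of the two sides solves a triangular system. Were it nonzero, at an index of
maximal weight in its support both sides would be given by the characters, and be equal. -/
theorem IsGap.exists_coeff_glAct_gapForm_eq [Infinite K] (hw : StrictAnti w)
    (hdist : Distinguishes w (r * m)) (hgen : IsGeneric r (gradedPiece J m))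
    (hred : IsReduced w (gradedPiece J m) b F) (hlt : StrictlyReduced w b F)
    (hk : IsGap w b F k) {h : GL (Fin (n + 1)) K} (hh : IsUpperTri h) :
    ∃ c : K, ∀ A, A ∉ Set.range b → ∀ i, coeff A (glAct m h (gapForm w b F k i)).1 =
      c * (limitMatrix b h).mulVec (fun j => gapCoeff w b F k j A) i := by
  obtain ⟨c, hc⟩ := hk.exists_diagChar_mul_gapCoeff_eq hdist hred.degree_eq hh
  refine ⟨c, fun A hA => ?_⟩
  let T := limitMatrix b h
  let q : Fin r → K := fun i => coeff A (glAct m h (gapForm w b F k i)).1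
  let δ : Fin r → K := fun i => gapCoeff w b F k i A
  let z : Fin r → K := T.cramer q - (T.det * c) • δ
  have hTz : T.mulVec z = T.det • (q - c • T.mulVec δ) := by
    rw [Matrix.mulVec_sub, Matrix.mulVec_cramer, Matrix.mulVec_smul, smul_sub, mul_smul]
  have hz_support : ∀ i, z i ≠ 0 → wt w A + k ≤ wt w (b i) := by
    intro i hi
    by_contra hwt
    have hcramer : T.cramer q i = 0 := by
      by_contra hne
      exact hwt (hk.wt_add_le_of_cramer_ne_zero hw hgen hred hlt hh hA hne)
    have hδ : δ i = 0 := by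
      by_contra hne
      exact hwt (wt_add_eq_of_gapCoeff_ne_zero hne).le
    exact hi (by simp [z, hcramer, hδ])
  have hz : z = 0 := by
    by_contra hne
    obtain ⟨i, hi, hdiag⟩ :=
      exists_mulVec_eq_of_triangular (limitMatrix_triangular hw hred.b_injective hh) hne
    have hq : q i = c * T.mulVec δ i := by
      rw [limitMatrix_mulVec_gapCoeff hw hred.b_injective hh (hz_support i hi), ← hc]
      exact coeff_glAct_gapForm hw hh (hz_support i hi)
    rw [limitMatrix_apply_self hw hh, hTz, Pi.smul_apply, Pi.sub_apply, Pi.smul_apply, hq,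
      smul_eq_mul c, sub_self, smul_zero] at hdiag
    exact mul_ne_zero (diagChar_ne_zero hh h.det_ne_zero _) hi hdiag.symm
  intro i
  rw [hz, Matrix.mulVec_zero] at hTz
  exact sub_eq_zero.1 ((mul_eq_zero.1 (congrFun hTz.symm i)).resolve_left
    (det_limitMatrix_ne_zero hw hred.b_injective hh))

theorem tangentAct_eq_smul {V : Submodule K (Forms K n m)} {h : GL (Fin (n + 1)) K}
    (hV : V.map (glAct m h).toLinearMap = V) {φ : GrassTangent V} {c : K}
    (hφ : ∀ (v v' : V), glAct m h v.1 = v'.1 →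
      Submodule.Quotient.equiv V V (glAct m h) hV (φ v) = c • φ v') :
    tangentAct h hV φ = c • φ := by
  refine LinearMap.ext fun x => ?_
  refine hφ (((glAct m h).ofSubmodules V V hV).symm x) x ?_
  exact congrArg Subtype.val (((glAct m h).ofSubmodules V V hV).apply_symm_apply x)

theorem coeff_glAct_eq_vecMul_limitMatrix (hb : Function.Injective b) (h : GL (Fin (n + 1)) K)
    {v : Forms K n m} (hv : ∀ A, A ∉ Set.range b → coeff A v.1 = 0) (j : Fin r) :
    coeff (b j) (glAct m h v).1 =
      Matrix.vecMul (fun i => coeff (b i) v.1) (limitMatrix b h) j := by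
  rw [glAct_apply]
  conv_lhs => rw [eq_sum_coeff_smul_monomial hb hv]
  rw [map_sum, coeff_sum]
  exact Finset.sum_congr rfl fun i _ => by rw [map_smul, coeff_smul]; rfl

theorem IsGap.isBorelEigenvector_gapTangent [Infinite K] (hw : StrictAnti w)
    (hdist : Distinguishes w (r * m)) (hgen : IsGeneric r (gradedPiece J m))
    (hred : IsReduced w (gradedPiece J m) b F) (hlt : StrictlyReduced w b F)
    (hk : IsGap w b F k) (hB : BorelFixed (fibre (familyForms w b F) 0)) :
    IsBorelEigenvector hB (gapTangent w b F k _) := by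
  refine ⟨hk.gapTangent_ne_zero hred hlt, fun h hh => ?_⟩
  obtain ⟨c, hc⟩ := hk.exists_coeff_glAct_gapForm_eq hw hdist hgen hred hlt hh
  refine ⟨c, tangentAct_eq_smul (hB h hh) fun v v' hv => ?_⟩
  suffices (fibre (familyForms w b F) 0).mkQ (glAct m h (gapMap w b F k v.1)) =
      (fibre (familyForms w b F) 0).mkQ (c • gapMap w b F k v'.1) from this
  refine (hred.mkQ_eq_mkQ_iff hlt).2 fun A hA => ?_
  have hv0 := (hred.mem_fibre_zero_iff hlt).1 v.2
  have hv' : (fun j => coeff (b j) v'.1.1) =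
      Matrix.vecMul (fun i => coeff (b i) v.1.1) (limitMatrix b h) := funext fun j => by
    rw [← hv, coeff_glAct_eq_vecMul_limitMatrix hred.b_injective h hv0]
  calc coeff A (glAct m h (gapMap w b F k v.1)).1
      = ∑ i, coeff (b i) v.1.1 * (c * (limitMatrix b h).mulVec
          (fun j => gapCoeff w b F k j A) i) := by
        simp only [gapMap_apply, map_sum, map_smul, Forms.coeff_sum, Forms.coeff_smul, hc A hA]
    _ = c * (Matrix.vecMul (fun i => coeff (b i) v.1.1) (limitMatrix b h) ⬝ᵥ
          fun j => gapCoeff w b F k j A) := by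
        rw [← Matrix.dotProduct_mulVec, dotProduct, Finset.mul_sum]
        exact Finset.sum_congr rfl fun i _ => mul_left_comm _ _ _
    _ = coeff A (c • gapMap w b F k v'.1).1 := by
        rw [← hv', Forms.coeff_smul, coeff_gapMap, dotProduct]

end Eigenvector

/-! ### The limit of a generic translate -/

section GenericLimit

variable {K : Type*} [Field K] {n m r : ℕ} {w : Fin (n + 1) → ℤ}

theorem wt_nsmul (w : Fin (n + 1) → ℤ) (k : ℕ) (A : Fin (n + 1) →₀ ℕ) :
    wt w (k • A) = k * wt w A := by
  simp [wt, Finset.mul_sum, mul_left_comm]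

theorem Distinguishes.eq_of_wt_eq {d k : ℕ} (hw : Distinguishes w (k * d)) (hk : k ≠ 0)
    {A B : Fin (n + 1) →₀ ℕ} (hA : A.degree = d) (hB : B.degree = d) (h : wt w A = wt w B) :
    A = B := by
  have hinj := smul_right_injective (Fin (n + 1) →₀ ℕ) hk
  by_contra hne
  refine hw (k • A) (k • B) ?_ ?_ (hinj.ne hne) ?_
  · rw [map_nsmul, hA, smul_eq_mul]
  · rw [map_nsmul, hB, smul_eq_mul]
  · change wt w (k • A) = wt w (k • B)
    rw [wt_nsmul, wt_nsmul, h]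

theorem IsReduced.strictlyReduced {W : Submodule K (Forms K n m)}
    {b : Fin r → (Fin (n + 1) →₀ ℕ)} {F : Fin r → Forms K n m} (hred : IsReduced w W b F)
    (hw : Distinguishes w (r * m)) : StrictlyReduced w b F := fun i A hA hne =>
  (hred.wt_le i A hA).lt_of_ne fun h => hne <|
    hw.eq_of_wt_eq i.pos.ne' (not_imp_comm.1 (Forms.coeff_eq_zero (F i)) hA)
      (hred.degree_eq i) h

variable {P : ℚ[X]} {J : Ideal (MvPolynomial (Fin (n + 1)) K)}

theorem isHilbTangent_of_isTangentVectorAtZero_familyIdeal [Infinite K]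
    (hm : IsRegularityBound K n P m) (hJ : IsSaturatedIdeal J) (hP : HasHilbertPoly J P)
    {φ : GrassTangent (fibre (idealForms (familyIdeal w J) m) 0)}
    (hφ : IsTangentVectorAtZero (idealForms (familyIdeal w J) m) φ) :
    IsHilbTangent (fibre (idealForms (familyIdeal w J) m) 0) φ :=
  isHilbTangent_of_isTangentVectorAtZero (isHomogeneousIdeal_familyIdeal w hJ.1)
    (fun _ _ => mem_familyIdeal_of_X_pow_mul)
    (fun _ hd => gradedPiece_span_limitIdeal w hm hJ hP hd) hφ

theorem borelFixed_fibre_zero_familyIdeal [Infinite K]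
    (hr : Module.finrank K (gradedPiece J m) = r) (hgen : IsGeneric r (gradedPiece J m))
    (hw : StrictAnti w) (hdist : Distinguishes w (r * m)) :
    BorelFixed (fibre (idealForms (familyIdeal w J) m) 0) := by
  obtain ⟨b, F, hred⟩ := exists_isReduced w hr
  rw [hred.idealForms_familyIdeal_eq]
  exact borelFixed_fibre_zero hw hgen hred (hred.strictlyReduced hdist)

theorem exists_isTangentVectorAtZero_familyIdeal [CharZero K] (hm : IsRegular m J)
    (hJ : IsSaturatedIdeal J) (hbot : J ≠ ⊥) (htop : J ≠ ⊤)
    (hr : Module.finrank K (gradedPiece J m) = r) (hgen : IsGeneric r (gradedPiece J m))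
    (hw : StrictAnti w) (hdist : Distinguishes w (r * m))
    (hB : BorelFixed (fibre (idealForms (familyIdeal w J) m) 0)) :
    ∃ φ : GrassTangent (fibre (idealForms (familyIdeal w J) m) 0),
      (∀ ψ : GrassTangent (fibre (idealForms (familyIdeal w J) m) 0),
        IsTangentVectorAtZero (idealForms (familyIdeal w J) m) ψ ↔ ψ = φ) ∧
      IsBorelEigenvector hB φ := by
  obtain ⟨b, F, hred⟩ := exists_isReduced w hr
  have hlt := hred.strictlyReduced hdist
  revert hB
  rw [hred.idealForms_familyIdeal_eq]
  intro hB
  have hr0 : r ≠ 0 := fun hr0 =>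
    hbot (eq_bot_of_gradedPiece_eq_bot hJ.1 hm (Submodule.finrank_eq_zero.1 (hr.trans hr0)))
  obtain ⟨A, hA, hAb⟩ := exists_notMem_range hJ htop hr hred.b_injective hred.degree_eq
  obtain ⟨k, hk⟩ := exists_isGap hlt
    (exists_coeff_ne_zero hgen hred hlt ⟨0, Nat.pos_of_ne_zero hr0⟩ hA hAb)
  refine ⟨_, fun ψ => ⟨hk.eq_gapTangent hred hlt, ?_⟩,
    hk.isBorelEigenvector_gapTangent hw hdist hgen hred hlt hB⟩
  rintro rfl
  exact hk.isTangentVectorAtZero hred hlt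

end GenericLimit

end

end InfGalligo

theorem mainTheorem1_general {K : Type*} [Field K] [CharZero K] (n : ℕ)
    (P : Polynomial ℚ) (m : ℕ) (hm : InfGalligo.IsRegularityBound K n P m)
    (I : Ideal (MvPolynomial (Fin (n + 1)) K))
    (hI : InfGalligo.IsSaturatedIdeal I) (hP : InfGalligo.HasHilbertPoly I P)
    (r : ℕ) (f : Module.Basis (Fin r) K (InfGalligo.gradedPiece I m))
    (w : Fin (n + 1) → ℤ) (hw : StrictAnti w) (hdist : InfGalligo.Distinguishes w (r * m))
    (U : Set (Matrix.GeneralLinearGroup (Fin (n + 1)) K))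
    (hU : U = InfGalligo.genericSet m
      fun i => ((f i : InfGalligo.Forms K n m) : MvPolynomial (Fin (n + 1)) K)) :
    InfGalligo.IsZariskiOpen U ∧ InfGalligo.IsZariskiDense U ∧
    ∀ g ∈ U, ∃ M : Submodule (Polynomial K) (InfGalligo.Forms (Polynomial K) n m),
      (∀ M' : Submodule (Polynomial K) (InfGalligo.Forms (Polynomial K) n m),
        InfGalligo.IsPath P w g (InfGalligo.gradedPiece I m) M' ↔ M' = M) ∧
      InfGalligo.fibre M 0 ∈ InfGalligo.hilb K n P m ∧
      ∃ hB : InfGalligo.BorelFixed (InfGalligo.fibre M 0),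
        I ≠ ⊥ → I ≠ ⊤ →
          ∃ φ : InfGalligo.GrassTangent (InfGalligo.fibre M 0),
            (∀ ψ : InfGalligo.GrassTangent (InfGalligo.fibre M 0),
              InfGalligo.IsTangentVectorAtZero M ψ ↔ ψ = φ) ∧
            InfGalligo.IsHilbTangent (InfGalligo.fibre M 0) φ ∧
            InfGalligo.IsBorelEigenvector hB φ := by
  subst hU
  refine ⟨InfGalligo.isZariskiOpen_genericSet m _, InfGalligo.isZariskiDense_genericSet m _,
    fun g hg => ⟨_, InfGalligo.isPath_iff w hm hI hP g, ?_⟩⟩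
  have hJ := InfGalligo.isSaturatedIdeal_translate g hI
  have hPJ := InfGalligo.hasHilbertPoly_translate g hP
  have hr : Module.finrank K (InfGalligo.gradedPiece (InfGalligo.translate g I) m) = r := by
    rw [InfGalligo.finrank_gradedPiece_translate, Module.finrank_eq_card_basis f, Fintype.card_fin]
  have hgen := InfGalligo.isGeneric_gradedPiece_translate f hg
  have hB := InfGalligo.borelFixed_fibre_zero_familyIdeal hr hgen hw hdist
  refine ⟨(InfGalligo.isHilbCurve_idealForms_familyIdeal w hm hJ hPJ).2 0, hB,
    fun hbot htop => ?_⟩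
  obtain ⟨φ, hunique, heigen⟩ := InfGalligo.exists_isTangentVectorAtZero_familyIdeal (hm _ hJ hPJ)
    hJ (mt InfGalligo.eq_bot_of_translate_eq_bot hbot) (mt InfGalligo.translate_eq_top_iff.1 htop)
    hr hgen hw hdist hB
  exact ⟨φ, hunique, InfGalligo.isHilbTangent_of_isTangentVectorAtZero_familyIdeal hm hJ hPJ
    ((hunique φ).2 rfl), heigen⟩

theorem mainTheorem1 {K : Type*} [Field K] [IsAlgClosed K] [CharZero K] (n : ℕ)
    (P : Polynomial ℚ) (m : ℕ) (hm : InfGalligo.IsGotzmannNumber K n P m)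
    (I : Ideal (MvPolynomial (Fin (n + 1)) K))
    (hI : InfGalligo.IsSaturatedIdeal I) (hP : InfGalligo.HasHilbertPoly I P)
    (r : ℕ) (f : Module.Basis (Fin r) K (InfGalligo.gradedPiece I m))
    (w : Fin (n + 1) → ℤ) (hw : StrictAnti w)
    (hdist : ∀ d ≤ r * m, InfGalligo.Distinguishes w d)
    (U : Set (Matrix.GeneralLinearGroup (Fin (n + 1)) K))
    (hU : U = InfGalligo.genericSet m
      fun i => ((f i : InfGalligo.Forms K n m) : MvPolynomial (Fin (n + 1)) K)) :
    InfGalligo.IsZariskiOpen U ∧ InfGalligo.IsZariskiDense U ∧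
    ∀ g ∈ U, ∃ M : Submodule (Polynomial K) (InfGalligo.Forms (Polynomial K) n m),
      (∀ M' : Submodule (Polynomial K) (InfGalligo.Forms (Polynomial K) n m),
        InfGalligo.IsPath P w g (InfGalligo.gradedPiece I m) M' ↔ M' = M) ∧
      InfGalligo.fibre M 0 ∈ InfGalligo.hilb K n P m ∧
      ∃ hB : InfGalligo.BorelFixed (InfGalligo.fibre M 0),
        I ≠ ⊥ → I ≠ ⊤ →
          ∃ φ : InfGalligo.GrassTangent (InfGalligo.fibre M 0),
            (∀ ψ : InfGalligo.GrassTangent (InfGalligo.fibre M 0),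
              InfGalligo.IsTangentVectorAtZero M ψ ↔ ψ = φ) ∧
            InfGalligo.IsHilbTangent (InfGalligo.fibre M 0) φ ∧
            InfGalligo.IsBorelEigenvector hB φ := by
  exact mainTheorem1_general n P m hm.1 I hI hP r f w hw (hdist _ le_rfl) U hU
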